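/- Consider one of the following two situations. (a) $X$ is a finite connected graph (loops and multiple edges allowed) with first Betti number $g\ge 2$ and all valencies $\ge 3$, $T$ is its universal covering tree with its path metric $d$, $\Gamma$ is the fundamental group of $X$, acting on $T$ by deck transformations, $\Lambda=\partial T$, and $x_0$ is a vertex of $T$. (b) $\Gamma\subset \mathrm{PSL}_2(\mathbb C)$ is a Schottky group of rank $g$: it is generated by $\gamma_1,\dots,\gamma_g$ for which there are $2g$ Jordan domains $D_1,\dots,D_g,D_1',\dots,D_g'$ in $\mathbb P^1(\mathbb C)$ with pairwise disjoint closures such that $\gamma_i$ maps the exterior of $\overline{D_i}$ onto $D_i'$. $\Lambda\subset\mathbb P^1(\mathbb C)$ is the limit set, $T$ is the Cayley graph of $\Gamma$ with respect to $\gamma_1,\dots,\gamma_g$, with its path metric $d$ and with its vertices embedded in hyperbolic space $\mathbb H^3$ as an orbit $\Gamma p$, and $x_0$ is a vertex of $T$. For $\gamma\in\Gamma$ and $\xi\in\Lambda$ let $B(x_0,\gamma x_0,\xi)=\lim_{x\to\xi}\bigl(d(x_0,x)-d(\gamma x_0,x)\bigr)$ be the Busemann function, where $x$ runs through the vertices of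 $T$ and, in case (b), convergence is in $\mathbb H^3\cup\mathbb P^1(\mathbb C)$. Let $\mu=\mu_{x_0}$ be a normalized Patterson--Sullivan measure on $\Lambda$: a weak limit, along a sequence $s\downarrow\delta$, of the probability measures on the orbit of $x_0$ that give $\gamma x_0$ mass proportional to $e^{-s\,\mathrm{dist}(x_0,\gamma x_0)}$, where $\delta$ is the critical exponent of $\sum_\gamma e^{-s\,\mathrm{dist}(x_0,\gamma x_0)}$. Here $\mathrm{dist}=d$ in case (a), and in case (b) $\mathrm{dist}$ is either $d$ or the hyperbolic distance of the corresponding points of $\Gamma p\subset\mathbb H^3$. Let $\mathcal A=C(\Lambda)\rtimes\Gamma$ be the crossed product $C^*$-algebra, the completion in the universal $C^*$-norm of the $*$-algebra of finite sums $\sum_\gamma f_\gamma U_\gamma$, $f_\gamma\in C(\Lambda)$, where $U_\gamma f U_\gamma^*=f\circ\gamma^{-1}$. Then the limits $B(x_0,\gamma x_0,\xi)$ exist, $\mu$ is quasi-invariant under $\Gamma$, and $$\upsilon_\gamma(h)(\xi)=\Bigl(\frac{d\gamma_*\mu}{d\mu}(\xi)\Bigr)^{1/2}h(\gamma^{-1}\xi),\qquad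 \gamma_*\mu(A)=\mu(\gamma^{-1}A),$$ is a unitary representation of $\Gamma$ on $L^2(\Lambda,\mu)$. The algebra $\mathcal A$ acts by bounded operators on $\mathcal H=L^2(\Lambda,\mu)\otimes\ell^2(\Gamma)$, through a $*$-homomorphism $\pi:\mathcal A\to\mathcal B(\mathcal H)$ with $$\pi(fU_\gamma)(h\otimes\gamma')=f\,\upsilon_\gamma(h)\otimes\gamma\gamma'.$$ There is a strongly continuous one-parameter group $\sigma$ of $*$-automorphisms of $\mathcal A$ with $\sigma_t(fU_\gamma)=e^{itB(x_0,\gamma x_0,\cdot)}fU_\gamma$, and it is implemented in the representation $\pi$ by the Hamiltonian $$H(h\otimes\gamma)=B(x_0,\gamma x_0,\cdot)\,h\otimes\gamma :$$ on its maximal domain (all $\sum_\gamma\psi_\gamma\otimes\gamma\in\mathcal H$ with $\sum_\gamma B(x_0,\gamma x_0,\cdot)\psi_\gamma\otimes\gamma\in\mathcal H$) the operator $H$ is self-adjoint, and $$e^{itH}\,\pi(a)\,e^{-itH}=\pi(\sigma_t(a))\qquad\text{for all } a\in\mathcal A,\ t\in\mathbb R .$$ -/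

import Mathlib

open Set Filter Topology MeasureTheory Complex
open scoped ComplexConjugate

noncomputable section

section CrossedProduct

/-- The action of `Γ` on `C(Λ)` by `(γ • f) ξ = f (γ⁻¹ ξ)`. -/
instance translationAction {Γ Λ : Type*} [Group Γ] [TopologicalSpace Λ] [MulAction Γ Λ]
    [ContinuousConstSMul Γ Λ] : MulSemiringAction Γ C(Λ, ℂ) where
  smul γ f := ⟨fun ξ => f (γ⁻¹ • ξ), f.continuous.comp (continuous_const_smul γ⁻¹)⟩
  one_smul f := by ext ξ; change f ((1 : Γ)⁻¹ • ξ) = f ξ; simp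
  mul_smul γ δ f := by
    ext ξ; change f ((γ * δ)⁻¹ • ξ) = f (δ⁻¹ • γ⁻¹ • ξ); rw [mul_inv_rev, mul_smul]
  smul_zero γ := rfl
  smul_add γ f g := rfl
  smul_one γ := rfl
  smul_mul γ f g := rfl

variable (Γ Λ : Type*) [Group Γ] [TopologicalSpace Λ] [MulAction Γ Λ]
  [ContinuousConstSMul Γ Λ]

/-- The algebraic crossed product: finite sums `∑ f_γ U_γ` with `f_γ ∈ C(Λ)`, multiplied by
`f U_γ * g U_δ = f (γ • g) U_{γδ}`. -/
def AlgCrossedProduct : Type _ := SkewMonoidAlgebra C(Λ, ℂ) Γ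

namespace AlgCrossedProduct

instance : Ring (AlgCrossedProduct Γ Λ) := inferInstanceAs (Ring (SkewMonoidAlgebra C(Λ, ℂ) Γ))

instance : Module ℂ (AlgCrossedProduct Γ Λ) :=
  inferInstanceAs (Module ℂ (SkewMonoidAlgebra C(Λ, ℂ) Γ))

variable {Γ Λ}

/-- The monomial `f U_γ`. -/
def mono (f : C(Λ, ℂ)) (γ : Γ) : AlgCrossedProduct Γ Λ := SkewMonoidAlgebra.single γ f

theorem mono_mul (f g : C(Λ, ℂ)) (γ δ : Γ) : mono f γ * mono g δ = mono (f * γ • g) (γ * δ) :=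
  SkewMonoidAlgebra.single_mul_single

theorem mono_add (f g : C(Λ, ℂ)) (γ : Γ) : mono (f + g) γ = mono f γ + mono g γ :=
  SkewMonoidAlgebra.single_add _ _ _

theorem mono_zero (γ : Γ) : mono (0 : C(Λ, ℂ)) γ = 0 := SkewMonoidAlgebra.single_zero _

theorem smul_mono (c : ℂ) (f : C(Λ, ℂ)) (γ : Γ) : c • mono f γ = mono (c • f) γ :=
  SkewMonoidAlgebra.smul_single _ _ _

theorem one_eq : (1 : AlgCrossedProduct Γ Λ) = mono 1 1 := rfl

theorem induction {P : AlgCrossedProduct Γ Λ → Prop} (h0 : P 0) (hm : ∀ f γ, P (mono f γ))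
    (ha : ∀ a b, P a → P b → P (a + b)) (a : AlgCrossedProduct Γ Λ) : P a :=
  SkewMonoidAlgebra.induction_on (p := P) a h0 (fun γ f => hm f γ) (fun {a b} => ha a b)

theorem translate_smul (c : ℂ) (γ : Γ) (f : C(Λ, ℂ)) : γ • (c • f) = c • (γ • f) := rfl

theorem translate_star (γ : Γ) (f : C(Λ, ℂ)) : γ • star f = star (γ • f) := rfl

instance : Algebra ℂ (AlgCrossedProduct Γ Λ) :=
  Algebra.ofModule
    (fun c a b => by
      induction a using induction with
      | h0 => simp
      | ha a a' h h' => rw [smul_add, add_mul, add_mul, smul_add, h, h']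
      | hm f γ =>
        induction b using induction with
        | h0 => simp
        | ha a a' h h' => rw [mul_add, mul_add, smul_add, h, h']
        | hm g δ => rw [smul_mono, mono_mul, mono_mul, smul_mono, smul_mul_assoc])
    (fun c a b => by
      induction a using induction with
      | h0 => simp
      | ha a a' h h' => rw [add_mul, add_mul, smul_add, h, h']
      | hm f γ =>
        induction b using induction with
        | h0 => simp
        | ha a a' h h' => rw [smul_add, mul_add, mul_add, smul_add, h, h']
        | hm g δ => rw [smul_mono, mono_mul, mono_mul, smul_mono, translate_smul, mul_smul_comm])

/-- The involution `(f U_γ)* = U_γ⁻¹ f̄ = (γ⁻¹ • f̄) U_γ⁻¹`, extended additively. -/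
def involution : AlgCrossedProduct Γ Λ →+ AlgCrossedProduct Γ Λ where
  toFun a := SkewMonoidAlgebra.sum a fun γ f => mono (γ⁻¹ • star f) γ⁻¹
  map_zero' := SkewMonoidAlgebra.sum_zero_index
  map_add' a b := SkewMonoidAlgebra.sum_add_index' (fun γ => by rw [star_zero, smul_zero, mono_zero])
    (fun γ f g => by rw [star_add, smul_add, mono_add])

theorem involution_mono (f : C(Λ, ℂ)) (γ : Γ) :
    involution (mono f γ) = mono (γ⁻¹ • star f) γ⁻¹ := by
  refine SkewMonoidAlgebra.sum_single_index (a := γ) (b := f)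
    (h := fun γ (f : C(Λ, ℂ)) => (mono (γ⁻¹ • star f) γ⁻¹ : AlgCrossedProduct Γ Λ)) ?_
  rw [star_zero, smul_zero, mono_zero]

instance : StarRing (AlgCrossedProduct Γ Λ) where
  star := involution
  star_involutive a := by
    induction a using induction with
    | h0 => simp
    | ha a b h h' => rw [map_add, map_add, h, h']
    | hm f γ =>
      rw [involution_mono, involution_mono, ← translate_star, star_star, smul_smul]
      simp
  star_mul a b := by
    change involution (a * b) = involution b * involution a
    induction a using induction with
    | h0 => simp
    | ha a a' h h' => rw [add_mul, map_add, map_add, mul_add, h, h']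
    | hm f γ =>
      induction b using induction with
      | h0 => simp
      | ha a a' h h' => rw [mul_add, map_add, map_add, add_mul, h, h']
      | hm g δ =>
        rw [mono_mul, involution_mono, involution_mono, involution_mono, mono_mul, mul_inv_rev,
          star_mul, ← translate_star, MulSemiringAction.smul_mul, smul_smul, smul_smul]
        simp
  star_add a b := map_add involution a b

theorem star_mono (f : C(Λ, ℂ)) (γ : Γ) : star (mono f γ) = mono (γ⁻¹ • star f) γ⁻¹ :=
  involution_mono f γ

instance : StarModule ℂ (AlgCrossedProduct Γ Λ) where
  star_smul c a := by
    induction a using induction with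
    | h0 => simp
    | ha a b h h' => rw [smul_add, star_add, star_add, smul_add, h, h']
    | hm f γ => rw [smul_mono, star_mono, star_mono, smul_mono, star_smul, translate_smul]

variable [CompactSpace Λ]

/-- A C⋆-seminorm on the algebraic crossed product that is dominated by the norm of `C(Λ)` on
monomials (which is the case for `a ↦ ‖π a‖` for each ⋆-representation `π`). -/
structure IsCStarSeminorm (p : Seminorm ℂ (AlgCrossedProduct Γ Λ)) : Prop where
  mul_le : ∀ a b, p (a * b) ≤ p a * p b
  star_mul_self : ∀ a, p (star a * a) = p a ^ 2
  mono_le : ∀ f γ, p (mono f γ) ≤ ‖f‖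

theorem IsCStarSeminorm.star_eq {p : Seminorm ℂ (AlgCrossedProduct Γ Λ)} (hp : IsCStarSeminorm p)
    (a : AlgCrossedProduct Γ Λ) : p (star a) = p a := by
  have key : ∀ a, p a ≤ p (star a) := fun a => by
    rcases (apply_nonneg p a).eq_or_lt with h | h
    · rw [← h]; exact apply_nonneg p _
    · have := hp.mul_le (star a) a
      rw [hp.star_mul_self, sq] at this
      exact le_of_mul_le_mul_right this h
  exact le_antisymm (by simpa using key (star a)) (key a)

theorem exists_bound (a : AlgCrossedProduct Γ Λ) :
    ∃ C : ℝ, ∀ p : Seminorm ℂ (AlgCrossedProduct Γ Λ), IsCStarSeminorm p → p a ≤ C := by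
  induction a using induction with
  | h0 => exact ⟨0, fun p _ => by simp⟩
  | hm f γ => exact ⟨‖f‖, fun p hp => hp.mono_le f γ⟩
  | ha a b h h' =>
    obtain ⟨C, hC⟩ := h
    obtain ⟨D, hD⟩ := h'
    exact ⟨C + D, fun p hp => (map_add_le_add p a b).trans (add_le_add (hC p hp) (hD p hp))⟩

/-- The universal C⋆-norm: the supremum of all C⋆-seminorms. -/
def univNorm (a : AlgCrossedProduct Γ Λ) : ℝ :=
  ⨆ p : {p : Seminorm ℂ (AlgCrossedProduct Γ Λ) // IsCStarSeminorm p}, p.1 a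

theorem bddAbove (a : AlgCrossedProduct Γ Λ) : BddAbove (range fun
    p : {p : Seminorm ℂ (AlgCrossedProduct Γ Λ) // IsCStarSeminorm p} => p.1 a) := by
  obtain ⟨C, hC⟩ := exists_bound a
  exact ⟨C, by rintro _ ⟨p, rfl⟩; exact hC p.1 p.2⟩

theorem le_univNorm {p : Seminorm ℂ (AlgCrossedProduct Γ Λ)} (hp : IsCStarSeminorm p)
    (a : AlgCrossedProduct Γ Λ) : p a ≤ univNorm a :=
  le_ciSup (bddAbove a) (⟨p, hp⟩ : {p // IsCStarSeminorm p})

instance : Nonempty {p : Seminorm ℂ (AlgCrossedProduct Γ Λ) // IsCStarSeminorm p} :=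
  ⟨⟨0, ⟨fun a b => by simp, fun a => by simp, fun f γ => by simp⟩⟩⟩

theorem univNorm_nonneg (a : AlgCrossedProduct Γ Λ) : 0 ≤ univNorm a :=
  Real.iSup_nonneg fun p => apply_nonneg p.1 a

instance : SeminormedRing (AlgCrossedProduct Γ Λ) :=
  let N : SeminormedAddCommGroup (AlgCrossedProduct Γ Λ) :=
    AddGroupSeminorm.toSeminormedAddCommGroup
      { toFun := univNorm
        map_zero' := by simp [univNorm]
        add_le' := fun a b => ciSup_le fun p => (map_add_le_add p.1 a b).trans
          (add_le_add (le_univNorm p.2 a) (le_univNorm p.2 b))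
        neg' := fun a => by simp [univNorm] }
  { N, (inferInstance : Ring (AlgCrossedProduct Γ Λ)) with
    norm_mul_le := fun a b => ciSup_le fun p => (p.2.mul_le a b).trans
      (mul_le_mul (le_univNorm p.2 a) (le_univNorm p.2 b) (apply_nonneg _ _) (univNorm_nonneg a)) }

theorem norm_def (a : AlgCrossedProduct Γ Λ) : ‖a‖ = univNorm a := rfl

instance : NormedAlgebra ℂ (AlgCrossedProduct Γ Λ) where
  norm_smul_le c a := ciSup_le fun p => by
    rw [map_smul_eq_mul]
    exact mul_le_mul_of_nonneg_left (le_univNorm p.2 a) (norm_nonneg c)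

instance : NormedStarGroup (AlgCrossedProduct Γ Λ) where
  norm_star_le a := ciSup_le fun p => (p.2.star_eq a).le.trans (le_univNorm p.2 a)

theorem norm_mul_self_le (a : AlgCrossedProduct Γ Λ) : ‖a‖ * ‖a‖ ≤ ‖star a * a‖ := by
  have h : ‖a‖ ≤ Real.sqrt ‖star a * a‖ := ciSup_le fun p =>
    Real.le_sqrt_of_sq_le ((p.2.star_mul_self a).symm.le.trans (le_univNorm p.2 _))
  calc ‖a‖ * ‖a‖ ≤ Real.sqrt ‖star a * a‖ * Real.sqrt ‖star a * a‖ :=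
        mul_self_le_mul_self (norm_nonneg a) h
    _ = ‖star a * a‖ := Real.mul_self_sqrt (norm_nonneg _)

end AlgCrossedProduct

variable [CompactSpace Λ]

/-- The C⋆-algebra `C(Λ) ⋊ Γ`: the completion of the algebraic crossed product in the universal
C⋆-norm. -/
def CrossedProduct : Type _ := UniformSpace.Completion (AlgCrossedProduct Γ Λ)

namespace CrossedProduct

open UniformSpace

instance : NormedRing (CrossedProduct Γ Λ) :=
  inferInstanceAs (NormedRing (Completion (AlgCrossedProduct Γ Λ)))

instance : CompleteSpace (CrossedProduct Γ Λ) :=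
  inferInstanceAs (CompleteSpace (Completion (AlgCrossedProduct Γ Λ)))

instance : Algebra ℂ (CrossedProduct Γ Λ) :=
  inferInstanceAs (Algebra ℂ (Completion (AlgCrossedProduct Γ Λ)))

instance : NormedAlgebra ℂ (CrossedProduct Γ Λ) where
  norm_smul_le c a := norm_smul_le (β := Completion (AlgCrossedProduct Γ Λ)) c a

variable {Γ Λ}

/-- The canonical map of the algebraic crossed product to its completion. -/
def ofAlg : AlgCrossedProduct Γ Λ →ₐ[ℂ] CrossedProduct Γ Λ where
  toFun a := ((a : AlgCrossedProduct Γ Λ) : Completion (AlgCrossedProduct Γ Λ))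
  map_one' := rfl
  map_mul' a b := Completion.coe_mul a b
  map_zero' := rfl
  map_add' a b := Completion.coe_add a b
  commutes' _ := rfl

/-- The element `f U_γ` of `C(Λ) ⋊ Γ`. -/
def mono (f : C(Λ, ℂ)) (γ : Γ) : CrossedProduct Γ Λ := ofAlg (AlgCrossedProduct.mono f γ)

theorem norm_ofAlg (a : AlgCrossedProduct Γ Λ) : ‖ofAlg a‖ = AlgCrossedProduct.univNorm a :=
  Completion.norm_coe a

theorem denseRange_ofAlg : DenseRange (ofAlg : AlgCrossedProduct Γ Λ → CrossedProduct Γ Λ) :=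
  Completion.denseRange_coe

theorem continuous_ofAlg : Continuous (ofAlg : AlgCrossedProduct Γ Λ → CrossedProduct Γ Λ) :=
  Completion.continuous_coe _

/-- The involution of the completion, the continuous extension of that of the dense
subalgebra. -/
def involution : CrossedProduct Γ Λ → CrossedProduct Γ Λ :=
  Completion.map (star : AlgCrossedProduct Γ Λ → AlgCrossedProduct Γ Λ)

theorem continuous_involution : Continuous (involution : CrossedProduct Γ Λ → _) :=
  Completion.continuous_map

theorem involution_ofAlg (a : AlgCrossedProduct Γ Λ) : involution (ofAlg a) = ofAlg (star a) :=
  Completion.map_coe (starₗᵢ ℂ (E := AlgCrossedProduct Γ Λ)).isometry.uniformContinuous a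

theorem induction {P : CrossedProduct Γ Λ → Prop} (hc : IsClosed {a | P a})
    (ha : ∀ a, P (ofAlg a)) (a : CrossedProduct Γ Λ) : P a :=
  denseRange_ofAlg.induction_on a hc ha

instance : StarRing (CrossedProduct Γ Λ) where
  star := involution
  star_involutive a := by
    induction a using induction with
    | hc =>
      exact isClosed_eq (continuous_involution.comp continuous_involution) continuous_id
    | ha a => rw [involution_ofAlg, involution_ofAlg, star_star]
  star_mul a b := by
    change involution (a * b) = involution b * involution a
    induction a using induction with
    | hc =>
      exact isClosed_eq (continuous_involution.comp (continuous_mul_const b))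
        (continuous_const.mul continuous_involution)
    | ha a =>
      induction b using induction with
      | hc =>
        exact isClosed_eq (continuous_involution.comp (continuous_const_mul _))
          (continuous_involution.mul continuous_const)
      | ha b =>
        rw [← map_mul, involution_ofAlg, involution_ofAlg, involution_ofAlg, ← map_mul, star_mul]
  star_add a b := by
    change involution (a + b) = involution a + involution b
    induction a using induction with
    | hc =>
      exact isClosed_eq (continuous_involution.comp (continuous_add_const b))
        (continuous_involution.add continuous_const)
    | ha a =>
      induction b using induction with
      | hc =>
        exact isClosed_eq (continuous_involution.comp (continuous_const_add _))
          (continuous_const.add continuous_involution)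
      | ha b =>
        rw [← map_add, involution_ofAlg, involution_ofAlg, involution_ofAlg, ← map_add, star_add]

theorem star_ofAlg (a : AlgCrossedProduct Γ Λ) : star (ofAlg a) = ofAlg (star a) :=
  involution_ofAlg a

theorem continuous_star' : Continuous (star : CrossedProduct Γ Λ → _) := continuous_involution

instance : StarModule ℂ (CrossedProduct Γ Λ) where
  star_smul c a := by
    induction a using induction with
    | hc =>
      exact isClosed_eq (continuous_star'.comp (continuous_const_smul c))
        ((continuous_const_smul (star c)).comp continuous_star')
    | ha a => rw [← map_smul, star_ofAlg, star_ofAlg, star_smul, map_smul]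

instance : CStarRing (CrossedProduct Γ Λ) where
  norm_mul_self_le a := by
    induction a using induction with
    | hc =>
      exact isClosed_le (continuous_norm.mul continuous_norm)
        (continuous_norm.comp (continuous_star'.mul continuous_id))
    | ha a =>
      rw [star_ofAlg, ← map_mul, norm_ofAlg, norm_ofAlg]
      exact AlgCrossedProduct.norm_mul_self_le a

instance : CStarAlgebra (CrossedProduct Γ Λ) where

end CrossedProduct

end CrossedProduct

section Dynamics

/-- The Busemann function `B(x, y, ξ) = lim_{z → ξ} (d(x, z) - d(y, z))`, where `z` runs through
points that converge to `ξ` along the filter `F`. -/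
def busemann {P : Type*} (d : P → P → ℝ) (F : Filter P) (x y : P) : ℝ :=
  limUnder F fun z => d x z - d y z

variable {Γ Λ P : Type*}

/-- The function `(γ, ξ) ↦ B(x₀, γ x₀, ξ)`, where points of `P` converge to `ξ ∈ Λ` along `F ξ`. -/
def busemannCocycle {Γ P Λ : Type*} [Group Γ] [MulAction Γ P] (d : P → P → ℝ) (F : Λ → Filter P)
    (x₀ : P) (γ : Γ) (ξ : Λ) : ℝ :=
  busemann d (F ξ) x₀ (γ • x₀)

/-- The critical exponent of the Poincaré series `∑_γ exp (-s d(x₀, γ x₀))`. -/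
def criticalExponent (Γ : Type*) {P : Type*} [Group Γ] [MulAction Γ P] (d : P → P → ℝ) (x₀ : P) :
    ℝ :=
  sInf {s : ℝ | Summable fun γ : Γ => Real.exp (-s * d x₀ (γ • x₀))}

/-- The mean of `φ` over the orbit of `x₀` with weights proportional to `exp (-s d(x₀, γ x₀))`. -/
def orbitMean (Γ : Type*) {P : Type*} [Group Γ] [MulAction Γ P] (d : P → P → ℝ) (x₀ : P) (s : ℝ)
    (φ : P → ℝ) : ℝ :=
  (∑' γ : Γ, Real.exp (-s * d x₀ (γ • x₀)) * φ (γ • x₀)) /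
    ∑' γ : Γ, Real.exp (-s * d x₀ (γ • x₀))

/-- `μ` is a normalized Patterson--Sullivan measure with base point `x₀` on the boundary `Λ` of
`P`: a weak limit, for some `s n ↓ δ` with `δ` the critical exponent, of the probability measures
`(∑_γ exp (-s d(x₀, γ x₀)))⁻¹ ∑_γ exp (-s d(x₀, γ x₀)) δ_{γ x₀}` on `P ∪ Λ`. Here `P` is discrete
and `F ξ` is the trace on `P` of the neighbourhoods of `ξ ∈ Λ`, so that a continuous function on
`P ∪ Λ` is a pair `(φ, ψ)` of functions on `P` and `Λ`, with `ψ` continuous and `φ → ψ ξ`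
along `F ξ` for each `ξ`. -/
structure IsPattersonSullivan (Γ : Type*) [Group Γ] [MulAction Γ P] [TopologicalSpace Λ]
    [MeasurableSpace Λ] (d : P → P → ℝ) (F : Λ → Filter P) (x₀ : P) (μ : Measure Λ) : Prop where
  isProbabilityMeasure : IsProbabilityMeasure μ
  exists_weak_limit : ∃ s : ℕ → ℝ, (∀ n, criticalExponent Γ d x₀ < s n) ∧
    Tendsto s atTop (𝓝 (criticalExponent Γ d x₀)) ∧
    ∀ (φ : P → ℝ) (ψ : C(Λ, ℝ)), (∃ C, ∀ x, |φ x| ≤ C) →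
      (∀ ξ, Tendsto φ (F ξ) (𝓝 (ψ ξ))) →
      Tendsto (fun n => orbitMean Γ d x₀ (s n) φ) atTop (𝓝 (∫ ξ, ψ ξ ∂μ))

variable (Γ) in
/-- The Hilbert space `L²(Λ, μ) ⊗ ℓ²(Γ)`, as the space `ℓ²(Γ, L²(Λ, μ))`. -/
abbrev HilbertTensor [MeasurableSpace Λ] (μ : Measure Λ) : Type _ :=
  lp (fun _ : Γ => Lp ℂ 2 μ) 2

open Classical in
/-- The elementary tensor `h ⊗ γ` (`γ` stands for the basis vector `δ_γ` of `ℓ²(Γ)`). -/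
def tmul [MeasurableSpace Λ] {μ : Measure Λ} (h : Lp ℂ 2 μ) (γ : Γ) : HilbertTensor Γ μ :=
  lp.single 2 γ h

/-- `φ_γ = b γ · ψ_γ` for all `γ`, where `ψ = ∑ ψ_γ ⊗ γ` and `φ = ∑ φ_γ ⊗ γ`. -/
def IsDiagonalProduct [MeasurableSpace Λ] {μ : Measure Λ} (b : Γ → Λ → ℝ)
    (ψ φ : HilbertTensor Γ μ) : Prop :=
  ∀ γ, φ γ =ᵐ[μ] fun ξ => (b γ ξ : ℂ) * ψ γ ξ

namespace IsDiagonalProduct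

variable [MeasurableSpace Λ] {μ : Measure Λ} {b : Γ → Λ → ℝ} {ψ φ ψ' φ' : HilbertTensor Γ μ}

theorem unique (h : IsDiagonalProduct b ψ φ) (h' : IsDiagonalProduct b ψ φ') : φ = φ' :=
  lp.ext <| funext fun γ => Lp.ext <| (h γ).trans (h' γ).symm

theorem zero : IsDiagonalProduct b (0 : HilbertTensor Γ μ) 0 := fun γ => by
  rw [lp.coeFn_zero, Pi.zero_apply]
  filter_upwards [Lp.coeFn_zero ℂ 2 μ] with ξ h
  rw [h, Pi.zero_apply, mul_zero]

theorem add (h : IsDiagonalProduct b ψ φ) (h' : IsDiagonalProduct b ψ' φ') :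
    IsDiagonalProduct b (ψ + ψ') (φ + φ') := fun γ => by
  rw [lp.coeFn_add, lp.coeFn_add, Pi.add_apply, Pi.add_apply]
  filter_upwards [h γ, h' γ, Lp.coeFn_add (φ γ) (φ' γ), Lp.coeFn_add (ψ γ) (ψ' γ)]
    with ξ h₁ h₂ h₃ h₄
  rw [h₃, h₄, Pi.add_apply, Pi.add_apply, h₁, h₂, mul_add]

theorem smul (c : ℂ) (h : IsDiagonalProduct b ψ φ) :
    IsDiagonalProduct b (c • ψ) (c • φ) := fun γ => by
  rw [lp.coeFn_smul, lp.coeFn_smul, Pi.smul_apply, Pi.smul_apply]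
  filter_upwards [h γ, Lp.coeFn_smul c (φ γ), Lp.coeFn_smul c (ψ γ)] with ξ h₁ h₂ h₃
  rw [h₂, h₃, Pi.smul_apply, Pi.smul_apply, h₁, smul_eq_mul, smul_eq_mul, mul_left_comm]

end IsDiagonalProduct

/-- The operator `H (h ⊗ γ) = b γ · h ⊗ γ` on its maximal domain: all `ψ = ∑ ψ_γ ⊗ γ` for which
`∑ (b γ · ψ_γ) ⊗ γ` is in the Hilbert space. -/
def hamiltonian [MeasurableSpace Λ] (μ : Measure Λ) (b : Γ → Λ → ℝ) :
    HilbertTensor Γ μ →ₗ.[ℂ] HilbertTensor Γ μ where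
  domain :=
    { carrier := {ψ | ∃ φ, IsDiagonalProduct b ψ φ}
      zero_mem' := ⟨0, .zero⟩
      add_mem' := fun ⟨_, h⟩ ⟨_, h'⟩ => ⟨_, h.add h'⟩
      smul_mem' := fun c _ ⟨_, h⟩ => ⟨_, h.smul c⟩ }
  toFun :=
    { toFun := fun ψ => ψ.2.choose
      map_add' := fun ψ ψ' =>
        (ψ + ψ').2.choose_spec.unique (ψ.2.choose_spec.add ψ'.2.choose_spec)
      map_smul' := fun c ψ => (c • ψ).2.choose_spec.unique (ψ.2.choose_spec.smul c) }

theorem hamiltonian_spec [MeasurableSpace Λ] (μ : Measure Λ) (b : Γ → Λ → ℝ)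
    (ψ : (hamiltonian μ b).domain) :
    IsDiagonalProduct b (ψ : HilbertTensor Γ μ) (hamiltonian μ b ψ) :=
  ψ.2.choose_spec

/-- `W t = exp (i t H)` for all `t`: `W` is the strongly continuous one-parameter unitary group
with infinitesimal generator `i H`. -/
structure IsUnitaryGroupOf {E : Type*} [NormedAddCommGroup E] [InnerProductSpace ℂ E]
    (H : E →ₗ.[ℂ] E) (W : ℝ → E ≃ₗᵢ[ℂ] E) : Prop where
  zero : W 0 = 1
  add : ∀ s t, W (s + t) = W s * W t
  continuous : ∀ ψ, Continuous fun t => W t ψ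
  generator : ∀ ψ φ, HasDerivAt (fun t => W t ψ) φ 0 ↔ ∃ h : ψ ∈ H.domain, φ = I • H ⟨ψ, h⟩

section

variable [Group Γ] [TopologicalSpace Λ] [CompactSpace Λ] [MulAction Γ Λ] [ContinuousConstSMul Γ Λ]

/-- `σ` is a time evolution (a strongly continuous one-parameter group of ⋆-automorphisms) of
`C(Λ) ⋊ Γ` with `σ_t (f U_γ) = exp (i t b γ) f U_γ`. -/
structure IsTimeEvolution (b : Γ → Λ → ℝ)
    (σ : ℝ → CrossedProduct Γ Λ ≃⋆ₐ[ℂ] CrossedProduct Γ Λ) : Prop where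
  zero : ∀ a, σ 0 a = a
  add : ∀ s t a, σ (s + t) a = σ s (σ t a)
  continuous : ∀ a, Continuous fun t => σ t a
  mono : ∀ (t : ℝ) (f : C(Λ, ℂ)) γ, ∃ f' : C(Λ, ℂ), (∀ ξ, f' ξ = exp (I * (t : ℝ) * b γ ξ) * f ξ) ∧
    σ t (CrossedProduct.mono f γ) = CrossedProduct.mono f' γ

variable [MeasurableSpace Λ] [BorelSpace Λ]

/-- `υ` is the unitary representation
`υ_γ h (ξ) = (d(γ_* μ)/dμ (ξ))^{1/2} h (γ⁻¹ ξ)` of `Γ` on `L²(Λ, μ)`, with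
`γ_* μ (A) = μ (γ⁻¹ A)`. -/
def IsKoopman (μ : Measure Λ) (υ : Γ →* (Lp ℂ 2 μ ≃ₗᵢ[ℂ] Lp ℂ 2 μ)) : Prop :=
  ∀ γ (h : Lp ℂ 2 μ), υ γ h =ᵐ[μ] fun ξ =>
    (√((μ.map (γ • ·)).rnDeriv μ ξ).toReal : ℂ) * h (γ⁻¹ • ξ)

/-- `π` is a representation of `C(Λ) ⋊ Γ` with
`π (f U_γ) (h ⊗ γ') = f υ_γ(h) ⊗ γ γ'`. -/
def IsCovariantRepresentation (μ : Measure Λ) (υ : Γ →* (Lp ℂ 2 μ ≃ₗᵢ[ℂ] Lp ℂ 2 μ))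
    (π : CrossedProduct Γ Λ →⋆ₐ[ℂ] (HilbertTensor Γ μ →L[ℂ] HilbertTensor Γ μ)) : Prop :=
  ∀ (f : C(Λ, ℂ)) (γ : Γ) (h : Lp ℂ 2 μ) (γ' : Γ), ∃ k : Lp ℂ 2 μ,
    (k =ᵐ[μ] fun ξ => f ξ * υ γ h ξ) ∧
      π (CrossedProduct.mono f γ) (tmul h γ') = tmul k (γ * γ')

/-- The representation of `C(Λ) ⋊ Γ` on `L²(Λ, μ) ⊗ ℓ²(Γ)` exists, and in it the time evolution
`σ_t (f U_γ) = exp (i t B(x₀, γ x₀, ·)) f U_γ` is implemented by the Hamiltonian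
`H (h ⊗ γ) = B(x₀, γ x₀, ·) h ⊗ γ`. -/
structure BusemannDynamicsImplemented (Γ : Type*) [Group Γ] [MulAction Γ Λ]
    [ContinuousConstSMul Γ Λ] [MulAction Γ P] (d : P → P → ℝ) (F : Λ → Filter P) (x₀ : P) (μ : Measure Λ) :
    Prop where
  /-- The Busemann function is a genuine limit. -/
  neBot : ∀ ξ, (F ξ).NeBot
  tendsto_busemann : ∀ (γ : Γ) ξ,
    Tendsto (fun z => d x₀ z - d (γ • x₀) z) (F ξ) (𝓝 (busemannCocycle d F x₀ γ ξ))
  /-- The measure is quasi-invariant, so that the Radon--Nikodym derivatives exist. -/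
  quasiInvariant : ∀ γ : Γ, μ.map (γ • ·) ≪ μ
  implemented : ∃ (υ : Γ →* (Lp ℂ 2 μ ≃ₗᵢ[ℂ] Lp ℂ 2 μ))
    (π : CrossedProduct Γ Λ →⋆ₐ[ℂ] (HilbertTensor Γ μ →L[ℂ] HilbertTensor Γ μ))
    (σ : ℝ → CrossedProduct Γ Λ ≃⋆ₐ[ℂ] CrossedProduct Γ Λ)
    (W : ℝ → HilbertTensor Γ μ ≃ₗᵢ[ℂ] HilbertTensor Γ μ),
    IsKoopman μ υ ∧
    IsCovariantRepresentation μ υ π ∧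
    IsTimeEvolution (busemannCocycle d F x₀) σ ∧
    (∀ (h : Lp ℂ 2 μ) (γ : Γ), ∃ k : Lp ℂ 2 μ,
      (k =ᵐ[μ] fun ξ => (busemannCocycle d F x₀ γ ξ : ℂ) * h ξ) ∧
      ∃ hdom : tmul h γ ∈ (hamiltonian μ (busemannCocycle (Γ := Γ) d F x₀)).domain,
        hamiltonian μ (busemannCocycle d F x₀) ⟨tmul h γ, hdom⟩ =
          tmul k γ) ∧
    IsSelfAdjoint (hamiltonian μ (busemannCocycle (Γ := Γ) d F x₀)) ∧
    IsUnitaryGroupOf (hamiltonian μ (busemannCocycle (Γ := Γ) d F x₀)) W ∧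
    ∀ t a ψ, W t (π a (W (-t) ψ)) = π (σ t a) ψ

end

end Dynamics

section Trees

open SimpleGraph Opposite

variable {W : Type*}

/-- The space of ends of a graph. For a locally finite tree it is the boundary at infinity. -/
def GraphEnd (T : SimpleGraph W) : Type _ := T.end

namespace GraphEnd

variable {T : SimpleGraph W}

/-- The component of `T ∖ K` in which the end lies. -/
def comp (ξ : GraphEnd T) (K : Finset W) : T.ComponentCompl (K : Set W) := ξ.1 (op K)

theorem comp_hom (ξ : GraphEnd T) {K L : Finset W} (h : K ⊆ L) :
    (ξ.comp L).hom (Finset.coe_subset.2 h) = ξ.comp K :=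
  ξ.2 (CategoryTheory.opHomOfLE h)

theorem ext {ξ η : GraphEnd T} (h : ∀ K, ξ.comp K = η.comp K) : ξ = η :=
  Subtype.ext (funext fun K => h K.unop)

/-- The end with prescribed components. -/
def mk (C : ∀ K : Finset W, T.ComponentCompl (K : Set W))
    (h : ∀ (K L : Finset W) (h : K ⊆ L), (C L).hom (Finset.coe_subset.2 h) = C K) : GraphEnd T :=
  ⟨fun K => C K.unop, fun f => h _ _ (CategoryTheory.leOfHom f.unop)⟩

/-- The topology of the inverse limit of the discrete sets of components of the `T ∖ K`, with `K`
finite. -/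
instance : TopologicalSpace (GraphEnd T) :=
  TopologicalSpace.induced (fun ξ K => ξ.comp K)
    (@Pi.topologicalSpace (Finset W) (fun K => T.ComponentCompl (K : Set W)) fun _ => ⊥)

instance : MeasurableSpace (GraphEnd T) := borel _

instance : BorelSpace (GraphEnd T) := ⟨rfl⟩

/-- The vertices converge to the end `ξ` along this filter: eventually they are in the
component of `T ∖ K` given by `ξ`, for each finite `K`. -/
def nhdsVertices (ξ : GraphEnd T) : Filter W :=
  ⨅ K : Finset W, 𝓟 (ξ.comp K : Set W)

/-- The image under an automorphism of a component of `T ∖ φ⁻¹ K`, as a component of `T ∖ K`. -/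
def mapComponent (φ : T ≃g T) (K : Finset W)
    (C : T.ComponentCompl (K.map φ.symm.toEquiv.toEmbedding : Set W)) :
    T.ComponentCompl (K : Set W) :=
  C.map
    { toFun := fun v => ⟨φ v.1, fun h => v.2 (by
        simp only [Finset.coe_map, Set.mem_image]
        exact ⟨φ v.1, h, φ.symm_apply_apply v.1⟩)⟩
      map_rel' := fun {v w} h => φ.map_adj_iff.2 h }

theorem mem_mapComponent (φ : T ≃g T) (K : Finset W)
    (C : T.ComponentCompl (K.map φ.symm.toEquiv.toEmbedding : Set W)) {v : W} (hv : v ∈ C) :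
    φ v ∈ mapComponent φ K C := by
  obtain ⟨h, rfl⟩ := hv
  exact ⟨_, rfl⟩

theorem eq_of_mem {K : Set W} {C D : T.ComponentCompl K} {v : W} (hC : v ∈ C) (hD : v ∈ D) :
    C = D := by
  obtain ⟨h, rfl⟩ := hC
  obtain ⟨h', rfl⟩ := hD
  rfl

theorem comp_mono (ξ : GraphEnd T) {K L : Finset W} (h : K ⊆ L) {v : W} (hv : v ∈ ξ.comp L) :
    v ∈ ξ.comp K := by
  rw [← ξ.comp_hom h]
  exact ComponentCompl.subset_hom _ _ hv

/-- The action of the automorphisms on the ends: `(φ ξ)(K) = φ (ξ (φ⁻¹ K))`. -/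
instance : MulAction (T ≃g T) (GraphEnd T) where
  smul φ ξ := mk (fun K => mapComponent φ K (ξ.comp _)) fun K L h => by
    obtain ⟨v, hv⟩ := (ξ.comp (L.map φ.symm.toEquiv.toEmbedding)).nonempty
    exact eq_of_mem (ComponentCompl.subset_hom _ _ (mem_mapComponent φ L _ hv))
      (mem_mapComponent φ K _ (ξ.comp_mono (Finset.map_subset_map.2 h) hv))
  one_smul ξ := ext fun K => by
    obtain ⟨v, hv⟩ := (ξ.comp (K.map (1 : T ≃g T).symm.toEquiv.toEmbedding)).nonempty
    refine eq_of_mem (mem_mapComponent 1 K _ hv) (ξ.comp_mono (fun w hw => ?_) hv)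
    simp only [Finset.mem_map]
    exact ⟨w, hw, rfl⟩
  mul_smul φ ψ ξ := ext fun K => by
    obtain ⟨v, hv⟩ := (ξ.comp (K.map (φ * ψ).symm.toEquiv.toEmbedding)).nonempty
    refine eq_of_mem (mem_mapComponent (φ * ψ) K _ hv)
      (mem_mapComponent φ K _ (mem_mapComponent ψ _ _ (ξ.comp_mono (fun w hw => ?_) hv)))
    simp only [Finset.mem_map] at hw ⊢
    obtain ⟨_, ⟨u, hu, rfl⟩, rfl⟩ := hw
    exact ⟨u, hu, rfl⟩

theorem smul_comp (φ : T ≃g T) (ξ : GraphEnd T) (K : Finset W) :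
    (φ • ξ).comp K = mapComponent φ K (ξ.comp _) := rfl

theorem continuous_iff {X : Type*} [TopologicalSpace X] {f : X → GraphEnd T} :
    Continuous f ↔ ∀ K, @Continuous _ _ _ ⊥ fun x => (f x).comp K := by
  rw [continuous_induced_rng]
  exact @continuous_pi_iff _ _ _ _ (fun K : Finset W => (⊥ : TopologicalSpace _)) _

theorem continuous_comp (K : Finset W) :
    @Continuous _ _ _ ⊥ fun ξ : GraphEnd T => ξ.comp K :=
  continuous_iff.1 continuous_id K

instance : ContinuousConstSMul (T ≃g T) (GraphEnd T) where
  continuous_const_smul φ := continuous_iff.2 fun K =>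
    @Continuous.comp _ _ _ _ ⊥ ⊥ _ (mapComponent φ K) continuous_bot (continuous_comp _)

/-- The space of ends is compact as soon as the sets of components are finite. -/
theorem compactSpace (hT : ∀ K : Finset W, Finite (T.ComponentCompl (K : Set W))) :
    CompactSpace (GraphEnd T) := by
  let : ∀ K : Finset W, TopologicalSpace (T.ComponentCompl (K : Set W)) := fun _ => ⊥
  have : ∀ K : Finset W, DiscreteTopology (T.ComponentCompl (K : Set W)) := fun _ => ⟨rfl⟩
  let e : GraphEnd T → ∀ K : Finset W, T.ComponentCompl (K : Set W) := fun ξ K => ξ.comp K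
  have he : IsInducing e := ⟨rfl⟩
  have hr : range e = ⋂ (K : Finset W) (L : Finset W) (h : K ⊆ L),
      {C | (C L).hom (Finset.coe_subset.2 h) = C K} := by
    ext C
    simp only [mem_range, mem_iInter, mem_ofPred_eq]
    exact ⟨by rintro ⟨ξ, rfl⟩ K L h; exact ξ.comp_hom h, fun h => ⟨mk C h, rfl⟩⟩
  have hc : IsClosed (range e) := by
    rw [hr]
    refine isClosed_iInter fun K => isClosed_iInter fun L => isClosed_iInter fun h => ?_
    exact isClosed_eq (continuous_of_discreteTopology.comp (continuous_apply L))
      (continuous_apply K)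
  exact ⟨by rw [he.isCompact_iff, image_univ]; exact hc.isCompact⟩

end GraphEnd

/-- A graph, possibly with loops and multiple edges. An unoriented edge is a pair `e ≠ inv e` of
oriented edges. -/
structure MultiGraph (V E : Type*) where
  src : E → V
  inv : E → E
  inv_inv : ∀ e, inv (inv e) = e
  inv_ne : ∀ e, inv e ≠ e

namespace MultiGraph

variable {V E : Type*} (X : MultiGraph V E)

/-- The end point of an oriented edge. -/
def tgt (e : E) : V := X.src (X.inv e)

/-- Any two vertices are joined by an edge path, and there is at least one vertex. -/
def Connected : Prop :=
  Nonempty V ∧ ∀ v w, Relation.ReflTransGen (fun a b => ∃ e, X.src e = a ∧ X.tgt e = b) v w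

/-- The valency of a vertex (a loop counts twice). -/
def valency (v : V) : ℕ := Nat.card {e // X.src e = v}

/-- The first Betti number of a finite connected graph: the number of unoriented edges minus the
number of vertices plus one. -/
def bettiNumber (_ : MultiGraph V E) : ℤ := (Nat.card E / 2 : ℕ) - Nat.card V + 1

/-- A covering of `X` by a tree `T`: a morphism of graphs that is bijective on the sets of oriented
edges that start at a vertex. -/
structure UniversalCovering (T : SimpleGraph W) where
  isTree : T.IsTree
  vert : W → V
  edge : T.Dart → E
  src_edge : ∀ d, X.src (edge d) = vert d.fst
  edge_symm : ∀ d, edge d.symm = X.inv (edge d)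
  existsUnique_lift : ∀ w e, X.src e = vert w → ∃! d : T.Dart, d.fst = w ∧ edge d = e

namespace UniversalCovering

variable {X} {T : SimpleGraph W} (c : X.UniversalCovering T)

/-- The fundamental group of `X` as the group of deck transformations of the universal covering:
the automorphisms of the tree over `X`. -/
def deckGroup : Subgroup (T ≃g T) where
  carrier := {φ | (∀ w, c.vert (φ w) = c.vert w) ∧
    ∀ d : T.Dart, c.edge (φ.toHom.mapDart d) = c.edge d}
  one_mem' := ⟨fun _ => rfl, fun _ => rfl⟩
  mul_mem' {φ ψ} h h' := ⟨fun w => (h.1 (ψ w)).trans (h'.1 w),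
    fun d => (h.2 (ψ.toHom.mapDart d)).trans (h'.2 d)⟩
  inv_mem' {φ} h := by
    refine ⟨fun w => ?_, fun d => ?_⟩
    · have := h.1 (φ⁻¹ w)
      rw [show φ (φ⁻¹ w) = w from φ.apply_symm_apply w] at this
      exact this.symm
    · have := h.2 ((φ⁻¹ : T ≃g T).toHom.mapDart d)
      rw [← this]
      congr 1
      refine SimpleGraph.Dart.ext _ _ (Prod.ext ?_ ?_)
      · exact φ.apply_symm_apply d.fst
      · exact φ.apply_symm_apply d.snd

/-- The boundary `∂T` of the universal covering tree. -/
def Boundary (_ : X.UniversalCovering T) : Type _ := GraphEnd T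

instance : TopologicalSpace c.Boundary := inferInstanceAs (TopologicalSpace (GraphEnd T))

instance : MeasurableSpace c.Boundary := inferInstanceAs (MeasurableSpace (GraphEnd T))

instance : BorelSpace c.Boundary := inferInstanceAs (BorelSpace (GraphEnd T))

instance : MulAction c.deckGroup c.Boundary :=
  inferInstanceAs (MulAction c.deckGroup (GraphEnd T))

instance : ContinuousConstSMul c.deckGroup c.Boundary :=
  ⟨fun γ => continuous_const_smul (T := GraphEnd T) (γ : T ≃g T)⟩

theorem finite_neighborSet (c : X.UniversalCovering T) [Finite E] (w : W) : Finite (T.neighborSet w) := by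
  refine Finite.of_injective
    (fun v : T.neighborSet w => c.edge ⟨(w, v.1), v.2⟩) fun v v' h => ?_
  have := (c.existsUnique_lift w _ (c.src_edge ⟨(w, v.1), v.2⟩)).unique
    (y₁ := ⟨(w, v.1), v.2⟩) (y₂ := ⟨(w, v'.1), v'.2⟩) ⟨rfl, rfl⟩ ⟨rfl, h.symm⟩
  exact Subtype.ext (congrArg (fun d : T.Dart => d.snd) this)

instance [Finite E] : CompactSpace c.Boundary := by
  let : T.LocallyFinite := fun w => by
    have := c.finite_neighborSet w
    exact Fintype.ofFinite _
  have : Fact T.Preconnected := ⟨c.isTree.connected.preconnected⟩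
  exact GraphEnd.compactSpace fun K => inferInstance

/-- The distance of the tree: the number of edges of the shortest path. -/
def dist (_ : X.UniversalCovering T) (v w : W) : ℝ := T.dist v w

/-- The trace on the set of vertices of the neighbourhoods of a boundary point. -/
def nhdsVertices (ξ : c.Boundary) : Filter W := GraphEnd.nhdsVertices (T := T) ξ

end UniversalCovering

end MultiGraph

end Trees

section Schottky

open Matrix OnePoint
open scoped MatrixGroups ComplexOrder

/-- Hyperbolic space `ℍ³ = SL(2, ℂ) / SU(2)`: the positive definite Hermitian `2 × 2` matrices of
determinant one, on which `A ∈ SL(2, ℂ)` acts by `A P A*`. -/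
def HypSpace : Type := {P : Matrix (Fin 2) (Fin 2) ℂ // P.PosDef ∧ P.det = 1}

namespace HypSpace

theorem smul_mem (A : SL(2, ℂ)) (P : HypSpace) :
    ((A : Matrix (Fin 2) (Fin 2) ℂ) * P.1 * (A : Matrix (Fin 2) (Fin 2) ℂ)ᴴ).PosDef ∧
      ((A : Matrix (Fin 2) (Fin 2) ℂ) * P.1 * (A : Matrix (Fin 2) (Fin 2) ℂ)ᴴ).det = 1 := by
  refine ⟨P.2.1.mul_mul_conjTranspose_same (Matrix.vecMul_injective_iff_isUnit.2
    ((Matrix.isUnit_iff_isUnit_det _).2 (by simp))), ?_⟩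
  simp [Matrix.det_mul, Matrix.det_conjTranspose, P.2.2]

instance : MulAction SL(2, ℂ) HypSpace where
  smul A P := ⟨(A : Matrix (Fin 2) (Fin 2) ℂ) * P.1 * (A : Matrix (Fin 2) (Fin 2) ℂ)ᴴ,
    smul_mem A P⟩
  one_smul P := Subtype.ext (by
    change ((1 : SL(2, ℂ)) : Matrix (Fin 2) (Fin 2) ℂ) * P.1 *
      ((1 : SL(2, ℂ)) : Matrix (Fin 2) (Fin 2) ℂ)ᴴ = P.1
    simp)
  mul_smul A B P := Subtype.ext (by
    change ((A * B : SL(2, ℂ)) : Matrix (Fin 2) (Fin 2) ℂ) * P.1 *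
      ((A * B : SL(2, ℂ)) : Matrix (Fin 2) (Fin 2) ℂ)ᴴ =
      (A : Matrix (Fin 2) (Fin 2) ℂ) * ((B : Matrix (Fin 2) (Fin 2) ℂ) * P.1 *
        (B : Matrix (Fin 2) (Fin 2) ℂ)ᴴ) * (A : Matrix (Fin 2) (Fin 2) ℂ)ᴴ
    rw [Matrix.SpecialLinearGroup.coe_mul, Matrix.conjTranspose_mul]
    simp only [Matrix.mul_assoc])

theorem smul_coe (A : SL(2, ℂ)) (P : HypSpace) :
    (A • P).1 = (A : Matrix (Fin 2) (Fin 2) ℂ) * P.1 * (A : Matrix (Fin 2) (Fin 2) ℂ)ᴴ := rfl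

/-- The hyperbolic distance (of curvature `-1`), `cosh d(P, Q) = tr(P⁻¹ Q) / 2`. -/
def dist (P Q : HypSpace) : ℝ := Real.arcosh ((P.1⁻¹ * Q.1).trace.re / 2)

/-- The embedding of `ℍ³` in the closed ball of positive semidefinite Hermitian matrices of
trace one. -/
def toBall (P : HypSpace) : Matrix (Fin 2) (Fin 2) ℂ := P.1.trace⁻¹ • P.1

end HypSpace

/-- The orthogonal projection of `ℂ²` onto the line spanned by `v`. -/
def lineProj (v : Fin 2 → ℂ) : Matrix (Fin 2) (Fin 2) ℂ :=
  (v ⬝ᵥ star v)⁻¹ • Matrix.vecMulVec v (star v)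

/-- The identification of `ℙ¹(ℂ) = ℂ ∪ {∞}` with the boundary of the closed ball: a line in `ℂ²`
is sent to the orthogonal projection onto it. -/
def sphereToBall (ξ : OnePoint ℂ) : Matrix (Fin 2) (Fin 2) ℂ :=
  ξ.elim (lineProj ![1, 0]) fun z => lineProj ![z, 1]

/-- `SL(2, ℂ)` acts on `ℙ¹(ℂ)` by Möbius transformations. -/
instance : MulAction SL(2, ℂ) (OnePoint ℂ) :=
  MulAction.compHom (OnePoint ℂ) (Matrix.SpecialLinearGroup.toGL : SL(2, ℂ) →* GL (Fin 2) ℂ)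

theorem sl_smul_sphere (A : SL(2, ℂ)) (ξ : OnePoint ℂ) :
    A • ξ = (Matrix.SpecialLinearGroup.toGL A : GL (Fin 2) ℂ) • ξ := rfl

theorem center_smul_sphere {A : SL(2, ℂ)} (hA : A ∈ Subgroup.center SL(2, ℂ)) (ξ : OnePoint ℂ) :
    A • ξ = ξ := by
  obtain ⟨r, hr, h⟩ := Matrix.SpecialLinearGroup.mem_center_iff.1 hA
  have hr0 : r ≠ 0 := by rintro rfl; simp at hr
  have e : ∀ i j, A i j = if i = j then r else 0 := fun i j => by
    rw [← h]; simp [Matrix.diagonal_apply]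
  induction ξ using OnePoint.rec with
  | infty => rw [sl_smul_sphere, OnePoint.smul_infty_eq_ite]; simp [e]
  | coe z => rw [sl_smul_sphere, OnePoint.smul_some_eq_ite]; simp [e, hr0]

theorem center_smul_hyp {A : SL(2, ℂ)} (hA : A ∈ Subgroup.center SL(2, ℂ)) (P : HypSpace) :
    A • P = P := by
  obtain ⟨r, hr, h⟩ := Matrix.SpecialLinearGroup.mem_center_iff.1 hA
  have hr' : ‖r‖ = 1 := by
    have := congrArg norm hr
    rw [norm_pow, norm_one] at this
    exact (pow_eq_one_iff_of_nonneg (norm_nonneg r) (by simp)).1 this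
  refine Subtype.ext ?_
  rw [HypSpace.smul_coe, ← h]
  have : r * star r = 1 := by
    rw [← starRingEnd_apply, Complex.mul_conj, Complex.normSq_eq_norm_sq, hr']; simp
  ext i j
  simp [Matrix.scalar_apply, Matrix.diagonal_conjTranspose, Matrix.mul_diagonal,
    Matrix.diagonal_mul]
  rw [starRingEnd_apply]
  linear_combination (P.1 i j) * this

/-- The action of `PSL(2, ℂ)` on `ℙ¹(ℂ)` by Möbius transformations. -/
instance : MulAction PSL(2, ℂ) (OnePoint ℂ) :=
  MulAction.compHom (OnePoint ℂ) (QuotientGroup.lift _ (MulAction.toPermHom SL(2, ℂ) (OnePoint ℂ))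
    fun _ hA => Equiv.ext (center_smul_sphere hA))

/-- The action of `PSL(2, ℂ)` on hyperbolic space by isometries. -/
instance : MulAction PSL(2, ℂ) HypSpace :=
  MulAction.compHom HypSpace (QuotientGroup.lift _ (MulAction.toPermHom SL(2, ℂ) HypSpace)
    fun _ hA => Equiv.ext (center_smul_hyp hA))

theorem mk_smul_sphere (A : SL(2, ℂ)) (ξ : OnePoint ℂ) :
    ((A : PSL(2, ℂ)) • ξ : OnePoint ℂ) = A • ξ := rfl

theorem mk_smul_hyp (A : SL(2, ℂ)) (P : HypSpace) : ((A : PSL(2, ℂ)) • P : HypSpace) = A • P := rfl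

/-- The projective action of `A` on matrices, `M ↦ A M A* / tr(A M A*)`. -/
def ballAct (A : Matrix (Fin 2) (Fin 2) ℂ) (M : Matrix (Fin 2) (Fin 2) ℂ) :
    Matrix (Fin 2) (Fin 2) ℂ :=
  (A * M * Aᴴ).trace⁻¹ • (A * M * Aᴴ)

theorem ballAct_toBall (A : SL(2, ℂ)) (P : HypSpace) :
    ballAct A P.toBall = (A • P).toBall := by
  have : P.1.trace ≠ 0 := P.2.1.trace_pos.ne'
  simp only [ballAct, HypSpace.toBall, HypSpace.smul_coe, Matrix.mul_smul, Matrix.smul_mul,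
    Matrix.trace_smul, smul_smul, smul_eq_mul]
  congr 1
  field_simp

theorem sphereToBall_coe (z : ℂ) : sphereToBall (z : OnePoint ℂ) = lineProj ![z, 1] := rfl

theorem sphereToBall_infty : sphereToBall ∞ = lineProj ![1, 0] := rfl

theorem sphereToBall_coe_eq (z : ℂ) : sphereToBall (z : OnePoint ℂ) =
    ((‖z‖ ^ 2 + 1 : ℝ) : ℂ)⁻¹ • !![((‖z‖ ^ 2 : ℝ) : ℂ), z; conj z, 1] := by
  have h : z * conj z = ((‖z‖ ^ 2 : ℝ) : ℂ) := by
    rw [Complex.mul_conj, Complex.normSq_eq_norm_sq]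
  rw [sphereToBall_coe, lineProj]
  congr 1
  · simp [dotProduct, Fin.sum_univ_two, h]
  · ext i j
    fin_cases i <;> fin_cases j <;> simp [Matrix.vecMulVec_apply, h]

theorem sphereToBall_infty_eq : sphereToBall ∞ = !![1, 0; 0, 0] := by
  rw [sphereToBall_infty, lineProj]
  have h : (![1, 0] : Fin 2 → ℂ) ⬝ᵥ star ![1, 0] = 1 := by simp [dotProduct, Fin.sum_univ_two]
  rw [h, inv_one, one_smul]
  ext i j
  rw [Matrix.vecMulVec_apply]
  fin_cases i <;> fin_cases j <;> simp

theorem sphereToBall_injective : Function.Injective sphereToBall := by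
  have hne : ∀ z : ℂ, ((‖z‖ ^ 2 + 1 : ℝ) : ℂ)⁻¹ ≠ 0 := fun z =>
    inv_ne_zero (Complex.ofReal_ne_zero.2 (by positivity))
  have h11 : ∀ z : ℂ, sphereToBall z 1 1 = ((‖z‖ ^ 2 + 1 : ℝ) : ℂ)⁻¹ := fun z => by
    rw [sphereToBall_coe_eq]; simp
  have h01 : ∀ z : ℂ, sphereToBall z 0 1 = sphereToBall z 1 1 * z := fun z => by
    rw [h11, sphereToBall_coe_eq]; simp
  have hi : sphereToBall ∞ 1 1 = 0 := by rw [sphereToBall_infty_eq]; simp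
  intro ξ η h
  induction ξ using OnePoint.rec with
  | infty =>
    induction η using OnePoint.rec with
    | infty => rfl
    | coe w => exact absurd (by rw [← h11, ← h, hi]) (hne w)
  | coe z =>
    induction η using OnePoint.rec with
    | infty => exact absurd (by rw [← h11, h, hi]) (hne z)
    | coe w =>
      have h2 := h01 z
      rw [h, h01 w] at h2
      rw [mul_left_cancel₀ (by rw [h11]; exact hne w) h2]

theorem continuous_sphereToBall : Continuous sphereToBall := by
  rw [OnePoint.continuous_iff]
  have hn : Tendsto (fun z : ℂ => ‖z‖ ^ 2 + 1) (coclosedCompact ℂ) atTop := by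
    rw [coclosedCompact_eq_cocompact]
    exact tendsto_atTop_add_const_right _ _
      ((tendsto_pow_atTop two_ne_zero).comp (@tendsto_norm_cocompact_atTop ℂ _ _))
  have hinv : Tendsto (fun z : ℂ => (‖z‖ ^ 2 + 1)⁻¹) (coclosedCompact ℂ) (𝓝 0) :=
    tendsto_inv_atTop_zero.comp hn
  have hinvC : Tendsto (fun z : ℂ => ((‖z‖ ^ 2 + 1 : ℝ) : ℂ)⁻¹) (coclosedCompact ℂ) (𝓝 0) := by
    have := (Complex.continuous_ofReal.tendsto 0).comp hinv
    simpa [Function.comp_def] using this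
  have hoff : Tendsto (fun z : ℂ => ((‖z‖ ^ 2 + 1 : ℝ) : ℂ)⁻¹ * z) (coclosedCompact ℂ) (𝓝 0) := by
    rw [tendsto_zero_iff_norm_tendsto_zero]
    have h0 : Tendsto (fun z : ℂ => ‖z‖⁻¹) (coclosedCompact ℂ) (𝓝 0) := by
      rw [coclosedCompact_eq_cocompact]
      exact tendsto_inv_atTop_zero.comp (@tendsto_norm_cocompact_atTop ℂ _ _)
    refine squeeze_zero (fun z => norm_nonneg _) (fun z => ?_) h0
    rw [norm_mul, norm_inv, Complex.norm_real, Real.norm_of_nonneg (by positivity)]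
    rcases eq_or_ne z 0 with rfl | hz
    · simp
    · have : 0 < ‖z‖ := norm_pos_iff.2 hz
      rw [inv_mul_eq_div, div_le_iff₀ (by positivity)]
      field_simp
      nlinarith
  refine ⟨?_, ?_⟩
  · rw [sphereToBall_infty_eq]
    have key : Tendsto (fun z : ℂ => ((‖z‖ ^ 2 + 1 : ℝ) : ℂ)⁻¹ * ((‖z‖ ^ 2 : ℝ) : ℂ))
        (coclosedCompact ℂ) (𝓝 1) := by
      have : Tendsto (fun z : ℂ => 1 - ((‖z‖ ^ 2 + 1 : ℝ) : ℂ)⁻¹) (coclosedCompact ℂ)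
          (𝓝 (1 - 0)) := tendsto_const_nhds.sub hinvC
      rw [sub_zero] at this
      refine this.congr fun z => ?_
      have : ((‖z‖ ^ 2 + 1 : ℝ) : ℂ) ≠ 0 := Complex.ofReal_ne_zero.2 (by positivity)
      field_simp
      push_cast
      ring
    have hc : Tendsto (fun z : ℂ => ((‖z‖ ^ 2 + 1 : ℝ) : ℂ)⁻¹ * conj z) (coclosedCompact ℂ)
        (𝓝 0) := by
      have := (Complex.continuous_conj.tendsto 0).comp hoff
      simpa [Function.comp_def] using this
    refine tendsto_pi_nhds.2 fun i => tendsto_pi_nhds.2 fun j => ?_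
    fin_cases i <;> fin_cases j
    · simpa [sphereToBall_coe_eq] using key
    · simpa [sphereToBall_coe_eq] using hoff
    · simpa [sphereToBall_coe_eq] using hc
    · simpa [sphereToBall_coe_eq] using hinvC
  · simp_rw [sphereToBall_coe_eq]
    have : ∀ z : ℂ, ((‖z‖ ^ 2 + 1 : ℝ) : ℂ) ≠ 0 := fun z =>
      Complex.ofReal_ne_zero.2 (by positivity)
    refine Continuous.smul (Continuous.inv₀ (by fun_prop) this) ?_
    refine continuous_matrix fun i j => ?_
    fin_cases i <;> fin_cases j <;> simp <;> fun_prop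

theorem lineProj_smul {c : ℂ} (hc : c ≠ 0) (v : Fin 2 → ℂ) : lineProj (c • v) = lineProj v := by
  have hs : star c ≠ 0 := star_ne_zero.2 hc
  ext i j
  simp only [lineProj, star_smul, Matrix.smul_apply, Matrix.vecMulVec_apply, Pi.smul_apply,
    Pi.star_apply, smul_eq_mul, dotProduct_smul, smul_dotProduct]
  rw [mul_inv, mul_inv]
  field_simp

theorem ballAct_lineProj (A : Matrix (Fin 2) (Fin 2) ℂ) {v : Fin 2 → ℂ} (hv : v ≠ 0) :
    ballAct A (lineProj v) = lineProj (A *ᵥ v) := by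
  have h : v ⬝ᵥ star v ≠ 0 := fun h => hv (dotProduct_self_star_eq_zero.1 h)
  simp only [ballAct, lineProj, Matrix.mul_smul, Matrix.smul_mul, Matrix.trace_smul, smul_smul,
    smul_eq_mul, Matrix.mul_vecMulVec, Matrix.vecMulVec_mul, Matrix.trace_vecMulVec,
    Matrix.star_mulVec]
  congr 1
  field_simp

theorem sl_smul_infty (A : SL(2, ℂ)) :
    A • (∞ : OnePoint ℂ) = if A 1 0 = 0 then ∞ else ((A 0 0 / A 1 0 : ℂ) : OnePoint ℂ) :=
  OnePoint.smul_infty_eq_ite (Matrix.SpecialLinearGroup.toGL A : GL (Fin 2) ℂ)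

theorem sl_smul_coe (A : SL(2, ℂ)) (z : ℂ) :
    A • (z : OnePoint ℂ) = if A 1 0 * z + A 1 1 = 0 then ∞ else
      (((A 0 0 * z + A 0 1) / (A 1 0 * z + A 1 1) : ℂ) : OnePoint ℂ) :=
  OnePoint.smul_some_eq_ite (g := (Matrix.SpecialLinearGroup.toGL A : GL (Fin 2) ℂ))

theorem sphereToBall_smul (A : SL(2, ℂ)) (ξ : OnePoint ℂ) :
    sphereToBall (A • ξ) = ballAct A (sphereToBall ξ) := by
  have hdet : A 0 0 * A 1 1 - A 0 1 * A 1 0 = 1 := by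
    rw [← Matrix.det_fin_two]; exact A.2
  induction ξ using OnePoint.rec with
  | infty =>
    rw [sphereToBall_infty, ballAct_lineProj _ (by simp), sl_smul_infty]
    have hv : (A : Matrix (Fin 2) (Fin 2) ℂ) *ᵥ ![1, 0] = ![A 0 0, A 1 0] := by
      ext i; fin_cases i <;> simp [Matrix.mulVec, dotProduct, Fin.sum_univ_two]
    rw [hv]
    split_ifs with h
    · have h' : A 1 0 = 0 := h
      rw [sphereToBall_infty, ← lineProj_smul (c := A 0 0) _ ![1, 0]]
      · congr 1
        ext i; fin_cases i <;> simp [h']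
      · rintro h0; simp [h0, h'] at hdet
    · have h' : A 1 0 ≠ 0 := h
      rw [sphereToBall_coe, ← lineProj_smul h']
      congr 1
      ext i; fin_cases i <;> (simp; try field_simp)
  | coe z =>
    rw [sphereToBall_coe, ballAct_lineProj _ (by simp), sl_smul_coe]
    have hv : (A : Matrix (Fin 2) (Fin 2) ℂ) *ᵥ ![z, 1] =
        ![A 0 0 * z + A 0 1, A 1 0 * z + A 1 1] := by
      ext i; fin_cases i <;> simp [Matrix.mulVec, dotProduct, Fin.sum_univ_two]
    rw [hv]
    split_ifs with h
    · have h' : A 1 0 * z + A 1 1 = 0 := h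
      rw [sphereToBall_infty, ← lineProj_smul (c := A 0 0 * z + A 0 1) _ ![1, 0]]
      · congr 1
        ext i; fin_cases i <;> simp [h']
      · intro h0
        have : (1 : ℂ) = 0 := by linear_combination A 0 0 * h' - A 1 0 * h0 - hdet
        exact one_ne_zero this
    · have h' : A 1 0 * z + A 1 1 ≠ 0 := h
      rw [sphereToBall_coe, ← lineProj_smul h']
      congr 1
      ext i; fin_cases i <;> (simp; try field_simp)

theorem rep_ne_zero (ξ : OnePoint ℂ) : ∃ v : Fin 2 → ℂ, v ≠ 0 ∧ sphereToBall ξ = lineProj v := by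
  induction ξ using OnePoint.rec with
  | infty => exact ⟨_, by simp, sphereToBall_infty⟩
  | coe z => exact ⟨_, by simp, sphereToBall_coe z⟩

theorem continuousAt_ballAct (A : SL(2, ℂ)) (ξ : OnePoint ℂ) :
    ContinuousAt (ballAct A) (sphereToBall ξ) := by
  obtain ⟨v, hv, h⟩ := rep_ne_zero ξ
  have h0 : v ⬝ᵥ star v ≠ 0 := fun h => hv (dotProduct_self_star_eq_zero.1 h)
  have hA : (A : Matrix (Fin 2) (Fin 2) ℂ) *ᵥ v ≠ 0 := fun h' => hv <|
    Matrix.mulVec_injective_iff_isUnit.2 ((Matrix.isUnit_iff_isUnit_det _).2 (by simp))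
      (h'.trans (Matrix.mulVec_zero (A : Matrix (Fin 2) (Fin 2) ℂ)).symm)
  have h1 : (A : Matrix (Fin 2) (Fin 2) ℂ) *ᵥ v ⬝ᵥ
      star ((A : Matrix (Fin 2) (Fin 2) ℂ) *ᵥ v) ≠ 0 :=
    fun h => hA (dotProduct_self_star_eq_zero.1 h)
  have ht : ((A : Matrix (Fin 2) (Fin 2) ℂ) * sphereToBall ξ *
      (A : Matrix (Fin 2) (Fin 2) ℂ)ᴴ).trace ≠ 0 := by
    rw [h]
    simp only [lineProj, Matrix.mul_smul, Matrix.smul_mul, Matrix.trace_smul, smul_eq_mul,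
      Matrix.mul_vecMulVec, Matrix.vecMulVec_mul, Matrix.trace_vecMulVec]
    rw [← Matrix.star_mulVec]
    exact mul_ne_zero (inv_ne_zero h0) h1
  have hc : Continuous fun M : Matrix (Fin 2) (Fin 2) ℂ =>
      (A : Matrix (Fin 2) (Fin 2) ℂ) * M * (A : Matrix (Fin 2) (Fin 2) ℂ)ᴴ :=
    (continuous_const.matrix_mul continuous_id).matrix_mul continuous_const
  exact (hc.matrix_trace.continuousAt.inv₀ ht).smul hc.continuousAt

instance : ContinuousConstSMul PSL(2, ℂ) (OnePoint ℂ) where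
  continuous_const_smul γ := by
    obtain ⟨A, rfl⟩ := QuotientGroup.mk_surjective γ
    have he : IsClosedEmbedding sphereToBall :=
      continuous_sphereToBall.isClosedEmbedding sphereToBall_injective
    refine he.isInducing.continuous_iff.2 (continuous_iff_continuousAt.2 fun ξ => ?_)
    have : sphereToBall ∘ (fun ξ : OnePoint ℂ => (A : PSL(2, ℂ)) • ξ) =
        ballAct A ∘ sphereToBall := funext (sphereToBall_smul A)
    rw [this]
    exact (continuousAt_ballAct A ξ).comp continuous_sphereToBall.continuousAt

/-- The base point of hyperbolic space given by the identity matrix. -/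
def HypSpace.origin : HypSpace := ⟨1, .one, Matrix.det_one⟩

/-- The limit set of a group of Möbius transformations: the points of `ℙ¹(ℂ)` that are limits of
points of an orbit in hyperbolic space. -/
def limitSet (Γ : Subgroup PSL(2, ℂ)) : Set (OnePoint ℂ) :=
  {ξ | sphereToBall ξ ∈ closure (range fun γ : Γ => ((γ : PSL(2, ℂ)) • HypSpace.origin).toBall)}

theorem smul_mem_limitSet {Γ : Subgroup PSL(2, ℂ)} (γ : Γ) {ξ : OnePoint ℂ}
    (hξ : ξ ∈ limitSet Γ) : (γ : PSL(2, ℂ)) • ξ ∈ limitSet Γ := by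
  obtain ⟨γ, hγ⟩ := γ
  obtain ⟨A, rfl⟩ := QuotientGroup.mk_surjective γ
  change sphereToBall (A • ξ) ∈
    closure (range fun γ : Γ => ((γ : PSL(2, ℂ)) • HypSpace.origin).toBall)
  rw [sphereToBall_smul]
  refine closure_mono ?_ ((continuousAt_ballAct A ξ).continuousWithinAt.mem_closure_image hξ)
  rintro _ ⟨_, ⟨δ, rfl⟩, rfl⟩
  obtain ⟨δ, hδ⟩ := δ
  obtain ⟨B, rfl⟩ := QuotientGroup.mk_surjective δ
  refine ⟨⟨_, Γ.mul_mem hγ hδ⟩, ?_⟩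
  change _ = ballAct A (B • HypSpace.origin).toBall
  rw [ballAct_toBall, ← mul_smul]
  rfl

variable (Γ : Subgroup PSL(2, ℂ))

instance : MulAction Γ (limitSet Γ) where
  smul γ ξ := ⟨(γ : PSL(2, ℂ)) • (ξ : OnePoint ℂ), smul_mem_limitSet γ ξ.2⟩
  one_smul ξ := Subtype.ext (one_smul PSL(2, ℂ) (ξ : OnePoint ℂ))
  mul_smul γ δ ξ := Subtype.ext (mul_smul (γ : PSL(2, ℂ)) (δ : PSL(2, ℂ)) (ξ : OnePoint ℂ))

instance : ContinuousConstSMul Γ (limitSet Γ) where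
  continuous_const_smul γ :=
    ((continuous_const_smul (γ : PSL(2, ℂ))).comp continuous_subtype_val).subtype_mk _

instance : CompactSpace (limitSet Γ) :=
  isCompact_iff_compactSpace.1 (isClosed_closure.preimage continuous_sphereToBall).isCompact

instance : MeasurableSpace (limitSet Γ) := borel _

instance : BorelSpace (limitSet Γ) := ⟨rfl⟩

/-- The interior of a Jordan curve: an open connected set whose boundary is a simple closed
curve. -/
def IsJordanDomain (U : Set (OnePoint ℂ)) : Prop :=
  IsOpen U ∧ IsConnected U ∧
    ∃ c : Circle → OnePoint ℂ, Continuous c ∧ Function.Injective c ∧ frontier U = range c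

/-- Generators of a Schottky group of rank `g`: there are `2 g` Jordan domains with disjoint closures,
and the `i`-th generator maps the exterior of the `i`-th of the first `g` domains onto the `i`-th
of the other domains. -/
structure SchottkyGenerators (g : ℕ) where
  gen : Fin g → PSL(2, ℂ)
  disc : Fin g ⊕ Fin g → Set (OnePoint ℂ)
  isJordanDomain : ∀ i, IsJordanDomain (disc i)
  disjoint : ∀ i j, i ≠ j → Disjoint (closure (disc i)) (closure (disc j))
  image_exterior : ∀ i, (fun ξ => gen i • ξ) '' (closure (disc (.inl i)))ᶜ = disc (.inr i)

namespace SchottkyGenerators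

variable {g : ℕ} (S : SchottkyGenerators g)

/-- The Schottky group. -/
def group : Subgroup PSL(2, ℂ) := Subgroup.closure (range S.gen)

/-- The Cayley graph of the Schottky group, in which `γ` is joined to `γ s` for each
generator `s`. -/
def cayleyGraph : SimpleGraph S.group :=
  SimpleGraph.mulCayley {s | ∃ i, (s : PSL(2, ℂ)) = S.gen i}

/-- The distance of the Cayley graph. -/
def cayleyDist (x y : S.group) : ℝ := S.cayleyGraph.dist x y

/-- The hyperbolic distance of two vertices of the Cayley graph, embedded in hyperbolic space as the
orbit of `p`. -/
def hypDist (p : HypSpace) (x y : S.group) : ℝ :=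
  HypSpace.dist ((x : PSL(2, ℂ)) • p) ((y : PSL(2, ℂ)) • p)

/-- The trace on the set of vertices of the Cayley graph, embedded in hyperbolic space as the orbit of
`p`, of the neighbourhoods of a point `ξ ∈ ℙ¹(ℂ)` in `ℍ³ ∪ ℙ¹(ℂ)`. -/
def nhdsVertices (p : HypSpace) (ξ : limitSet S.group) : Filter S.group :=
  comap (fun x => ((x : PSL(2, ℂ)) • p).toBall) (𝓝 (sphereToBall ξ))

end SchottkyGenerators

end Schottky

end

set_option linter.unusedSectionVars false

noncomputable section

/-! ### Continuous functions as multiplication operators on `L²(Λ, μ)`. -/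

section Multiplication

variable {Λ : Type*} [TopologicalSpace Λ] [CompactSpace Λ] [MeasurableSpace Λ] [BorelSpace Λ]
  {μ : Measure Λ}

/-! The argument has an algebraic half, valid for every continuous real cocycle, and a geometric
half that supplies the cocycle and the quasi-invariance of the measure.

Algebraic half (`RealCocycle.dynamics_implemented`). The identity `b(γδ)(ξ) = b(γ)(ξ) + b(δ)(γ⁻¹ξ)`
makes `γ ↦ exp(i t b(γ)) U_γ` a unitary representation covariant with `C(Λ)`, so the universal
property of the crossed product yields `σ_t`. Quasi-invariance makes `υ` unitary, and the same
universal property applied to `f ⊗ 1` and `υ_γ ⊗ λ_γ`, with `λ` the left translation, yields `π`. On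
each fibre `L² ⊗ γ` the Hamiltonian is multiplication by a real function that is bounded, `Λ` being
compact; no bound uniform in `γ` is used. Self-adjointness on the maximal domain and the generator
property are therefore checked fibre by fibre, and the fibres are reassembled by dominated
convergence in `ℓ²(Γ)`. That `exp(itH)` implements `σ_t` is once more the cocycle identity.

Geometric half (`busemannDynamicsImplemented_of_tendsto`). If the limits exist for all pairs of
vertices and are continuous in `ξ`, invariance of `d` and uniqueness of limits give the cocycle
identity. By telescoping it suffices to treat the two ends of an edge. In a tree, for an edge `xy`,
the function `d(x, ·) - d(y, ·)` is constant on the components left after removing `x` and `y`. For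
a Schottky group, ping-pong shows that the group is free, so `d` is word length and the difference
for the edge from `1` to a letter `l` is `±1` according to whether the word of `z` starts with `l`.
If `z p → ξ`, the matrices of `z`, rescaled, accumulate at rank-one matrices, so along ultrafilters
`z η → ξ` for all `η` on the sphere but one; a suitable `η` shows that `ξ` lies in the disc of the
first letter of `z`. The discs are disjoint, hence the first letter stabilises.

Quasi-invariance needs no exact conformal formula. Translation by `γ` changes the orbit weights by a
factor at most `exp(|s| C)`, where `C` bounds `|d(x₀, z) - d(γ x₀, z)|`. In the limit, `∫ ψ ∘ γ ≤ K
∫ ψ` for continuous `ψ ≥ 0`, and regularity of finite Borel measures turns this into absolute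
continuity (`map_smul_absolutelyContinuous`). For the hyperbolic distance `C` comes from trace
inequalities between positive definite matrices. -/

theorem memLp_continuousMap_mul (f : C(Λ, ℂ)) (h : Lp ℂ 2 μ) :
    MemLp (fun ξ => f ξ * h ξ) 2 μ := by
  refine (Lp.memLp h).of_le_mul (c := ‖f‖)
    (f.continuous.aestronglyMeasurable.mul (Lp.aestronglyMeasurable h)) (ae_of_all _ fun ξ => ?_)
  rw [norm_mul]
  exact mul_le_mul_of_nonneg_right (f.norm_coe_le_norm ξ) (norm_nonneg _)

/-- Multiplication by a continuous function on `L²`. -/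
def mulLp (μ : Measure Λ) (f : C(Λ, ℂ)) : Lp ℂ 2 μ →L[ℂ] Lp ℂ 2 μ :=
  LinearMap.mkContinuous
    { toFun := fun h => (memLp_continuousMap_mul f h).toLp _
      map_add' := fun h k => by
        refine Lp.ext ?_
        filter_upwards [(memLp_continuousMap_mul f h).coeFn_toLp,
          (memLp_continuousMap_mul f k).coeFn_toLp, (memLp_continuousMap_mul f (h + k)).coeFn_toLp,
          Lp.coeFn_add h k, Lp.coeFn_add ((memLp_continuousMap_mul f h).toLp _)
            ((memLp_continuousMap_mul f k).toLp _)] with ξ h1 h2 h3 h4 h5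
        rw [h3, h5, Pi.add_apply, h1, h2, h4, Pi.add_apply, mul_add]
      map_smul' := fun c h => by
        refine Lp.ext ?_
        filter_upwards [(memLp_continuousMap_mul f h).coeFn_toLp,
          (memLp_continuousMap_mul f (c • h)).coeFn_toLp,
          Lp.coeFn_smul c h, Lp.coeFn_smul c ((memLp_continuousMap_mul f h).toLp _)]
          with ξ h1 h3 h4 h5
        rw [RingHom.id_apply, h3, h5, Pi.smul_apply, h1, h4, Pi.smul_apply, smul_eq_mul,
          smul_eq_mul, mul_left_comm] } ‖f‖ fun h => by
    refine Lp.norm_le_mul_norm_of_ae_le_mul ?_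
    filter_upwards [(memLp_continuousMap_mul f h).coeFn_toLp] with ξ h1
    change ‖((memLp_continuousMap_mul f h).toLp _ : Λ → ℂ) ξ‖ ≤ _
    rw [h1, norm_mul]
    exact mul_le_mul_of_nonneg_right (f.norm_coe_le_norm ξ) (norm_nonneg _)

theorem coeFn_mulLp (f : C(Λ, ℂ)) (h : Lp ℂ 2 μ) :
    mulLp μ f h =ᵐ[μ] fun ξ => f ξ * h ξ :=
  (memLp_continuousMap_mul f h).coeFn_toLp

theorem eq_mulLp_iff {f : C(Λ, ℂ)} {h k : Lp ℂ 2 μ} :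
    k = mulLp μ f h ↔ k =ᵐ[μ] fun ξ => f ξ * h ξ :=
  ⟨fun e => e ▸ coeFn_mulLp f h, fun e => Lp.ext (e.trans (coeFn_mulLp f h).symm)⟩

/-- This pointwise comparison serves twice: phases have modulus one and so act contractively, and
difference quotients of phases are dominated by the generator. -/
theorem norm_mulLp_apply_le_of_le {f g : C(Λ, ℂ)} (hfg : ∀ ξ, ‖f ξ‖ ≤ ‖g ξ‖) (h : Lp ℂ 2 μ) :
    ‖mulLp μ f h‖ ≤ ‖mulLp μ g h‖ := by
  refine Lp.norm_le_norm_of_ae_le ?_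
  filter_upwards [coeFn_mulLp f h, coeFn_mulLp g h] with ξ h1 h2
  rw [h1, h2, norm_mul, norm_mul]
  exact mul_le_mul_of_nonneg_right (hfg ξ) (norm_nonneg _)

/-- The representation of `C(Λ)` on `L²(Λ, μ)` by multiplication operators. -/
def mulRep (μ : Measure Λ) : C(Λ, ℂ) →⋆ₐ[ℂ] (Lp ℂ 2 μ →L[ℂ] Lp ℂ 2 μ) where
  toFun := mulLp μ
  map_one' := ContinuousLinearMap.ext fun h => (eq_mulLp_iff.2 (by simp)).symm
  map_zero' := ContinuousLinearMap.ext fun h => (eq_mulLp_iff.2 (by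
    filter_upwards [Lp.coeFn_zero ℂ 2 μ] with ξ h1
    simpa using h1)).symm
  map_mul' f g := ContinuousLinearMap.ext fun h => (eq_mulLp_iff.2 (by
    rw [mul_apply_eq_comp]
    filter_upwards [coeFn_mulLp f (mulLp μ g h), coeFn_mulLp g h] with ξ h1 h2
    rw [h1, h2, ContinuousMap.mul_apply, mul_assoc])).symm
  map_add' f g := ContinuousLinearMap.ext fun h => (eq_mulLp_iff.2 (by
    rw [add_apply]
    filter_upwards [coeFn_mulLp f h, coeFn_mulLp g h, Lp.coeFn_add (mulLp μ f h) (mulLp μ g h)]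
      with ξ h1 h2 h3
    rw [h3, Pi.add_apply, h1, h2, ContinuousMap.add_apply, add_mul])).symm
  commutes' c := ContinuousLinearMap.ext fun h => (eq_mulLp_iff.2 (by
    rw [Algebra.algebraMap_eq_smul_one, smul_apply,
      one_apply_eq_self]
    filter_upwards [Lp.coeFn_smul c h] with ξ h1
    rw [h1]
    simp)).symm
  map_star' f := by
    rw [ContinuousLinearMap.star_eq_adjoint, ContinuousLinearMap.eq_adjoint_iff]
    intro h k
    rw [L2.inner_def, L2.inner_def]
    refine integral_congr_ae ?_
    filter_upwards [coeFn_mulLp (star f) h, coeFn_mulLp f k] with ξ h1 h2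
    rw [h1, h2]
    simp
    ring

theorem mulRep_apply (f : C(Λ, ℂ)) : mulRep μ f = mulLp μ f := rfl

end Multiplication

/-! ### The unitary representation of `Γ` on `L²(Λ, μ)`. -/

section Koopman

open scoped ENNReal

variable {Γ Λ : Type*} [Group Γ] [TopologicalSpace Λ] [MulAction Γ Λ] [ContinuousConstSMul Γ Λ]
  [MeasurableSpace Λ] [BorelSpace Λ] {μ : Measure Λ}

theorem measurable_smul_borel (γ : Γ) : Measurable fun ξ : Λ => γ • ξ :=
  (continuous_const_smul γ).measurable

theorem measurableEmbedding_smul_borel (γ : Γ) : MeasurableEmbedding fun ξ : Λ => γ • ξ :=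
  (Homeomorph.smul γ).measurableEmbedding

theorem map_smul_map_smul (γ δ : Γ) :
    (μ.map (δ • ·)).map (γ • ·) = μ.map (fun ξ : Λ => (γ * δ) • ξ) := by
  rw [Measure.map_map (measurable_smul_borel γ) (measurable_smul_borel δ)]
  congr 1
  exact funext fun ξ => (mul_smul γ δ ξ).symm

theorem quasiMeasurePreserving_smul (hq : ∀ γ : Γ, μ.map (γ • ·) ≪ μ) (γ : Γ) :
    Measure.QuasiMeasurePreserving (fun ξ : Λ => γ • ξ) μ μ :=
  ⟨measurable_smul_borel γ, hq γ⟩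

variable [IsFiniteMeasure μ]

/-- The square root of the Radon–Nikodym derivative of `γ_* μ` with respect to `μ`. -/
def sqrtDensity (μ : Measure Λ) (γ : Γ) (ξ : Λ) : ℝ :=
  √((μ.map (γ • ·)).rnDeriv μ ξ).toReal

theorem measurable_sqrtDensity (γ : Γ) : Measurable (sqrtDensity μ γ) :=
  (Measure.measurable_rnDeriv _ _).ennreal_toReal.sqrt

/-- Taking `toReal` would lose the value `∞`; the derivative of a finite measure is finite almost
everywhere, so nothing is lost. -/
theorem enorm_sqrtDensity_sq (γ : Γ) :
    ∀ᵐ ξ ∂μ, ‖(sqrtDensity μ γ ξ : ℂ)‖ₑ ^ (2 : ℝ) = (μ.map (γ • ·)).rnDeriv μ ξ := by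
  filter_upwards [Measure.rnDeriv_lt_top (μ.map (γ • ·)) μ] with ξ hξ
  rw [← ofReal_norm, Complex.norm_real, sqrtDensity, Real.norm_of_nonneg (Real.sqrt_nonneg _),
    ENNReal.ofReal_rpow_of_nonneg (Real.sqrt_nonneg _) zero_le_two, Real.rpow_two,
    Real.sq_sqrt ENNReal.toReal_nonneg, ENNReal.ofReal_toReal hξ.ne]

/-- Chain rule for `(γδ)_*μ = γ_*(δ_*μ)` through the intermediate measure `γ_*μ`: the density of
`γ_*(δ_*μ)` with respect to `γ_*μ` is that of `δ_*μ` with respect to `μ`, transported by `γ`. -/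
theorem sqrtDensity_mul (hq : ∀ γ : Γ, μ.map (γ • ·) ≪ μ) (γ δ : Γ) :
    ∀ᵐ ξ ∂μ, sqrtDensity μ (γ * δ) ξ = sqrtDensity μ γ ξ * sqrtDensity μ δ (γ⁻¹ • ξ) := by
  have hac := (hq δ).map (measurable_smul_borel γ)
  have h1 := Measure.rnDeriv_mul_rnDeriv (κ := μ) hac
  have h2 := (measurableEmbedding_smul_borel (Λ := Λ) γ).rnDeriv_map (μ.map (δ • ·)) μ
  -- `h2` is an identity at the points `γ • ξ`; quasi-invariance under `γ⁻¹` allows `γ⁻¹ • ξ` to be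
  -- substituted for `ξ` almost everywhere.
  have h3 := (quasiMeasurePreserving_smul hq γ⁻¹).ae h2
  rw [map_smul_map_smul] at h1 h3
  filter_upwards [h1, h3] with ξ h1 h3
  rw [smul_inv_smul] at h3
  rw [Pi.mul_apply, h3, mul_comm] at h1
  rw [sqrtDensity, ← h1, ENNReal.toReal_mul, Real.sqrt_mul ENNReal.toReal_nonneg]
  rfl

theorem sqrtDensity_one : ∀ᵐ ξ ∂μ, sqrtDensity μ (1 : Γ) ξ = 1 := by
  filter_upwards [Measure.rnDeriv_self μ] with ξ h
  have : (fun ξ : Λ => (1 : Γ) • ξ) = id := funext fun ξ => one_smul Γ ξ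
  simp only [sqrtDensity, this, Measure.map_id, h]
  simp

/-- Change of variables: the squared factor turns `μ` into `γ_*μ`, by absolute continuity, and
integrating against `γ_*μ` undoes the composition with `γ⁻¹`. -/
theorem eLpNorm_sqrtDensity_mul (hq : ∀ γ : Γ, μ.map (γ • ·) ≪ μ) (γ : Γ) {h : Λ → ℂ}
    (hh : AEStronglyMeasurable h μ) :
    eLpNorm (fun ξ => (sqrtDensity μ γ ξ : ℂ) * h (γ⁻¹ • ξ)) 2 μ = eLpNorm h 2 μ := by
  have hh' : AEStronglyMeasurable (fun ξ => h (γ⁻¹ • ξ)) μ :=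
    hh.comp_quasiMeasurePreserving (quasiMeasurePreserving_smul hq γ⁻¹)
  rw [eLpNorm_eq_lintegral_rpow_enorm_toReal two_ne_zero ENNReal.ofNat_ne_top,
    eLpNorm_eq_lintegral_rpow_enorm_toReal two_ne_zero ENNReal.ofNat_ne_top]
  simp only [ENNReal.toReal_ofNat]
  congr 1
  calc ∫⁻ ξ, ‖(sqrtDensity μ γ ξ : ℂ) * h (γ⁻¹ • ξ)‖ₑ ^ (2 : ℝ) ∂μ
      = ∫⁻ ξ, (μ.map (γ • ·)).rnDeriv μ ξ * ‖h (γ⁻¹ • ξ)‖ₑ ^ (2 : ℝ) ∂μ := by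
        refine lintegral_congr_ae ?_
        filter_upwards [enorm_sqrtDensity_sq (μ := μ) γ] with ξ hξ
        rw [enorm_mul, ENNReal.mul_rpow_of_nonneg _ _ zero_le_two, hξ]
    _ = ∫⁻ ξ, ‖h (γ⁻¹ • ξ)‖ₑ ^ (2 : ℝ) ∂(μ.map (γ • ·)) :=
        lintegral_rnDeriv_mul (hq γ) (hh'.enorm.pow_const 2)
    _ = ∫⁻ ξ, ‖h ξ‖ₑ ^ (2 : ℝ) ∂μ := by
        rw [lintegral_map' ((hh'.enorm.pow_const 2).mono_ac (hq γ))
          (measurable_smul_borel γ).aemeasurable]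
        simp

theorem memLp_sqrtDensity_mul (hq : ∀ γ : Γ, μ.map (γ • ·) ≪ μ) (γ : Γ) (h : Lp ℂ 2 μ) :
    MemLp (fun ξ => (sqrtDensity μ γ ξ : ℂ) * h (γ⁻¹ • ξ)) 2 μ :=
  ⟨(measurable_sqrtDensity γ).complex_ofReal.aestronglyMeasurable.mul
    ((Lp.aestronglyMeasurable h).comp_quasiMeasurePreserving (quasiMeasurePreserving_smul hq γ⁻¹)),
    (eLpNorm_sqrtDensity_mul hq γ (Lp.aestronglyMeasurable h)).trans_lt (Lp.memLp h).eLpNorm_lt_top⟩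

/-- The isometry `h ↦ (d γ_* μ / dμ)^{1/2} h ∘ γ⁻¹` of `L²(Λ, μ)`. -/
def koopmanIsometry (hq : ∀ γ : Γ, μ.map (γ • ·) ≪ μ) (γ : Γ) : Lp ℂ 2 μ →ₗᵢ[ℂ] Lp ℂ 2 μ where
  toFun h := (memLp_sqrtDensity_mul hq γ h).toLp _
  map_add' h k := by
    refine Lp.ext ?_
    filter_upwards [(memLp_sqrtDensity_mul hq γ h).coeFn_toLp,
      (memLp_sqrtDensity_mul hq γ k).coeFn_toLp, (memLp_sqrtDensity_mul hq γ (h + k)).coeFn_toLp,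
      (quasiMeasurePreserving_smul hq γ⁻¹).ae (Lp.coeFn_add h k),
      Lp.coeFn_add ((memLp_sqrtDensity_mul hq γ h).toLp _)
        ((memLp_sqrtDensity_mul hq γ k).toLp _)] with ξ h1 h2 h3 h4 h5
    rw [h3, h5, Pi.add_apply, h1, h2, h4, Pi.add_apply, mul_add]
  map_smul' c h := by
    refine Lp.ext ?_
    filter_upwards [(memLp_sqrtDensity_mul hq γ h).coeFn_toLp,
      (memLp_sqrtDensity_mul hq γ (c • h)).coeFn_toLp,
      (quasiMeasurePreserving_smul hq γ⁻¹).ae (Lp.coeFn_smul c h),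
      Lp.coeFn_smul c ((memLp_sqrtDensity_mul hq γ h).toLp _)] with ξ h1 h3 h4 h5
    rw [RingHom.id_apply, h3, h5, Pi.smul_apply, h1, h4, Pi.smul_apply, smul_eq_mul,
      smul_eq_mul, mul_left_comm]
  norm_map' h := by
    change ‖(memLp_sqrtDensity_mul hq γ h).toLp _‖ = _
    rw [Lp.norm_toLp, eLpNorm_sqrtDensity_mul hq γ (Lp.aestronglyMeasurable h), Lp.norm_def]

theorem coeFn_koopmanIsometry (hq : ∀ γ : Γ, μ.map (γ • ·) ≪ μ) (γ : Γ) (h : Lp ℂ 2 μ) :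
    koopmanIsometry hq γ h =ᵐ[μ] fun ξ => (sqrtDensity μ γ ξ : ℂ) * h (γ⁻¹ • ξ) :=
  (memLp_sqrtDensity_mul hq γ h).coeFn_toLp

theorem koopmanIsometry_mul (hq : ∀ γ : Γ, μ.map (γ • ·) ≪ μ) (γ δ : Γ) (h : Lp ℂ 2 μ) :
    koopmanIsometry hq (γ * δ) h = koopmanIsometry hq γ (koopmanIsometry hq δ h) := by
  refine Lp.ext ?_
  filter_upwards [coeFn_koopmanIsometry hq (γ * δ) h,
    coeFn_koopmanIsometry hq γ (koopmanIsometry hq δ h),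
    (quasiMeasurePreserving_smul hq γ⁻¹).ae (coeFn_koopmanIsometry hq δ h),
    sqrtDensity_mul hq γ δ] with ξ h1 h2 h3 h4
  rw [h1, h2, h3, h4, mul_inv_rev, mul_smul, Complex.ofReal_mul, mul_assoc]

theorem koopmanIsometry_one (hq : ∀ γ : Γ, μ.map (γ • ·) ≪ μ) (h : Lp ℂ 2 μ) :
    koopmanIsometry hq 1 h = h := by
  refine Lp.ext ?_
  filter_upwards [coeFn_koopmanIsometry hq 1 h, sqrtDensity_one (Γ := Γ) (μ := μ)] with ξ h1 h2
  rw [h1, h2, inv_one, one_smul, Complex.ofReal_one, one_mul]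

/-- The unitary representation `υ` of `Γ` on `L²(Λ, μ)`. -/
def koopman (hq : ∀ γ : Γ, μ.map (γ • ·) ≪ μ) : Γ →* (Lp ℂ 2 μ ≃ₗᵢ[ℂ] Lp ℂ 2 μ) where
  toFun γ :=
    { (koopmanIsometry hq γ) with
      invFun := koopmanIsometry hq γ⁻¹
      left_inv := fun h => by
        change koopmanIsometry hq γ⁻¹ (koopmanIsometry hq γ h) = h
        rw [← koopmanIsometry_mul, inv_mul_cancel, koopmanIsometry_one]
      right_inv := fun h => by
        change koopmanIsometry hq γ (koopmanIsometry hq γ⁻¹ h) = h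
        rw [← koopmanIsometry_mul, mul_inv_cancel, koopmanIsometry_one] }
  map_one' := LinearIsometryEquiv.ext (koopmanIsometry_one hq)
  map_mul' γ δ := LinearIsometryEquiv.ext (koopmanIsometry_mul hq γ δ)

theorem isKoopman_koopman (hq : ∀ γ : Γ, μ.map (γ • ·) ≪ μ) : IsKoopman μ (koopman hq) :=
  fun γ h => coeFn_koopmanIsometry hq γ h

/-- The covariance relation, which lets the multiplication operators and `υ` be combined into a
representation of the crossed product. -/
theorem koopman_mulLp [CompactSpace Λ] (hq : ∀ γ : Γ, μ.map (γ • ·) ≪ μ) (γ : Γ) (f : C(Λ, ℂ))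
    (h : Lp ℂ 2 μ) : koopman hq γ (mulLp μ f h) = mulLp μ (γ • f) (koopman hq γ h) := by
  refine eq_mulLp_iff.2 ?_
  filter_upwards [isKoopman_koopman hq γ (mulLp μ f h), isKoopman_koopman hq γ h,
    (quasiMeasurePreserving_smul hq γ⁻¹).ae (coeFn_mulLp f h)] with ξ h1 h2 h3
  rw [h1, h2, h3]
  exact mul_left_comm _ _ _

end Koopman

/-! ### Universal property of the crossed product. -/

section Covariant

variable {Γ Λ B : Type*} [Group Γ] [TopologicalSpace Λ] [MulAction Γ Λ] [ContinuousConstSMul Γ Λ]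

/-- The ⋆-representation `f U_γ ↦ ρ(f) u(γ)` of the algebraic crossed product that is given by a
covariant pair. -/
def AlgCrossedProduct.lift [Ring B] [Algebra ℂ B] [StarRing B]
    (ρ : C(Λ, ℂ) →⋆ₐ[ℂ] B) (u : Γ →* B) (hu : ∀ γ, star (u γ) = u γ⁻¹)
    (hc : ∀ γ f, u γ * ρ f = ρ (γ • f) * u γ) : AlgCrossedProduct Γ Λ →⋆ₐ[ℂ] B :=
  let φ : AlgCrossedProduct Γ Λ →+* B :=
    SkewMonoidAlgebra.liftNCRingHom (ρ : C(Λ, ℂ) →+* B) u fun {f γ} => (hc γ f).symm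
  have hφ : ∀ (f : C(Λ, ℂ)) (γ : Γ), φ (AlgCrossedProduct.mono f γ) = ρ f * u γ := fun f γ =>
    SkewMonoidAlgebra.liftNC_single _ _ _ _
  { φ with
    commutes' := fun c => by
      change φ (algebraMap ℂ (AlgCrossedProduct Γ Λ) c) = _
      rw [Algebra.algebraMap_eq_smul_one, AlgCrossedProduct.one_eq, AlgCrossedProduct.smul_mono,
        hφ, map_smul, map_one, map_one, mul_one, Algebra.algebraMap_eq_smul_one]
    map_star' := fun a => by
      change φ (star a) = star (φ a)
      induction a using AlgCrossedProduct.induction with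
      | h0 => simp
      | ha a b h h' => rw [star_add, map_add, map_add, star_add, h, h']
      | hm f γ =>
        rw [AlgCrossedProduct.star_mono, hφ, hφ, star_mul, hu, ← map_star, hc] }

theorem AlgCrossedProduct.lift_mono [Ring B] [Algebra ℂ B] [StarRing B]
    (ρ : C(Λ, ℂ) →⋆ₐ[ℂ] B) (u : Γ →* B) (hu : ∀ γ, star (u γ) = u γ⁻¹)
    (hc : ∀ γ f, u γ * ρ f = ρ (γ • f) * u γ) (f : C(Λ, ℂ)) (γ : Γ) :
    AlgCrossedProduct.lift ρ u hu hc (AlgCrossedProduct.mono f γ) = ρ f * u γ :=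
  SkewMonoidAlgebra.liftNC_single _ _ _ _

variable [CompactSpace Λ] [CStarAlgebra B]

theorem norm_le_one_of_star_mul_self_eq_one {u : B} (hu : star u * u = 1) : ‖u‖ ≤ 1 := by
  rcases subsingleton_or_nontrivial B with h | h
  · rw [Subsingleton.elim u 0, norm_zero]; exact zero_le_one
  · have := CStarRing.norm_star_mul_self (x := u)
    rw [hu, CStarRing.norm_one] at this
    nlinarith [norm_nonneg u]

/-- The norm of `B` pulled back along the representation is one of the seminorms over which the
universal norm is the supremum: `ρ` is contractive and each `u γ` is unitary, so monomials are
bounded as required. -/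
theorem AlgCrossedProduct.norm_lift_le
    (ρ : C(Λ, ℂ) →⋆ₐ[ℂ] B) (u : Γ →* B) (hu : ∀ γ, star (u γ) = u γ⁻¹)
    (hc : ∀ γ f, u γ * ρ f = ρ (γ • f) * u γ) (a : AlgCrossedProduct Γ Λ) :
    ‖AlgCrossedProduct.lift ρ u hu hc a‖ ≤ ‖a‖ := by
  let φ := AlgCrossedProduct.lift ρ u hu hc
  let p : Seminorm ℂ (AlgCrossedProduct Γ Λ) :=
    (normSeminorm ℂ B).comp (φ.toAlgHom.toLinearMap)
  have hp : AlgCrossedProduct.IsCStarSeminorm p := by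
    refine ⟨fun a b => ?_, fun a => ?_, fun f γ => ?_⟩
    · change ‖φ (a * b)‖ ≤ ‖φ a‖ * ‖φ b‖
      rw [map_mul]
      exact norm_mul_le _ _
    · change ‖φ (star a * a)‖ = ‖φ a‖ ^ 2
      rw [map_mul, map_star, CStarRing.norm_star_mul_self, sq]
    · change ‖φ (AlgCrossedProduct.mono f γ)‖ ≤ ‖f‖
      rw [AlgCrossedProduct.lift_mono]
      have h1 : ‖u γ‖ ≤ 1 := norm_le_one_of_star_mul_self_eq_one (by
        rw [hu, ← map_mul, inv_mul_cancel, map_one])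
      calc ‖ρ f * u γ‖ ≤ ‖ρ f‖ * ‖u γ‖ := norm_mul_le _ _
        _ ≤ ‖f‖ * 1 := mul_le_mul (NonUnitalStarAlgHom.norm_apply_le ρ f) h1 (norm_nonneg _)
            (norm_nonneg _)
        _ = ‖f‖ := mul_one _
  exact AlgCrossedProduct.le_univNorm hp a

theorem AlgCrossedProduct.continuous_lift
    (ρ : C(Λ, ℂ) →⋆ₐ[ℂ] B) (u : Γ →* B) (hu : ∀ γ, star (u γ) = u γ⁻¹)
    (hc : ∀ γ f, u γ * ρ f = ρ (γ • f) * u γ) :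
    Continuous (AlgCrossedProduct.lift ρ u hu hc) :=
  AddMonoidHomClass.continuous_of_bound _ 1 fun a => by
    rw [one_mul]; exact AlgCrossedProduct.norm_lift_le ρ u hu hc a

/-- The ⋆-representation of the crossed product that is given by a covariant pair. -/
def CrossedProduct.lift
    (ρ : C(Λ, ℂ) →⋆ₐ[ℂ] B) (u : Γ →* B) (hu : ∀ γ, star (u γ) = u γ⁻¹)
    (hc : ∀ γ f, u γ * ρ f = ρ (γ • f) * u γ) : CrossedProduct Γ Λ →⋆ₐ[ℂ] B :=
  let φ := AlgCrossedProduct.lift ρ u hu hc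
  have hφ := AlgCrossedProduct.continuous_lift ρ u hu hc
  let Φ : CrossedProduct Γ Λ →+* B :=
    UniformSpace.Completion.extensionHom (φ : AlgCrossedProduct Γ Λ →+* B) hφ
  have hΦ : ∀ a, Φ (CrossedProduct.ofAlg a) = φ a := fun a =>
    UniformSpace.Completion.extensionHom_coe _ _ a
  have hcont : Continuous Φ := UniformSpace.Completion.continuous_extension
  { Φ with
    commutes' := fun c => by
      change Φ (algebraMap ℂ (CrossedProduct Γ Λ) c) = _
      rw [← AlgHom.commutes (CrossedProduct.ofAlg (Γ := Γ) (Λ := Λ)) c, hΦ,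
        AlgHomClass.commutes φ c]
    map_star' := fun a => by
      change Φ (star a) = star (Φ a)
      induction a using CrossedProduct.induction with
      | hc =>
        exact isClosed_eq (hcont.comp CrossedProduct.continuous_star') (continuous_star.comp hcont)
      | ha a => rw [CrossedProduct.star_ofAlg, hΦ, hΦ, map_star] }

theorem CrossedProduct.lift_mono
    (ρ : C(Λ, ℂ) →⋆ₐ[ℂ] B) (u : Γ →* B) (hu : ∀ γ, star (u γ) = u γ⁻¹)
    (hc : ∀ γ f, u γ * ρ f = ρ (γ • f) * u γ) (f : C(Λ, ℂ)) (γ : Γ) :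
    CrossedProduct.lift ρ u hu hc (CrossedProduct.mono f γ) = ρ f * u γ :=
  (UniformSpace.Completion.extensionHom_coe _ (AlgCrossedProduct.continuous_lift ρ u hu hc) _).trans
    (AlgCrossedProduct.lift_mono ρ u hu hc f γ)

namespace CrossedProduct

theorem mono_mul (f g : C(Λ, ℂ)) (γ δ : Γ) : mono f γ * mono g δ = mono (f * γ • g) (γ * δ) := by
  rw [mono, mono, ← map_mul, AlgCrossedProduct.mono_mul, mono]

theorem star_mono (f : C(Λ, ℂ)) (γ : Γ) : star (mono f γ) = mono (γ⁻¹ • star f) γ⁻¹ := by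
  rw [mono, star_ofAlg, AlgCrossedProduct.star_mono, mono]

theorem one_eq : (1 : CrossedProduct Γ Λ) = mono 1 1 := rfl

theorem norm_mono_le (f : C(Λ, ℂ)) (γ : Γ) : ‖mono f γ‖ ≤ ‖f‖ := by
  rw [mono, norm_ofAlg]
  exact ciSup_le fun p => p.2.mono_le f γ

theorem mono_sub (f g : C(Λ, ℂ)) (γ : Γ) : mono (f - g) γ = mono f γ - mono g γ := by
  rw [eq_sub_iff_add_eq, mono, mono, mono, ← map_add, ← AlgCrossedProduct.mono_add,
    sub_add_cancel]

/-- A closed additive property of monomials holds on the crossed product. -/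
theorem induction_mono {P : CrossedProduct Γ Λ → Prop} (hc : IsClosed {a | P a}) (h0 : P 0)
    (hm : ∀ f γ, P (mono f γ)) (ha : ∀ a b, P a → P b → P (a + b)) (a : CrossedProduct Γ Λ) :
    P a := by
  induction a using CrossedProduct.induction with
  | hc => exact hc
  | ha a =>
    induction a using AlgCrossedProduct.induction with
    | h0 => rwa [map_zero]
    | hm f γ => exact hm f γ
    | ha a b h h' => rw [map_add]; exact ha _ _ h h'

/-- Homomorphisms of C⋆-algebras are contractive, hence continuous, and sums of monomials are dense.
-/
theorem ext_mono {F G : CrossedProduct Γ Λ →⋆ₐ[ℂ] B} (h : ∀ f γ, F (mono f γ) = G (mono f γ))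
    (a : CrossedProduct Γ Λ) : F a = G a := by
  have hF : Continuous F := AddMonoidHomClass.continuous_of_bound F 1 fun a => by
    rw [one_mul]; exact NonUnitalStarAlgHom.norm_apply_le F a
  have hG : Continuous G := AddMonoidHomClass.continuous_of_bound G 1 fun a => by
    rw [one_mul]; exact NonUnitalStarAlgHom.norm_apply_le G a
  induction a using induction_mono with
  | hc => exact isClosed_eq hF hG
  | h0 => rw [map_zero, map_zero]
  | hm f γ => exact h f γ
  | ha a b h h' => rw [map_add, map_add, h, h']

/-- The inclusion of `C(Λ)` in the crossed product. -/
def coeff : C(Λ, ℂ) →⋆ₐ[ℂ] CrossedProduct Γ Λ where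
  toFun f := mono f 1
  map_one' := rfl
  map_mul' f g := by rw [mono_mul, one_smul, mul_one]
  map_zero' := by rw [mono, AlgCrossedProduct.mono_zero, map_zero]
  map_add' f g := by rw [mono, AlgCrossedProduct.mono_add, map_add]; rfl
  commutes' c := by
    rw [Algebra.algebraMap_eq_smul_one, Algebra.algebraMap_eq_smul_one, one_eq, mono, mono,
      ← AlgCrossedProduct.smul_mono, map_smul]
  map_star' f := by rw [star_mono, inv_one, one_smul]

end CrossedProduct

end Covariant

/-! ### The time evolution defined by a real cocycle. -/

section TimeEvolution

variable {Γ Λ : Type*} [Group Γ] [TopologicalSpace Λ] [MulAction Γ Λ] [ContinuousConstSMul Γ Λ]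
  [CompactSpace Λ]

/-- A real-valued cocycle of `Γ` with values in `C(Λ)`. -/
structure RealCocycle (Γ Λ : Type*) [Group Γ] [TopologicalSpace Λ] [MulAction Γ Λ] where
  toFun : Γ → C(Λ, ℝ)
  map_mul : ∀ γ δ ξ, toFun (γ * δ) ξ = toFun γ ξ + toFun δ (γ⁻¹ • ξ)

namespace RealCocycle

variable (b : RealCocycle Γ Λ)

theorem map_one (ξ : Λ) : b.toFun 1 ξ = 0 := by
  have := b.map_mul 1 1 ξ
  rw [mul_one, inv_one, one_smul] at this
  linarith

theorem map_inv (γ : Γ) (ξ : Λ) : b.toFun γ⁻¹ ξ = - b.toFun γ (γ • ξ) := by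
  have := b.map_mul γ⁻¹ γ ξ
  rw [inv_mul_cancel, map_one, inv_inv] at this
  linarith

/-- The function `b γ` with complex values. -/
def toComplex (γ : Γ) : C(Λ, ℂ) := ⟨fun ξ => (b.toFun γ ξ : ℂ), by fun_prop⟩

/-- The function `exp (i t b γ)`. -/
def phase (t : ℝ) (γ : Γ) : C(Λ, ℂ) := ⟨fun ξ => exp (I * t * b.toFun γ ξ), by fun_prop⟩

theorem phase_apply (t : ℝ) (γ : Γ) (ξ : Λ) : b.phase t γ ξ = exp (I * t * b.toFun γ ξ) := rfl

/-- The cocycle identity, exponentiated. It is what makes the twisted monomials `exp(i t b(γ)) U_γ`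
multiplicative in `γ`. -/
theorem phase_mul (t : ℝ) (γ δ : Γ) : b.phase t (γ * δ) = b.phase t γ * γ • b.phase t δ := by
  ext ξ
  change exp _ = exp _ * exp (I * t * b.toFun δ (γ⁻¹ • ξ))
  rw [b.map_mul, ← exp_add]
  congr 1
  push_cast
  ring

theorem phase_one (t : ℝ) : b.phase t 1 = 1 := by
  ext ξ
  simp [phase_apply, b.map_one]

theorem phase_zero (γ : Γ) : b.phase 0 γ = 1 := by
  ext ξ
  simp [phase_apply]

theorem phase_add (s t : ℝ) (γ : Γ) : b.phase (s + t) γ = b.phase s γ * b.phase t γ := by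
  ext ξ
  rw [ContinuousMap.mul_apply, phase_apply, phase_apply, phase_apply, ← exp_add]
  congr 1
  push_cast
  ring

theorem star_phase (t : ℝ) (γ : Γ) : star (b.phase t γ) = b.phase (-t) γ := by
  ext ξ
  change (starRingEnd ℂ) (exp _) = exp _
  rw [← exp_conj]
  congr 1
  simp

theorem norm_phase_apply (t : ℝ) (γ : Γ) (ξ : Λ) : ‖b.phase t γ ξ‖ = 1 := by
  rw [phase_apply, show I * t * b.toFun γ ξ = ((t * b.toFun γ ξ : ℝ) : ℂ) * I by push_cast; ring]
  exact norm_exp_ofReal_mul_I _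

/-- Joint continuity in `(t, ξ)` gives continuity for the compact-open topology, which is the norm
topology because `Λ` is compact. The strong continuity of `σ` and of the unitary group rests on
this. -/
theorem continuous_phase (γ : Γ) : Continuous fun t : ℝ => b.phase t γ :=
  ContinuousMap.continuous_of_continuous_uncurry _ (by
    change Continuous fun p : ℝ × Λ => exp (I * p.1 * b.toFun γ p.2)
    fun_prop)

/-- The ⋆-endomorphism `f U_γ ↦ exp (i t b γ) f U_γ`. -/
def evolutionHom (t : ℝ) : CrossedProduct Γ Λ →⋆ₐ[ℂ] CrossedProduct Γ Λ :=
  CrossedProduct.lift CrossedProduct.coeff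
    { toFun := fun γ => CrossedProduct.mono (b.phase t γ) γ
      map_one' := by rw [phase_one]; rfl
      map_mul' := fun γ δ => by rw [CrossedProduct.mono_mul, phase_mul] }
    -- The twisted monomials are unitary because `b(γ⁻¹)(ξ) = -b(γ)(γξ)`.
    (fun γ => by
      change star (CrossedProduct.mono (b.phase t γ) γ) = CrossedProduct.mono (b.phase t γ⁻¹) γ⁻¹
      rw [CrossedProduct.star_mono, star_phase]
      congr 1
      ext ξ
      change exp (I * (-t : ℝ) * b.toFun γ (γ⁻¹⁻¹ • ξ)) = exp (I * t * b.toFun γ⁻¹ ξ)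
      rw [b.map_inv, inv_inv]
      congr 1
      push_cast
      ring)
    -- Twisting does not disturb covariance: `C(Λ)` is commutative, so the phase moves past `f`.
    (fun γ f => by
      change CrossedProduct.mono _ γ * CrossedProduct.mono f 1 =
        CrossedProduct.mono _ 1 * CrossedProduct.mono _ γ
      rw [CrossedProduct.mono_mul, CrossedProduct.mono_mul, one_smul, mul_one, one_mul, mul_comm])

theorem evolutionHom_mono (t : ℝ) (f : C(Λ, ℂ)) (γ : Γ) :
    b.evolutionHom t (CrossedProduct.mono f γ) = CrossedProduct.mono (b.phase t γ * f) γ := by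
  rw [evolutionHom, CrossedProduct.lift_mono]
  change CrossedProduct.mono f 1 * CrossedProduct.mono _ γ = _
  rw [CrossedProduct.mono_mul, one_smul, one_mul, mul_comm]

theorem evolutionHom_zero (a : CrossedProduct Γ Λ) : b.evolutionHom 0 a = a :=
  CrossedProduct.ext_mono (G := StarAlgHom.id ℂ _) (fun f γ => by
    rw [evolutionHom_mono, phase_zero, one_mul]; rfl) a

theorem evolutionHom_add (s t : ℝ) (a : CrossedProduct Γ Λ) :
    b.evolutionHom (s + t) a = b.evolutionHom s (b.evolutionHom t a) :=
  CrossedProduct.ext_mono (G := (b.evolutionHom s).comp (b.evolutionHom t)) (fun f γ => by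
    rw [StarAlgHom.comp_apply, evolutionHom_mono, evolutionHom_mono, evolutionHom_mono, phase_add,
      mul_assoc]) a

theorem norm_evolutionHom_le (t : ℝ) (a : CrossedProduct Γ Λ) : ‖b.evolutionHom t a‖ ≤ ‖a‖ :=
  NonUnitalStarAlgHom.norm_apply_le _ a

theorem continuous_evolutionHom (a : CrossedProduct Γ Λ) :
    Continuous fun t => b.evolutionHom t a := by
  induction a using CrossedProduct.induction_mono with
  | hc =>
    -- Each `σ_t` is a contraction, so approximating `a` approximates its orbit uniformly in `t`,
    -- and uniform limits of continuous orbits are continuous.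
    refine isClosed_of_closure_subset fun a ha => ?_
    refine continuous_of_uniform_approx_of_continuous fun u hu => ?_
    obtain ⟨ε, hε, hu⟩ := Metric.mem_uniformity_dist.1 hu
    obtain ⟨a', ha', hd⟩ := Metric.mem_closure_iff.1 ha ε hε
    refine ⟨fun t => b.evolutionHom t a', ha', fun t => hu ?_⟩
    rw [dist_eq_norm, ← map_sub]
    exact (b.norm_evolutionHom_le t _).trans_lt (by rwa [← dist_eq_norm])
  | h0 => simp only [map_zero]; exact continuous_const
  | hm f γ =>
    simp only [evolutionHom_mono]
    have : Continuous fun g : C(Λ, ℂ) => (CrossedProduct.mono g γ : CrossedProduct Γ Λ) := by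
      refine LipschitzWith.continuous (K := 1) (LipschitzWith.of_dist_le_mul fun g g' => ?_)
      rw [dist_eq_norm, dist_eq_norm, ← CrossedProduct.mono_sub, NNReal.coe_one, one_mul]
      exact CrossedProduct.norm_mono_le _ _
    exact this.comp ((b.continuous_phase γ).mul continuous_const)
  | ha a b h h' => simp only [map_add]; exact h.add h'

/-- The time evolution `σ_t (f U_γ) = exp (i t b γ) f U_γ`. -/
def evolution (t : ℝ) : CrossedProduct Γ Λ ≃⋆ₐ[ℂ] CrossedProduct Γ Λ :=
  StarAlgEquiv.ofStarAlgHom (b.evolutionHom t) (b.evolutionHom (-t))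
    (StarAlgHom.ext fun a => by
      rw [StarAlgHom.comp_apply, ← evolutionHom_add, neg_add_cancel, evolutionHom_zero]; rfl)
    (StarAlgHom.ext fun a => by
      rw [StarAlgHom.comp_apply, ← evolutionHom_add, add_neg_cancel, evolutionHom_zero]; rfl)

theorem isTimeEvolution_evolution :
    IsTimeEvolution (fun γ ξ => b.toFun γ ξ) (b.evolution (Γ := Γ) (Λ := Λ)) where
  zero := b.evolutionHom_zero
  add := b.evolutionHom_add
  continuous := b.continuous_evolutionHom
  mono t f γ := ⟨b.phase t γ * f, fun _ => rfl, b.evolutionHom_mono t f γ⟩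

end RealCocycle

end TimeEvolution

/-! ### Convergence and fibrewise operators in `ℓ²(ι, E)`. -/

section LpShift

variable {ι E : Type*} [NormedAddCommGroup E] [InnerProductSpace ℂ E]

theorem lp_summable_sq (ψ : lp (fun _ : ι => E) 2) : Summable fun i => ‖ψ i‖ ^ 2 := by
  have := (lp.memℓp ψ).summable (by simp)
  simpa using this

theorem lp_norm_sq_eq_tsum (ψ : lp (fun _ : ι => E) 2) : ‖ψ‖ ^ 2 = ∑' i, ‖ψ i‖ ^ 2 := by
  have := lp.norm_rpow_eq_tsum (p := 2) (by simp) ψ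
  simpa using this

/-- Dominated convergence for the series of squared norms. It is the one tool that passes from
fibrewise limits to limits in the Hilbert space. -/
theorem lp_tendsto_of_dominated {α : Type*} {F : Filter α} {x : α → lp (fun _ : ι => E) 2}
    {y : lp (fun _ : ι => E) 2} {g : ι → ℝ} (hg : Summable fun i => g i ^ 2)
    (hb : ∀ᶠ a in F, ∀ i, ‖x a i - y i‖ ≤ g i)
    (ht : ∀ i, Tendsto (fun a => x a i) F (𝓝 (y i))) : Tendsto x F (𝓝 y) := by
  rw [tendsto_iff_norm_sub_tendsto_zero]
  have h : Tendsto (fun a => ∑' i, ‖x a i - y i‖ ^ 2) F (𝓝 (∑' _ : ι, (0 : ℝ))) := by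
    refine tendsto_tsum_of_dominated_convergence hg (fun i => ?_) ?_
    · have := (tendsto_iff_norm_sub_tendsto_zero.1 (ht i)).pow 2
      simpa using this
    · filter_upwards [hb] with a ha i
      rw [Real.norm_of_nonneg (by positivity)]
      exact pow_le_pow_left₀ (norm_nonneg _) (ha i) 2
  rw [tsum_zero] at h
  have h' := h.sqrt
  rw [Real.sqrt_zero] at h'
  refine h'.congr fun a => ?_
  rw [← Real.sqrt_sq (norm_nonneg (x a - y)), lp_norm_sq_eq_tsum]
  rfl

theorem memℓp_shift (e : Equiv.Perm ι) (T : ι → E →L[ℂ] E) (C : ℝ)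
    (hT : ∀ i x, ‖T i x‖ ≤ C * ‖x‖) (ψ : lp (fun _ : ι => E) 2) :
    Memℓp (fun i => T i (ψ (e i))) 2 := by
  refine memℓp_gen ?_
  simp only [ENNReal.toReal_ofNat, Real.rpow_two]
  refine Summable.of_nonneg_of_le (fun i => by positivity) (fun i => ?_)
    ((e.summable_iff.2 (lp_summable_sq ψ)).mul_left (C ^ 2))
  rw [Function.comp_apply, ← mul_pow]
  exact pow_le_pow_left₀ (norm_nonneg _) (hT i _) 2

/-- The linear map `(S ψ)_i = T_i ψ_{e i}` on `ℓ²(ι, E)`. -/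
def lpShiftLinear (e : Equiv.Perm ι) (T : ι → E →L[ℂ] E) (C : ℝ)
    (hT : ∀ i x, ‖T i x‖ ≤ C * ‖x‖) : lp (fun _ : ι => E) 2 →ₗ[ℂ] lp (fun _ : ι => E) 2 where
  toFun ψ := ⟨fun i => T i (ψ (e i)), memℓp_shift e T C hT ψ⟩
  map_add' ψ φ := lp.ext (funext fun i => map_add (T i) (ψ (e i)) (φ (e i)))
  map_smul' c ψ := lp.ext (funext fun i => map_smul (T i) c (ψ (e i)))

theorem norm_lpShiftLinear_le (e : Equiv.Perm ι) (T : ι → E →L[ℂ] E) (C : ℝ) (hC : 0 ≤ C)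
    (hT : ∀ i x, ‖T i x‖ ≤ C * ‖x‖) (ψ : lp (fun _ : ι => E) 2) :
    ‖lpShiftLinear e T C hT ψ‖ ≤ C * ‖ψ‖ := by
  refine (sq_le_sq₀ (norm_nonneg _) (by positivity)).1 ?_
  rw [mul_pow, lp_norm_sq_eq_tsum, lp_norm_sq_eq_tsum, ← e.tsum_eq (fun i => ‖ψ i‖ ^ 2),
    ← tsum_mul_left]
  refine Summable.tsum_le_tsum (fun i => ?_) (lp_summable_sq _)
    ((e.summable_iff.2 (lp_summable_sq ψ)).mul_left (C ^ 2))
  rw [← mul_pow]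
  exact pow_le_pow_left₀ (norm_nonneg _) (hT i (ψ (e i))) 2

/-- The operator `(S ψ)_i = T_i ψ_{e i}` on `ℓ²(ι, E)`. -/
def lpShift (e : Equiv.Perm ι) (T : ι → E →L[ℂ] E) (C : ℝ) (hC : 0 ≤ C)
    (hT : ∀ i x, ‖T i x‖ ≤ C * ‖x‖) : lp (fun _ : ι => E) 2 →L[ℂ] lp (fun _ : ι => E) 2 :=
  (lpShiftLinear e T C hT).mkContinuous C (norm_lpShiftLinear_le e T C hC hT)

variable {e : Equiv.Perm ι} {T : ι → E →L[ℂ] E} {C : ℝ} {hC : 0 ≤ C}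
  {hT : ∀ i x, ‖T i x‖ ≤ C * ‖x‖}

theorem lpShift_apply (ψ : lp (fun _ : ι => E) 2) (i : ι) :
    lpShift e T C hC hT ψ i = T i (ψ (e i)) := rfl

theorem norm_lpShift_le (ψ : lp (fun _ : ι => E) 2) : ‖lpShift e T C hC hT ψ‖ ≤ C * ‖ψ‖ :=
  ContinuousLinearMap.le_of_opNorm_le _ (LinearMap.mkContinuous_norm_le _ hC _) ψ

theorem inner_lpShift {T' : ι → E →L[ℂ] E} {C' : ℝ} {hC' : 0 ≤ C'}
    {hT' : ∀ i x, ‖T' i x‖ ≤ C' * ‖x‖}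
    (h : ∀ i x y, inner ℂ (T i x) y = inner ℂ x (T' (e i) y)) (φ ψ : lp (fun _ : ι => E) 2) :
    inner ℂ (lpShift e T C hC hT φ) ψ = inner ℂ φ (lpShift e.symm T' C' hC' hT' ψ) := by
  rw [lp.inner_eq_tsum, lp.inner_eq_tsum, ← e.tsum_eq fun i => inner ℂ (φ i) _]
  refine tsum_congr fun i => ?_
  rw [lpShift_apply, lpShift_apply, e.symm_apply_apply, h]

end LpShift

/-! ### The representation `π` on `L²(Λ, μ) ⊗ ℓ²(Γ)`. -/

section Tensor

variable {Γ Λ : Type*} [Group Γ] [TopologicalSpace Λ] [MulAction Γ Λ] [ContinuousConstSMul Γ Λ]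
  [CompactSpace Λ] [MeasurableSpace Λ] [BorelSpace Λ] {μ : Measure Λ}

theorem norm_mulLp_le (f : C(Λ, ℂ)) (h : Lp ℂ 2 μ) : ‖mulLp μ f h‖ ≤ ‖f‖ * ‖h‖ :=
  ContinuousLinearMap.le_of_opNorm_le _ (NonUnitalStarAlgHom.norm_apply_le (mulRep μ) f) h

theorem mulLp_mul (f g : C(Λ, ℂ)) (h : Lp ℂ 2 μ) :
    mulLp μ (f * g) h = mulLp μ f (mulLp μ g h) :=
  congrArg (· h) (map_mul (mulRep μ) f g)

theorem mulLp_one (h : Lp ℂ 2 μ) : mulLp μ 1 h = h := congrArg (· h) (map_one (mulRep μ))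

theorem inner_mulLp (f : C(Λ, ℂ)) (h k : Lp ℂ 2 μ) :
    inner ℂ (mulLp μ f h) k = inner ℂ h (mulLp μ (star f) k) := by
  have : mulLp μ (star f) = ContinuousLinearMap.adjoint (mulLp μ f) := map_star (mulRep μ) f
  rw [this, ContinuousLinearMap.adjoint_inner_right]

/-- `C(Λ)` acts on `L²(Λ, μ) ⊗ ℓ²(Γ)` by multiplication operators on the first factor. -/
def tensorMulRep (Γ : Type*) (μ : Measure Λ) :
    C(Λ, ℂ) →⋆ₐ[ℂ] (HilbertTensor Γ μ →L[ℂ] HilbertTensor Γ μ) where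
  toFun f := lpShift 1 (fun _ : Γ => mulLp μ f) ‖f‖ (norm_nonneg f) fun _ => norm_mulLp_le f
  map_one' := ContinuousLinearMap.ext fun ψ => lp.ext (funext fun γ => mulLp_one _)
  map_mul' f g := ContinuousLinearMap.ext fun ψ => lp.ext (funext fun γ => mulLp_mul f g _)
  map_zero' := ContinuousLinearMap.ext fun ψ => lp.ext (funext fun γ =>
    congrArg (· (ψ γ)) (map_zero (mulRep μ)))
  map_add' f g := ContinuousLinearMap.ext fun ψ => lp.ext (funext fun γ =>
    congrArg (· (ψ γ)) (map_add (mulRep μ) f g))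
  commutes' c := ContinuousLinearMap.ext fun ψ => lp.ext (funext fun γ =>
    congrArg (· (ψ γ)) (AlgHomClass.commutes (mulRep μ) c))
  map_star' f := by
    rw [ContinuousLinearMap.star_eq_adjoint, ContinuousLinearMap.eq_adjoint_iff]
    intro φ ψ
    exact inner_lpShift (fun _ x y => by rw [inner_mulLp, star_star]) φ ψ

theorem tmul_apply_self (h : Lp ℂ 2 μ) (γ : Γ) : (tmul h γ : HilbertTensor Γ μ) γ = h := by
  classical exact lp.single_apply_self _ _ _

theorem tmul_apply_ne (h : Lp ℂ 2 μ) {γ γ' : Γ} (hne : γ' ≠ γ) :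
    (tmul h γ : HilbertTensor Γ μ) γ' = 0 := by
  classical exact lp.single_apply_ne _ _ _ hne

variable [IsFiniteMeasure μ] (hq : ∀ γ : Γ, μ.map (γ • ·) ≪ μ)

/-- The unitary representation `U_γ (h ⊗ γ') = υ_γ(h) ⊗ γ γ'`. -/
def tensorKoopman : Γ →* (HilbertTensor Γ μ →L[ℂ] HilbertTensor Γ μ) where
  toFun γ := lpShift (Equiv.mulLeft γ⁻¹)
    (fun _ => ((koopman hq γ).toContinuousLinearEquiv : Lp ℂ 2 μ →L[ℂ] Lp ℂ 2 μ)) 1 zero_le_one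
    fun _ x => by rw [one_mul]; exact ((koopman hq γ).norm_map x).le
  map_one' := ContinuousLinearMap.ext fun ψ => lp.ext (funext fun γ => by
    change koopman hq 1 (ψ (1⁻¹ * γ)) = ψ γ
    rw [inv_one, one_mul, map_one]
    rfl)
  map_mul' γ δ := ContinuousLinearMap.ext fun ψ => lp.ext (funext fun γ' => by
    change koopman hq (γ * δ) (ψ ((γ * δ)⁻¹ * γ')) =
      koopman hq γ (koopman hq δ (ψ (δ⁻¹ * (γ⁻¹ * γ'))))
    rw [map_mul, mul_inv_rev, mul_assoc]
    rfl)

theorem tensorKoopman_apply (γ : Γ) (ψ : HilbertTensor Γ μ) (γ' : Γ) :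
    tensorKoopman hq γ ψ γ' = koopman hq γ (ψ (γ⁻¹ * γ')) := rfl

theorem inner_koopman (γ : Γ) (h k : Lp ℂ 2 μ) :
    inner ℂ (koopman hq γ⁻¹ h) k = inner ℂ h (koopman hq γ k) := by
  rw [← (koopman hq γ).inner_map_map]
  congr 1
  change (koopman hq γ * koopman hq γ⁻¹) h = h
  rw [← map_mul, mul_inv_cancel, map_one]
  rfl

theorem star_tensorKoopman (γ : Γ) : star (tensorKoopman hq γ) = tensorKoopman hq γ⁻¹ := by
  rw [eq_comm, ContinuousLinearMap.star_eq_adjoint, ContinuousLinearMap.eq_adjoint_iff]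
  intro φ ψ
  rw [lp.inner_eq_tsum, lp.inner_eq_tsum, ← (Equiv.mulLeft γ).tsum_eq fun i => inner ℂ (φ i) _]
  refine tsum_congr fun γ' => ?_
  rw [tensorKoopman_apply, tensorKoopman_apply, Equiv.coe_mulLeft, inv_mul_cancel_left, inv_inv,
    inner_koopman]

/-- The representation of the crossed product on `L²(Λ, μ) ⊗ ℓ²(Γ)`. -/
def tensorRep : CrossedProduct Γ Λ →⋆ₐ[ℂ] (HilbertTensor Γ μ →L[ℂ] HilbertTensor Γ μ) :=
  CrossedProduct.lift (tensorMulRep Γ μ) (tensorKoopman hq) (star_tensorKoopman hq) fun γ f =>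
    ContinuousLinearMap.ext fun _ => lp.ext (funext fun _ => koopman_mulLp hq γ f _)

theorem tensorRep_mono (f : C(Λ, ℂ)) (γ : Γ) (ψ : HilbertTensor Γ μ) (γ' : Γ) :
    tensorRep hq (CrossedProduct.mono f γ) ψ γ' =
      mulLp μ f (koopman hq γ (ψ (γ⁻¹ * γ'))) := by
  rw [tensorRep, CrossedProduct.lift_mono]
  rfl

theorem isCovariantRepresentation_tensorRep :
    IsCovariantRepresentation μ (koopman hq) (tensorRep hq) := fun f γ h γ' =>
  ⟨mulLp μ f (koopman hq γ h), coeFn_mulLp _ _, lp.ext (funext fun δ => by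
    rw [tensorRep_mono]
    by_cases hδ : δ = γ * γ'
    · rw [hδ, inv_mul_cancel_left, tmul_apply_self, tmul_apply_self]
    · rw [tmul_apply_ne _ hδ, tmul_apply_ne _ fun e => hδ (by rw [← e, mul_inv_cancel_left]),
        map_zero, map_zero])⟩

end Tensor

/-! ### The Hamiltonian: unitary group, self-adjointness, implementation of `σ`. -/

section Hamiltonian

variable {Γ Λ : Type*} [Group Γ] [TopologicalSpace Λ] [MulAction Γ Λ] [ContinuousConstSMul Γ Λ]
  [CompactSpace Λ] [MeasurableSpace Λ] [BorelSpace Λ] {μ : Measure Λ} (b : RealCocycle Γ Λ)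

namespace RealCocycle

theorem norm_mulLp_phase_le (t : ℝ) (γ : Γ) (h : Lp ℂ 2 μ) :
    ‖mulLp μ (b.phase t γ) h‖ ≤ 1 * ‖h‖ := by
  rw [one_mul]
  conv_rhs => rw [← mulLp_one h]
  exact norm_mulLp_apply_le_of_le (fun ξ => by
    rw [b.norm_phase_apply, ContinuousMap.one_apply, norm_one]) h

/-- The operator `exp (i t H) (h ⊗ γ) = exp (i t b γ) h ⊗ γ`. -/
def phaseOp (μ : Measure Λ) (t : ℝ) : HilbertTensor Γ μ →L[ℂ] HilbertTensor Γ μ :=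
  lpShift 1 (fun γ => mulLp μ (b.phase t γ)) 1 zero_le_one (b.norm_mulLp_phase_le t)

theorem phaseOp_apply (t : ℝ) (ψ : HilbertTensor Γ μ) (γ : Γ) :
    b.phaseOp μ t ψ γ = mulLp μ (b.phase t γ) (ψ γ) := rfl

theorem phaseOp_zero (ψ : HilbertTensor Γ μ) : b.phaseOp μ 0 ψ = ψ :=
  lp.ext (funext fun γ => by rw [phaseOp_apply, phase_zero, mulLp_one])

theorem phaseOp_add (s t : ℝ) (ψ : HilbertTensor Γ μ) :
    b.phaseOp μ (s + t) ψ = b.phaseOp μ s (b.phaseOp μ t ψ) :=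
  lp.ext (funext fun γ => by
    rw [phaseOp_apply, phaseOp_apply, phaseOp_apply, phase_add, mulLp_mul])

theorem norm_phaseOp_le (t : ℝ) (ψ : HilbertTensor Γ μ) : ‖b.phaseOp μ t ψ‖ ≤ ‖ψ‖ :=
  (norm_lpShift_le ψ).trans (one_mul _).le

theorem phaseOp_neg_phaseOp (t : ℝ) (ψ : HilbertTensor Γ μ) :
    b.phaseOp μ (-t) (b.phaseOp μ t ψ) = ψ := by
  rw [← phaseOp_add, neg_add_cancel, phaseOp_zero]

/-- The unitary group generated by the Hamiltonian. -/
def unitaryGroup (μ : Measure Λ) (t : ℝ) : HilbertTensor Γ μ ≃ₗᵢ[ℂ] HilbertTensor Γ μ where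
  toLinearEquiv :=
    LinearEquiv.ofLinearMap (b.phaseOp μ t).toLinearMap (b.phaseOp μ (-t)).toLinearMap
    (LinearMap.ext fun ψ => by
      have := b.phaseOp_neg_phaseOp (-t) ψ
      rwa [neg_neg] at this)
    (LinearMap.ext (b.phaseOp_neg_phaseOp t))
  norm_map' ψ := le_antisymm (b.norm_phaseOp_le t ψ) (by
    have := b.norm_phaseOp_le (-t) (b.phaseOp μ t ψ)
    rwa [phaseOp_neg_phaseOp] at this)

theorem unitaryGroup_apply (t : ℝ) (ψ : HilbertTensor Γ μ) (γ : Γ) :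
    b.unitaryGroup μ t ψ γ = mulLp μ (b.phase t γ) (ψ γ) := rfl

theorem isDiagonalProduct_iff {ψ φ : HilbertTensor Γ μ} :
    IsDiagonalProduct (fun γ ξ => b.toFun γ ξ) ψ φ ↔ ∀ γ, φ γ = mulLp μ (b.toComplex γ) (ψ γ) :=
  forall_congr' fun γ => (eq_mulLp_iff (f := b.toComplex γ)).symm

theorem star_toComplex (γ : Γ) : star (b.toComplex γ) = b.toComplex γ :=
  ContinuousMap.ext fun _ => Complex.conj_ofReal _

theorem continuous_mulLp_apply (h : Lp ℂ 2 μ) : Continuous fun f : C(Λ, ℂ) => mulLp μ f h := by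
  have : Continuous (mulRep μ) := AddMonoidHomClass.continuous_of_bound _ 1 fun f => by
    rw [one_mul]; exact NonUnitalStarAlgHom.norm_apply_le (mulRep μ) f
  exact (ContinuousLinearMap.apply ℂ (Lp ℂ 2 μ) h).continuous.comp this

theorem continuous_unitaryGroup (ψ : HilbertTensor Γ μ) :
    Continuous fun t => b.unitaryGroup μ t ψ := by
  refine continuous_iff_continuousAt.2 fun t => ?_
  -- Both phases are contractive, so each fibre of the difference is at most `2 ‖ψ γ‖`, which is
  -- square summable.
  refine lp_tendsto_of_dominated (g := fun γ => 2 * ‖ψ γ‖) ?_ (.of_forall fun s γ => ?_) fun γ => ?_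
  · simp only [mul_pow]
    exact (lp_summable_sq ψ).mul_left _
  · refine (norm_sub_le _ _).trans ?_
    rw [unitaryGroup_apply, unitaryGroup_apply, two_mul]
    have h1 := b.norm_mulLp_phase_le s γ (ψ γ)
    have h2 := b.norm_mulLp_phase_le t γ (ψ γ)
    rw [one_mul] at h1 h2
    exact add_le_add h1 h2
  · exact ((continuous_mulLp_apply (ψ γ)).comp (b.continuous_phase γ)).continuousAt

/-- Each single `b γ` is an element of the Banach algebra `C(Λ)`, so the phase is a norm-continuous
exponential there and can be differentiated in norm. -/
theorem phase_eq_exp (t : ℝ) (γ : Γ) :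
    b.phase t γ = NormedSpace.exp (t • (I • b.toComplex γ)) := by
  ext ξ
  let ev : C(Λ, ℂ) →+* ℂ := (Pi.evalRingHom (fun _ : Λ => ℂ) ξ).comp ContinuousMap.coeFnRingHom
  have hev : Continuous ev := continuous_eval_const ξ
  change _ = ev (NormedSpace.exp (t • (I • b.toComplex γ)))
  rw [NormedSpace.map_exp ev hev, ← Complex.exp_eq_exp_ℂ]
  change exp (I * t * (b.toFun γ ξ : ℂ)) = exp (t • (I • (b.toFun γ ξ : ℂ)))
  congr 1
  simp
  ring

theorem hasDerivAt_mulLp_phase (γ : Γ) (h : Lp ℂ 2 μ) :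
    HasDerivAt (fun t => mulLp μ (b.phase t γ) h) (I • mulLp μ (b.toComplex γ) h) 0 := by
  have h1 : HasDerivAt (fun t : ℝ => b.phase t γ) (I • b.toComplex γ) 0 := by
    simp only [phase_eq_exp]
    simpa using hasDerivAt_exp_smul_const (𝕂 := ℝ) (I • b.toComplex γ) 0
  let L : C(Λ, ℂ) →L[ℝ] Lp ℂ 2 μ :=
    { toFun := fun f => mulLp μ f h
      map_add' := fun f g => congrArg (· h) (map_add (mulRep μ) f g)
      map_smul' := fun c f => by
        have := congrArg (· h) (map_smul (mulRep μ) (c : ℂ) f)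
        exact this
      cont := continuous_mulLp_apply h }
  have h2 := L.hasFDerivAt.comp_hasDerivAt 0 h1
  have h3 : L (I • b.toComplex γ) = I • mulLp μ (b.toComplex γ) h :=
    congrArg (· h) (map_smul (mulRep μ) I (b.toComplex γ))
  rwa [h3] at h2

/-- From `|exp(i t x) - 1| ≤ |t x|`. The bound does not depend on `t`, so it dominates the
difference quotients over all `γ` at once even if the functions `b γ` are not uniformly bounded. -/
theorem norm_slope_mulLp_phase_le (γ : Γ) (h : Lp ℂ 2 μ) (t : ℝ) :
    ‖slope (fun t => mulLp μ (b.phase t γ) h) 0 t‖ ≤ ‖mulLp μ (b.toComplex γ) h‖ := by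
  have e : slope (fun t => mulLp μ (b.phase t γ) h) 0 t =
      mulLp μ (((t⁻¹ : ℝ) : ℂ) • (b.phase t γ - 1)) h := by
    rw [← mulRep_apply, map_smul, map_sub, _root_.map_one, slope_def_module, sub_zero, phase_zero,
      mulLp_one]
    rfl
  rw [e]
  refine norm_mulLp_apply_le_of_le (fun ξ => ?_) h
  change ‖((t⁻¹ : ℝ) : ℂ) * (exp (I * t * b.toFun γ ξ) - 1)‖ ≤ ‖(b.toFun γ ξ : ℂ)‖
  rw [norm_mul, Complex.norm_real, Complex.norm_real, norm_inv]
  have h1 := Real.norm_exp_I_mul_ofReal_sub_one_le (x := t * b.toFun γ ξ)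
  rw [Complex.ofReal_mul, ← mul_assoc, norm_mul] at h1
  -- At `t = 0` the slope is zero, since `0⁻¹ = 0`.
  rcases eq_or_ne t 0 with rfl | ht
  · simp
  · rw [inv_mul_le_iff₀ (norm_pos_iff.2 ht)]
    exact h1

theorem slope_apply (ψ : HilbertTensor Γ μ) (t : ℝ) (γ : Γ) :
    (slope (fun t => b.unitaryGroup μ t ψ) 0 t : HilbertTensor Γ μ) γ =
      slope (fun t => mulLp μ (b.phase t γ) (ψ γ)) 0 t := by
  rw [slope_def_module, slope_def_module]
  rfl

/-- Coordinates are continuous linear maps, so a derivative can be read off fibre by fibre.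
Conversely, the fibres of `φ`, which are square summable, dominate the difference quotients. This is
why the generator has exactly the maximal domain. -/
theorem hasDerivAt_unitaryGroup {ψ φ : HilbertTensor Γ μ} :
    HasDerivAt (fun t => b.unitaryGroup μ t ψ) φ 0 ↔
      ∀ γ, φ γ = I • mulLp μ (b.toComplex γ) (ψ γ) := by
  constructor
  · intro h γ
    have h1 := ((lp.evalCLM ℝ (fun _ : Γ => Lp ℂ 2 μ) 2 γ).hasFDerivAt).comp_hasDerivAt 0 h
    exact h1.unique (b.hasDerivAt_mulLp_phase γ (ψ γ))
  · intro h
    rw [hasDerivAt_iff_tendsto_slope]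
    refine lp_tendsto_of_dominated (g := fun γ => 2 * ‖φ γ‖) ?_ (.of_forall fun t γ => ?_)
      fun γ => ?_
    · simp only [mul_pow]
      exact (lp_summable_sq φ).mul_left _
    · refine (norm_sub_le _ _).trans ?_
      rw [slope_apply, two_mul]
      refine add_le_add ((b.norm_slope_mulLp_phase_le γ (ψ γ) t).trans ?_) le_rfl
      rw [h, norm_smul, norm_I, one_mul]
    · simp only [slope_apply]
      rw [h]
      exact hasDerivAt_iff_tendsto_slope.1 (b.hasDerivAt_mulLp_phase γ (ψ γ))

/-- The Hamiltonian `H (h ⊗ γ) = b γ h ⊗ γ`. -/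
abbrev energy (μ : Measure Λ) : HilbertTensor Γ μ →ₗ.[ℂ] HilbertTensor Γ μ :=
  hamiltonian μ fun γ ξ => b.toFun γ ξ

theorem energy_apply (ψ : (b.energy μ).domain) (γ : Γ) :
    b.energy μ ψ γ = mulLp μ (b.toComplex γ) ((ψ : HilbertTensor Γ μ) γ) :=
  b.isDiagonalProduct_iff.1 (hamiltonian_spec μ _ ψ) γ

theorem mem_energy_domain {ψ φ : HilbertTensor Γ μ}
    (h : ∀ γ, φ γ = mulLp μ (b.toComplex γ) (ψ γ)) : ψ ∈ (b.energy μ).domain :=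
  ⟨φ, b.isDiagonalProduct_iff.2 h⟩

theorem energy_eq {ψ : (b.energy μ).domain} {φ : HilbertTensor Γ μ}
    (h : ∀ γ, φ γ = mulLp μ (b.toComplex γ) ((ψ : HilbertTensor Γ μ) γ)) : b.energy μ ψ = φ :=
  lp.ext (funext fun γ => (b.energy_apply ψ γ).trans (h γ).symm)

theorem isUnitaryGroupOf_unitaryGroup : IsUnitaryGroupOf (b.energy μ) (b.unitaryGroup μ) where
  zero := LinearIsometryEquiv.ext b.phaseOp_zero
  add s t := LinearIsometryEquiv.ext (b.phaseOp_add s t)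
  continuous := b.continuous_unitaryGroup
  generator ψ φ := by
    refine Iff.trans b.hasDerivAt_unitaryGroup ⟨?_, ?_⟩
    · intro h
      -- Solving `φ = i H ψ` for `H ψ` gives the witness `-i φ`.
      have h' : ∀ γ, (-I • φ) γ = mulLp μ (b.toComplex γ) (ψ γ) := fun γ => by
        rw [lp.coeFn_smul, Pi.smul_apply, h γ, smul_smul, neg_mul, I_mul_I, neg_neg, one_smul]
      refine ⟨b.mem_energy_domain h', ?_⟩
      rw [b.energy_eq (ψ := ⟨ψ, b.mem_energy_domain h'⟩) h', smul_smul, mul_neg, I_mul_I, neg_neg,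
        one_smul]
    · rintro ⟨h, rfl⟩ γ
      rw [lp.coeFn_smul, Pi.smul_apply, energy_apply]

theorem tmul_mulLp_apply (h : Lp ℂ 2 μ) (γ δ : Γ) :
    (tmul (mulLp μ (b.toComplex γ) h) γ : HilbertTensor Γ μ) δ =
      mulLp μ (b.toComplex δ) ((tmul h γ : HilbertTensor Γ μ) δ) := by
  by_cases hδ : δ = γ
  · rw [hδ, tmul_apply_self, tmul_apply_self]
  · rw [tmul_apply_ne _ hδ, tmul_apply_ne _ hδ, map_zero]

theorem tmul_mem_domain (h : Lp ℂ 2 μ) (γ : Γ) : tmul h γ ∈ (b.energy μ).domain :=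
  b.mem_energy_domain (b.tmul_mulLp_apply h γ)

theorem energy_tmul (h : Lp ℂ 2 μ) (γ : Γ) :
    b.energy μ ⟨tmul h γ, b.tmul_mem_domain h γ⟩ = tmul (mulLp μ (b.toComplex γ) h) γ :=
  b.energy_eq (b.tmul_mulLp_apply h γ)

/-- Every vector is the sum of its coordinates, and finite sums of elementary tensors lie in the
domain. -/
theorem dense_energy_domain : Dense ((b.energy μ).domain : Set (HilbertTensor Γ μ)) := by
  classical
  intro ψ
  refine mem_closure_of_tendsto (lp.hasSum_single ENNReal.ofNat_ne_top ψ)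
    (.of_forall fun s => Submodule.sum_mem _ fun γ _ => ?_)
  convert b.tmul_mem_domain (ψ γ) γ
  unfold tmul
  congr

theorem inner_tmul (h : Lp ℂ 2 μ) (γ : Γ) (ψ : HilbertTensor Γ μ) :
    inner ℂ ψ (tmul h γ) = inner ℂ (ψ γ) h := by
  classical exact lp.inner_single_right _ _ _

/-- Symmetry holds because `b` is real. For `ψ` in the domain of the adjoint, testing against `h ⊗
γ` identifies the coordinate at `γ` of `H* ψ` as `b γ · ψ γ`; these coordinates then form a vector
of the Hilbert space, so `ψ` is already in the maximal domain. -/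
theorem isSelfAdjoint_energy : IsSelfAdjoint (b.energy μ) := by
  rw [LinearPMap.isSelfAdjoint_def]
  have hd := b.dense_energy_domain (μ := μ)
  have hle : b.energy μ ≤ (b.energy μ).adjoint := by
    refine LinearPMap.IsFormalAdjoint.le_adjoint hd fun ψ φ => ?_
    rw [lp.inner_eq_tsum, lp.inner_eq_tsum]
    refine tsum_congr fun γ => ?_
    rw [energy_apply, energy_apply, inner_mulLp, star_toComplex]
  refine (LinearPMap.eq_of_le_of_domain_eq hle (le_antisymm hle.1 fun ψ hψ => ?_)).symm
  refine b.mem_energy_domain (φ := (b.energy μ).adjoint ⟨ψ, hψ⟩) fun γ => ?_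
  refine ext_inner_right ℂ fun h => ?_
  have := LinearPMap.adjoint_isFormalAdjoint hd ⟨ψ, hψ⟩ ⟨tmul h γ, b.tmul_mem_domain h γ⟩
  rw [energy_tmul, inner_tmul, inner_tmul] at this
  rw [this, inner_mulLp, star_toComplex]

theorem unitaryGroup_conj_tensorRep [IsFiniteMeasure μ]
    (hq : ∀ γ : Γ, μ.map (γ • ·) ≪ μ) (t : ℝ) (a : CrossedProduct Γ Λ) (ψ : HilbertTensor Γ μ) :
    b.unitaryGroup μ t (tensorRep hq a (b.unitaryGroup μ (-t) ψ)) =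
      tensorRep hq (b.evolution t a) ψ := by
  have hπ : Continuous (tensorRep hq) := AddMonoidHomClass.continuous_of_bound _ 1 fun a => by
    rw [one_mul]; exact NonUnitalStarAlgHom.norm_apply_le (tensorRep hq) a
  have hσ : Continuous (b.evolution (Γ := Γ) (Λ := Λ) t) :=
    AddMonoidHomClass.continuous_of_bound _ 1 fun a => by
      rw [one_mul]; exact b.norm_evolutionHom_le t a
  induction a using CrossedProduct.induction_mono with
  | hc =>
    refine isClosed_eq ((b.unitaryGroup μ t).continuous.comp ?_) ?_
    · exact (ContinuousLinearMap.apply ℂ (HilbertTensor Γ μ) _).continuous.comp hπ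
    · exact (ContinuousLinearMap.apply ℂ (HilbertTensor Γ μ) ψ).continuous.comp (hπ.comp hσ)
  | h0 => simp
  | ha a a' h h' =>
    rw [map_add, map_add, map_add, add_apply, map_add, h, h', add_apply]
  | hm f γ =>
    refine lp.ext (funext fun δ => ?_)
    have e : b.evolution t (CrossedProduct.mono f γ) = CrossedProduct.mono (b.phase t γ * f) γ :=
      b.evolutionHom_mono t f γ
    rw [unitaryGroup_apply, e, tensorRep_mono, tensorRep_mono, unitaryGroup_apply, koopman_mulLp,
      ← mulLp_mul, ← mulLp_mul]
    -- What remains is an identity in `C(Λ)`: the phase at `δ` factors as the phase at `γ` times the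
    -- translate of the phase at `γ⁻¹δ`, and the latter cancels against the phase at time `-t`.
    congr 2
    have h1 := b.phase_mul t γ (γ⁻¹ * δ)
    rw [mul_inv_cancel_left] at h1
    have h2 : γ • b.phase t (γ⁻¹ * δ) * γ • b.phase (-t) (γ⁻¹ * δ) = 1 := by
      rw [← smul_mul', ← phase_add, add_neg_cancel, phase_zero, smul_one]
    rw [h1]
    linear_combination (b.phase t γ * f) * h2

theorem dynamics_implemented [IsFiniteMeasure μ] (hq : ∀ γ : Γ, μ.map (γ • ·) ≪ μ) :
    ∃ (υ : Γ →* (Lp ℂ 2 μ ≃ₗᵢ[ℂ] Lp ℂ 2 μ))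
      (π : CrossedProduct Γ Λ →⋆ₐ[ℂ] (HilbertTensor Γ μ →L[ℂ] HilbertTensor Γ μ))
      (σ : ℝ → CrossedProduct Γ Λ ≃⋆ₐ[ℂ] CrossedProduct Γ Λ)
      (W : ℝ → HilbertTensor Γ μ ≃ₗᵢ[ℂ] HilbertTensor Γ μ),
      IsKoopman μ υ ∧ IsCovariantRepresentation μ υ π ∧
      IsTimeEvolution (fun γ ξ => b.toFun γ ξ) σ ∧
      (∀ (h : Lp ℂ 2 μ) (γ : Γ), ∃ k : Lp ℂ 2 μ,
        (k =ᵐ[μ] fun ξ => (b.toFun γ ξ : ℂ) * h ξ) ∧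
        ∃ hdom : tmul h γ ∈ (b.energy μ).domain,
          b.energy μ ⟨tmul h γ, hdom⟩ = tmul k γ) ∧
      IsSelfAdjoint (b.energy μ) ∧ IsUnitaryGroupOf (b.energy μ) W ∧
      ∀ t a ψ, W t (π a (W (-t) ψ)) = π (σ t a) ψ :=
  ⟨koopman hq, tensorRep hq, b.evolution, b.unitaryGroup μ, isKoopman_koopman hq,
    isCovariantRepresentation_tensorRep hq, b.isTimeEvolution_evolution,
    fun h γ => ⟨mulLp μ (b.toComplex γ) h, coeFn_mulLp _ _, b.tmul_mem_domain h γ,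
      b.energy_tmul h γ⟩,
    b.isSelfAdjoint_energy, b.isUnitaryGroupOf_unitaryGroup, b.unitaryGroup_conj_tensorRep hq⟩

end RealCocycle

end Hamiltonian

/-! ### Existence of Busemann limits. -/

section BusemannLimit

variable {Λ P : Type*} [TopologicalSpace Λ] {d : P → P → ℝ} {F : Λ → Filter P}

/-- The limit `B(x, y, ξ)` exists for all `ξ` and depends continuously on `ξ`. -/
def HasBusemannLimit (d : P → P → ℝ) (F : Λ → Filter P) (x y : P) : Prop :=
  ∃ β : C(Λ, ℝ), ∀ ξ, Tendsto (fun z => d x z - d y z) (F ξ) (𝓝 (β ξ))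

theorem HasBusemannLimit.refl (x : P) : HasBusemannLimit d F x x :=
  ⟨0, fun ξ => by simp only [sub_self]; exact tendsto_const_nhds⟩

/-- The differences telescope; this reduces existence for arbitrary pairs of vertices to the end
points of an edge. -/
theorem HasBusemannLimit.trans {x y w : P} (h : HasBusemannLimit d F x y)
    (h' : HasBusemannLimit d F y w) : HasBusemannLimit d F x w := by
  obtain ⟨β, hβ⟩ := h
  obtain ⟨β', hβ'⟩ := h'
  exact ⟨β + β', fun ξ => ((hβ ξ).add (hβ' ξ)).congr fun z => sub_add_sub_cancel _ _ _⟩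

end BusemannLimit

/-! ### Quasi-invariance of Patterson–Sullivan measures and the general criterion. -/

section QuasiInvariance

open scoped ENNReal NNReal BoundedContinuousFunction

variable {Γ Λ P : Type*} [Group Γ] [MulAction Γ P] {d : P → P → ℝ} {x₀ : P}

/-- Replacing `δ` by `γ⁻¹δ` turns the weight with `d(x₀, δx₀)` into the one with `d(γx₀, δx₀)`, and
the exponents differ by at most `|s| C`. The absolute value is there because no sign of `s` is
assumed. The normalising denominators agree. -/
theorem orbitMean_comp_smul_le (hd : ∀ (γ : Γ) x y, d (γ • x) (γ • y) = d x y) {γ : Γ} {C : ℝ}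
    (hC : ∀ z, |d x₀ z - d (γ • x₀) z| ≤ C) {s : ℝ}
    (hs : Summable fun γ : Γ => Real.exp (-s * d x₀ (γ • x₀))) {φ : P → ℝ} (hφ : ∀ x, 0 ≤ φ x)
    (hφb : ∃ M, ∀ x, |φ x| ≤ M) :
    orbitMean Γ d x₀ s (fun x => φ (γ • x)) ≤ Real.exp (|s| * C) * orbitMean Γ d x₀ s φ := by
  obtain ⟨M, hM⟩ := hφb
  have hsum : Summable fun δ : Γ => Real.exp (-s * d x₀ (δ • x₀)) * φ (δ • x₀) := by
    refine Summable.of_nonneg_of_le (fun δ => mul_nonneg (Real.exp_pos _).le (hφ _)) (fun δ => ?_)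
      (hs.mul_right M)
    exact mul_le_mul_of_nonneg_left ((le_abs_self _).trans (hM _)) (Real.exp_pos _).le
  have hle : ∀ δ : Γ, Real.exp (-s * d x₀ ((γ⁻¹ * δ) • x₀)) * φ (γ • (γ⁻¹ * δ) • x₀) ≤
      Real.exp (|s| * C) * (Real.exp (-s * d x₀ (δ • x₀)) * φ (δ • x₀)) := fun δ => by
    have h1 : d x₀ ((γ⁻¹ * δ) • x₀) = d (γ • x₀) (δ • x₀) := by
      rw [← hd γ, smul_smul, mul_inv_cancel_left]
    rw [h1, smul_smul, mul_inv_cancel_left, ← mul_assoc, ← Real.exp_add]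
    refine mul_le_mul_of_nonneg_right (Real.exp_le_exp.2 ?_) (hφ _)
    have h2 : s * (d x₀ (δ • x₀) - d (γ • x₀) (δ • x₀)) ≤ |s| * C :=
      (le_abs_self _).trans (by
        rw [abs_mul]; exact mul_le_mul_of_nonneg_left (hC _) (abs_nonneg _))
    linarith
  rw [orbitMean, orbitMean, ← mul_div_assoc]
  refine div_le_div_of_nonneg_right ?_ (tsum_nonneg fun δ => (Real.exp_pos _).le)
  rw [← (Equiv.mulLeft γ⁻¹).tsum_eq, ← tsum_mul_left]
  refine Summable.tsum_le_tsum hle (Summable.of_nonneg_of_le (fun δ => ?_) hle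
    (hsum.mul_left _)) (hsum.mul_left _)
  exact mul_nonneg (Real.exp_pos _).le (hφ _)

variable [TopologicalSpace Λ] [CompactSpace Λ] [MulAction Γ Λ] [ContinuousConstSMul Γ Λ]
  [MeasurableSpace Λ] [BorelSpace Λ] {F : Λ → Filter P} {μ : Measure Λ}

/-- The comparison of orbit means passes to the weak limit. The maps `e` and `j` send boundary and
vertices to a common normal space `Y`, where Tietze's theorem extends `ψ` to a test function on the
vertices. -/
theorem integral_comp_smul_le {Y : Type*} [TopologicalSpace Y] [NormalSpace Y] {e : Λ → Y}
    (he : IsClosedEmbedding e) {j : P → Y} (hj : ∀ ξ, Tendsto j (F ξ) (𝓝 (e ξ)))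
    (hF : ∀ (γ : Γ) ξ, Tendsto (γ • ·) (F ξ) (F (γ • ξ)))
    (hd : ∀ (γ : Γ) x y, d (γ • x) (γ • y) = d x y) {γ : Γ} {C : ℝ}
    (hC : ∀ z, |d x₀ z - d (γ • x₀) z| ≤ C) (hμ : IsPattersonSullivan Γ d F x₀ μ)
    (ψ : C(Λ, ℝ)) (hψ : ∀ ξ, 0 ≤ ψ ξ) :
    ∫ ξ, ψ (γ • ξ) ∂μ ≤ Real.exp (|criticalExponent Γ d x₀| * C) * ∫ ξ, ψ ξ ∂μ := by
  have := hμ.isProbabilityMeasure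
  obtain ⟨s, -, hs, hlim⟩ := hμ.exists_weak_limit
  obtain ⟨g, -, hg⟩ := BoundedContinuousFunction.exists_extension_norm_eq_of_isClosedEmbedding
    (BoundedContinuousFunction.mkOfCompact ψ) he
  have hg' : ∀ ξ, g (e ξ) = ψ ξ := fun ξ => congrFun hg ξ
  -- Truncation at `0` restores the sign that the comparison of means needs, and leaves the boundary
  -- values `ψ ≥ 0` unchanged.
  let φ : P → ℝ := fun x => max (g (j x)) 0
  have hφ0 : ∀ x, 0 ≤ φ x := fun x => le_max_right _ _
  have hφb : ∀ x, |φ x| ≤ ‖g‖ := fun x => by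
    rw [abs_of_nonneg (hφ0 x)]
    exact max_le ((le_abs_self _).trans (g.norm_coe_le_norm _)) (norm_nonneg g)
  have hφ : ∀ ξ, Tendsto φ (F ξ) (𝓝 (ψ ξ)) := fun ξ => by
    have h : Tendsto (fun x => max (g (j x)) 0) (F ξ) (𝓝 (max (g (e ξ)) 0)) :=
      ((g.continuous.tendsto _).comp (hj ξ)).max tendsto_const_nhds
    rwa [hg', max_eq_left (hψ ξ)] at h
  -- Testing with the constant `1` shows that the Poincaré series converges at `s n` for large `n`:
  -- where it diverges, its `tsum` is `0` and the orbit mean is `0`, not close to `1`.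
  have h1 := hlim (fun _ => 1) 1 ⟨1, fun _ => by simp⟩ fun ξ => tendsto_const_nhds
  have hsum : ∀ᶠ n in atTop, Summable fun γ : Γ => Real.exp (-s n * d x₀ (γ • x₀)) := by
    have h2 : ∫ ξ, (1 : C(Λ, ℝ)) ξ ∂μ = 1 := by simp
    rw [h2] at h1
    filter_upwards [h1.eventually_ne one_ne_zero] with n hn
    by_contra hns
    exact hn (by rw [orbitMean, tsum_eq_zero_of_not_summable hns, div_zero])
  have h3 := hlim φ ψ ⟨_, hφb⟩ hφ
  have h4 := hlim (fun x => φ (γ • x)) ⟨fun ξ => ψ (γ • ξ), ψ.continuous.comp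
    (continuous_const_smul γ)⟩ ⟨_, fun x => hφb _⟩ fun ξ => (hφ _).comp (hF γ ξ)
  refine le_of_tendsto_of_tendsto h4
    (((Real.continuous_exp.tendsto _).comp (hs.abs.mul_const C)).mul h3) ?_
  filter_upwards [hsum] with n hn
  exact orbitMean_comp_smul_le hd hC hn hφ0 ⟨_, hφb⟩

/-- A measure is absolutely continuous with respect to another as soon as the integrals of
continuous functions are dominated. -/
theorem absolutelyContinuous_of_integral_le [TopologicalSpace.PseudoMetrizableSpace Λ]
    {μ ν : Measure Λ} [IsFiniteMeasure μ] [IsFiniteMeasure ν] {K : ℝ}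
    (h : ∀ ψ : C(Λ, ℝ), (∀ ξ, 0 ≤ ψ ξ) → ∫ ξ, ψ ξ ∂ν ≤ K * ∫ ξ, ψ ξ ∂μ) : ν ≪ μ := by
  let := TopologicalSpace.pseudoMetrizableSpacePseudoMetric Λ
  have key : ∀ f : Λ →ᵇ ℝ≥0, ∫⁻ ξ, f ξ ∂ν ≤ ENNReal.ofReal K * ∫⁻ ξ, f ξ ∂μ := fun f => by
    have hf := h ⟨fun ξ => (f ξ : ℝ), by fun_prop⟩ fun ξ => (f ξ).2
    have e : ∀ (m : Measure Λ) [IsFiniteMeasure m],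
        ∫⁻ ξ, f ξ ∂m = ENNReal.ofReal (∫ ξ, (f ξ : ℝ) ∂m) := fun m _ => by
      rw [← BoundedContinuousFunction.toReal_lintegral_coe_eq_integral,
        ENNReal.ofReal_toReal (f.lintegral_lt_top_of_nnreal m).ne]
    have h0 : 0 ≤ ∫ ξ, (f ξ : ℝ) ∂μ := integral_nonneg fun ξ => (f ξ).2
    rw [e, e, ← ENNReal.ofReal_mul' h0]
    exact ENNReal.ofReal_le_ofReal hf
  -- A closed set is approximated from outside by continuous functions, and the domination of
  -- integrals survives in the limit.
  have hclosed : ∀ A : Set Λ, IsClosed A → μ A = 0 → ν A = 0 := fun A hA h0 => by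
    have h1 := (HasOuterApproxClosed.tendsto_lintegral_apprSeq hA μ)
    have h2 := ENNReal.Tendsto.const_mul h1 (a := ENNReal.ofReal K) (.inr ENNReal.ofReal_ne_top)
    rw [h0, mul_zero] at h2
    refine le_antisymm (ge_of_tendsto' h2 fun n => ?_) zero_le
    exact (HasOuterApproxClosed.measure_le_lintegral hA _ n).trans (key _)
  refine Measure.AbsolutelyContinuous.mk fun A hA h0 => ?_
  -- Inner regularity: a Borel set is `ν`-null once all its closed subsets are.
  rw [hA.measure_eq_iSup_isClosed_of_ne_top (measure_ne_top ν A)]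
  simp only [ENNReal.iSup_eq_zero]
  exact fun B hB hc => hclosed B hc (measure_mono_null hB h0)

/-- Compactness of `Λ` makes `e` a closed embedding, so metrizability of `Y` provides both the
normality needed for the extension and a metrizable `Λ` for the regularity argument. -/
theorem map_smul_absolutelyContinuous {Y : Type*} [TopologicalSpace Y]
    [TopologicalSpace.MetrizableSpace Y] {e : Λ → Y}
    (he : Continuous e) (hinj : Function.Injective e) {j : P → Y}
    (hj : ∀ ξ, Tendsto j (F ξ) (𝓝 (e ξ)))
    (hF : ∀ (γ : Γ) ξ, Tendsto (γ • ·) (F ξ) (F (γ • ξ)))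
    (hd : ∀ (γ : Γ) x y, d (γ • x) (γ • y) = d x y)
    (hC : ∀ γ : Γ, ∃ C, ∀ z, |d x₀ z - d (γ • x₀) z| ≤ C) (hμ : IsPattersonSullivan Γ d F x₀ μ)
    (γ : Γ) : μ.map (γ • ·) ≪ μ := by
  let := TopologicalSpace.metrizableSpaceMetric Y
  have := hμ.isProbabilityMeasure
  have hemb := he.isClosedEmbedding hinj
  have := hemb.isEmbedding.metrizableSpace
  obtain ⟨C, hC⟩ := hC γ
  refine absolutelyContinuous_of_integral_le (K := Real.exp (|criticalExponent Γ d x₀| * C))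
    fun ψ hψ => ?_
  rw [integral_map (measurable_smul_borel γ).aemeasurable ψ.continuous.aestronglyMeasurable]
  exact integral_comp_smul_le hemb hj hF hd hC hμ ψ hψ

theorem busemannDynamicsImplemented_of_tendsto
    (hne : ∀ ξ, (F ξ).NeBot) (hF : ∀ (γ : Γ) ξ, Tendsto (γ • ·) (F ξ) (F (γ • ξ)))
    (hd : ∀ (γ : Γ) x y, d (γ • x) (γ • y) = d x y)
    (hb : ∀ x y, HasBusemannLimit d F x y)
    [IsFiniteMeasure μ] (hq : ∀ γ : Γ, μ.map (γ • ·) ≪ μ) :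
    BusemannDynamicsImplemented Γ d F x₀ μ := by
  choose β hβ using hb
  let b : RealCocycle Γ Λ :=
    { toFun := fun γ => β x₀ (γ • x₀)
      -- `B(x₀, γδx₀, ξ)` splits at `γx₀`; invariance of `d` turns the second part `B(γx₀, γδx₀, ξ)`
      -- into `B(x₀, δx₀, γ⁻¹ξ)`, and limits along the nontrivial filter `F ξ` are unique.
      map_mul := fun γ δ ξ => by
        have := hne ξ
        refine tendsto_nhds_unique (hβ x₀ ((γ * δ) • x₀) ξ) ?_
        refine ((hβ x₀ (γ • x₀) ξ).add ((hβ x₀ (δ • x₀) _).comp (hF γ⁻¹ ξ))).congr fun z => ?_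
        change _ + (d x₀ (γ⁻¹ • z) - d (δ • x₀) (γ⁻¹ • z)) = _
        have h : ∀ x, d x (γ⁻¹ • z) = d (γ • x) z := fun x => by rw [← hd γ x, smul_inv_smul]
        rw [h, h, smul_smul]
        ring }
  have e : (busemannCocycle d F x₀ : Γ → Λ → ℝ) = fun γ ξ => b.toFun γ ξ := by
    funext γ ξ
    have := hne ξ
    exact (hβ x₀ (γ • x₀) ξ).limUnder_eq
  refine ⟨hne, fun γ ξ => ?_, hq, ?_⟩
  · rw [e]
    exact hβ x₀ (γ • x₀) ξ
  · rw [e]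
    exact b.dynamics_implemented hq

end QuasiInvariance

/-! ### Distances in trees and graphs. -/

section TreeDistance

open SimpleGraph

variable {W : Type*} {T : SimpleGraph W}

/-- Here `z` is on the side of `y` and `z'` on the side of `x`. Then `x, y, …, z` and `x, …, z', z`
are both geodesics and must coincide; if `x ≠ z'`, the second one passes through `y` before `z'`,
which puts `z'` nearer to `y` than to `x`. -/
theorem SimpleGraph.IsTree.eq_of_dist_eq_of_adj (hT : T.IsTree) {x y z z' : W} (hxy : T.Adj x y)
    (hzz : T.Adj z z') (h : T.dist x z = T.dist y z + 1) (h' : T.dist y z' = T.dist x z' + 1) :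
    x = z' := by
  obtain ⟨p, hp⟩ := hT.connected.exists_walk_length_eq_dist y z
  obtain ⟨q, hq⟩ := hT.connected.exists_walk_length_eq_dist x z'
  have h1 : T.dist x z ≤ T.dist x z' + T.dist z' z := hT.connected.dist_triangle
  have h2 : T.dist y z' ≤ T.dist y z + T.dist z z' := hT.connected.dist_triangle
  rw [dist_eq_one_iff_adj.2 hzz.symm] at h1
  rw [dist_eq_one_iff_adj.2 hzz] at h2
  cases q with
  | nil => rfl
  | @cons _ w _ hw q =>
    rw [Walk.length_cons] at hq
    have hp1 : (Walk.cons hxy p).IsPath := Walk.isPath_of_length_eq_dist _ (by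
      rw [Walk.length_cons, hp, h])
    have hp2 : (Walk.cons hw (q.concat hzz.symm)).IsPath := Walk.isPath_of_length_eq_dist _ (by
      rw [Walk.length_cons, Walk.length_concat]; omega)
    have e := congrArg (fun p : T.Path x z => p.1.getVert 1)
      ((hT.isAcyclic.subsingleton_path x z).elim ⟨_, hp1⟩ ⟨_, hp2⟩)
    simp only [Walk.getVert_cons_succ, Walk.getVert_zero] at e
    subst e
    have := dist_le q
    omega

/-- Two edges of a tree without common end points: the distances to the end points of the first edge
change by the same amount along the second edge. -/
theorem SimpleGraph.IsTree.dist_sub_dist_eq_of_adj (hT : T.IsTree) {x y z z' : W}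
    (hxy : T.Adj x y) (hzz : T.Adj z z') (h1 : z ≠ x) (h2 : z ≠ y) (h3 : z' ≠ x) (h4 : z' ≠ y) :
    (T.dist x z : ℝ) - T.dist y z = T.dist x z' - T.dist y z' := by
  have key : ∀ {z z' : W}, T.Adj z z' → z ≠ x → z ≠ y → z' ≠ x → z' ≠ y →
      T.dist x z = T.dist y z + 1 → T.dist x z' = T.dist y z' + 1 := by
    intro z z' hzz h1 h2 h3 h4 h
    have e := hT.dist_eq_dist_add_one_of_adj z' hxy
    rw [dist_comm, T.dist_comm (u := z') (v := y)] at e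
    refine e.resolve_right fun h' => h3 (hT.eq_of_dist_eq_of_adj hxy hzz h h').symm
  have e := hT.dist_eq_dist_add_one_of_adj z hxy
  have e' := hT.dist_eq_dist_add_one_of_adj z' hxy
  rw [dist_comm, T.dist_comm (u := z) (v := y)] at e
  rw [dist_comm, T.dist_comm (u := z') (v := y)] at e'
  rcases e with e | e
  · rw [e, key hzz h1 h2 h3 h4 e]
    push_cast
    ring
  · rcases e' with e' | e'
    · have := key hzz.symm h3 h4 h1 h2 e'
      omega
    · rw [e, e']
      push_cast
      ring

theorem SimpleGraph.Iso.dist_eq {W' : Type*} {T' : SimpleGraph W'} (φ : T ≃g T')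
    (hT : T.Connected) (hT' : T'.Connected) (x y : W) : T'.dist (φ x) (φ y) = T.dist x y := by
  refine le_antisymm ?_ ?_
  · obtain ⟨p, hp⟩ := hT.exists_walk_length_eq_dist x y
    rw [← hp, ← Walk.length_map φ.toHom p]
    exact dist_le _
  · obtain ⟨p, hp⟩ := hT'.exists_walk_length_eq_dist (φ x) (φ y)
    rw [← hp, ← Walk.length_map φ.symm.toHom p]
    have := dist_le (p.map φ.symm.toHom)
    change T.dist (φ.symm (φ x)) (φ.symm (φ y)) ≤ _ at this
    rwa [φ.symm_apply_apply, φ.symm_apply_apply] at this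

theorem SimpleGraph.Connected.abs_dist_sub_dist_le (hT : T.Connected) (x y z : W) :
    |(T.dist x z : ℝ) - T.dist y z| ≤ T.dist x y := by
  have h1 : T.dist x z ≤ T.dist x y + T.dist y z := hT.dist_triangle
  have h2 : T.dist y z ≤ T.dist y x + T.dist x z := hT.dist_triangle
  rw [T.dist_comm (u := y) (v := x)] at h2
  have h1' : (T.dist x z : ℝ) ≤ T.dist x y + T.dist y z := by exact_mod_cast h1
  have h2' : (T.dist y z : ℝ) ≤ T.dist x y + T.dist x z := by exact_mod_cast h2
  rw [abs_le]
  constructor <;> linarith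

/-- Balls are countable by induction on the radius. Countability of the vertex set makes the space
of codes metrizable. -/
theorem SimpleGraph.Connected.countable_of_countable_neighborSet (hT : T.Connected)
    (h : ∀ w, (T.neighborSet w).Countable) : Countable W := by
  obtain ⟨x⟩ := hT.nonempty
  have key : ∀ n : ℕ, {y | ∃ p : T.Walk y x, p.length = n}.Countable := fun n => by
    induction n with
    | zero =>
      refine (countable_singleton x).mono ?_
      rintro y ⟨p, hp⟩
      exact Walk.eq_of_length_eq_zero hp
    | succ n ih =>
      refine (ih.biUnion fun y _ => h y).mono ?_
      rintro y ⟨p, hp⟩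
      cases p with
      | nil => simp at hp
      | @cons _ w _ hw p =>
        exact mem_biUnion (show w ∈ _ from ⟨p, by simpa using hp⟩) hw.symm
  rw [← countable_univ_iff]
  refine (countable_iUnion key).mono fun y _ => ?_
  obtain ⟨p⟩ := hT.preconnected y x
  exact mem_iUnion.2 ⟨p.length, p, rfl⟩

end TreeDistance

/-! ### Ends of trees: Busemann limits and a metrizable space of codes. -/

namespace GraphEnd

open SimpleGraph

variable {W : Type*} {T : SimpleGraph W}

theorem eventually_mem_comp (ξ : GraphEnd T) (K : Finset W) :
    ∀ᶠ v in nhdsVertices ξ, v ∈ ξ.comp K :=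
  mem_iInf_of_mem K (mem_principal_self _)

theorem nhdsVertices_neBot (ξ : GraphEnd T) : (nhdsVertices ξ).NeBot := by
  classical
  have : ∀ K : Finset W, (𝓟 (ξ.comp K : Set W)).NeBot := fun K =>
    principal_neBot_iff.2 (ξ.comp K).nonempty
  refine iInf_neBot_of_directed' (fun K L => ⟨K ∪ L, ?_, ?_⟩) this
  · exact principal_mono.2 fun v hv => ξ.comp_mono Finset.subset_union_left hv
  · exact principal_mono.2 fun v hv => ξ.comp_mono Finset.subset_union_right hv

theorem tendsto_nhdsVertices_smul (φ : T ≃g T) (ξ : GraphEnd T) :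
    Tendsto φ (nhdsVertices ξ) (nhdsVertices (φ • ξ)) := by
  refine tendsto_iInf.2 fun K => tendsto_principal.2 ?_
  filter_upwards [ξ.eventually_mem_comp (K.map φ.symm.toEquiv.toEmbedding)] with v hv
  exact mem_mapComponent φ K _ hv

/-- The difference of distances does not change along edges avoiding `x` and `y`, so it factors
through the components of the complement of `{x, y}`. The limit at an end depends only on its
component, hence is locally constant. -/
theorem hasBusemannLimit_of_adj (hT : T.IsTree) {x y : W} (hxy : T.Adj x y) :
    HasBusemannLimit (fun v w => (T.dist v w : ℝ)) (nhdsVertices (T := T)) x y := by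
  classical
  let K : Finset W := {x, y}
  let g : T.ComponentCompl (K : Set W) → ℝ :=
    ComponentCompl.lift (fun v _ => (T.dist x v : ℝ) - T.dist y v) fun v w hv hw h => by
      have hK : ∀ u, u ∉ (K : Set W) → u ≠ x ∧ u ≠ y := fun u hu => by
        simpa [K, not_or] using hu
      exact hT.dist_sub_dist_eq_of_adj hxy h (hK v hv).1 (hK v hv).2 (hK w hw).1 (hK w hw).2
  refine ⟨⟨fun ξ => g (ξ.comp K), @Continuous.comp _ _ _ _ ⊥ _ _ g continuous_bot
    (continuous_comp K)⟩, fun ξ => tendsto_const_nhds.congr' ?_⟩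
  filter_upwards [ξ.eventually_mem_comp K] with v hv
  obtain ⟨hvK, hv⟩ := hv
  change g (ξ.comp K) = _
  rw [← hv]
  rfl

theorem hasBusemannLimit (hT : T.IsTree) (x y : W) :
    HasBusemannLimit (fun v w => (T.dist v w : ℝ)) (nhdsVertices (T := T)) x y := by
  obtain ⟨p⟩ := hT.connected.preconnected x y
  induction p with
  | nil => exact .refl _
  | cons h p ih => exact (hasBusemannLimit_of_adj hT h).trans ih

/-- The components of the complements of the finite sets in which a vertex or an end lies. -/
def Code (T : SimpleGraph W) : Type _ := ∀ K : Finset W, Option (T.ComponentCompl (K : Set W))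

instance : TopologicalSpace (Code T) := @Pi.topologicalSpace _ _ fun _ => ⊥

/-- A countable product of discrete spaces. Codes record vertices and ends alike, so this is the
space in which test functions are extended from the boundary to the vertices. -/
theorem metrizableSpace_code [Countable W] : TopologicalSpace.MetrizableSpace (Code T) := by
  let : ∀ K : Finset W, TopologicalSpace (Option (T.ComponentCompl (K : Set W))) := fun _ => ⊥
  have : ∀ K : Finset W, DiscreteTopology (Option (T.ComponentCompl (K : Set W))) := fun _ => ⟨rfl⟩
  exact inferInstanceAs (TopologicalSpace.MetrizableSpace
    (∀ K : Finset W, Option (T.ComponentCompl (K : Set W))))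

/-- The code of an end. -/
def code (ξ : GraphEnd T) : Code T := fun K => some (ξ.comp K)

theorem code_injective : Function.Injective (code : GraphEnd T → Code T) := fun _ _ h =>
  GraphEnd.ext fun K => Option.some.inj (congrFun h K)

theorem continuous_code : Continuous (code : GraphEnd T → Code T) :=
  (@continuous_pi_iff _ _ _ _ (fun _ => ⊥) _).2 fun K =>
    @Continuous.comp _ _ _ _ ⊥ ⊥ _ _ continuous_bot (continuous_comp K)

open Classical in
/-- The code of a vertex. -/
def vertexCode (T : SimpleGraph W) (v : W) : Code T := fun K =>
  if h : v ∉ (K : Set W) then some (T.componentComplMk h) else none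

theorem tendsto_vertexCode (ξ : GraphEnd T) :
    Tendsto (vertexCode T) (nhdsVertices ξ) (𝓝 (code ξ)) := by
  let : ∀ K : Finset W, TopologicalSpace (Option (T.ComponentCompl (K : Set W))) := fun _ => ⊥
  refine tendsto_pi_nhds.2 fun K => tendsto_const_nhds.congr' ?_
  filter_upwards [ξ.eventually_mem_comp K] with v hv
  obtain ⟨hvK, hv⟩ := hv
  rw [code, ← hv, vertexCode, dif_pos hvK]


end GraphEnd

/-- Finiteness of `E` makes `T` locally finite, hence countable. Deck transformations are
isometries, and the triangle inequality supplies the constant for quasi-invariance. -/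
theorem busemannDynamicsImplemented_tree {V E W : Type*} [Finite E] (X : MultiGraph V E)
    {T : SimpleGraph W} (c : X.UniversalCovering T) (x₀ : W) (μ : Measure c.Boundary)
    (hμ : IsPattersonSullivan c.deckGroup c.dist c.nhdsVertices x₀ μ) :
    BusemannDynamicsImplemented c.deckGroup c.dist c.nhdsVertices x₀ μ := by
  have hconn := c.isTree.connected
  have : Countable W := hconn.countable_of_countable_neighborSet fun w => by
    have := c.finite_neighborSet w
    exact (toFinite (T.neighborSet w)).countable
  have := GraphEnd.metrizableSpace_code (T := T)
  have := hμ.isProbabilityMeasure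
  have hF : ∀ (γ : c.deckGroup) (ξ : c.Boundary),
      Tendsto (γ • ·) (c.nhdsVertices ξ) (c.nhdsVertices (γ • ξ)) := fun γ ξ =>
    GraphEnd.tendsto_nhdsVertices_smul (γ : T ≃g T) ξ
  have hd : ∀ (γ : c.deckGroup) x y, c.dist (γ • x) (γ • y) = c.dist x y := fun γ x y =>
    congrArg Nat.cast ((γ : T ≃g T).dist_eq hconn hconn x y)
  refine busemannDynamicsImplemented_of_tendsto (fun ξ => GraphEnd.nhdsVertices_neBot ξ) hF hd
    (GraphEnd.hasBusemannLimit c.isTree) ?_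
  have hcode : Continuous fun ξ : c.Boundary => GraphEnd.code (T := T) ξ :=
    GraphEnd.continuous_code
  exact map_smul_absolutelyContinuous hcode GraphEnd.code_injective
    GraphEnd.tendsto_vertexCode hF hd (fun γ => ⟨_, hconn.abs_dist_sub_dist_le x₀ (γ • x₀)⟩) hμ

/-! ### Projective limits of Möbius transformations. -/

section ProjectiveLimits

open Matrix OnePoint
open scoped MatrixGroups ComplexOrder

/-- In the closed ball of matrices of trace one the determinant separates the sphere, where it
vanishes, from hyperbolic space, where it does not. -/
theorem det_lineProj (v : Fin 2 → ℂ) : (lineProj v).det = 0 := by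
  rw [lineProj, Matrix.det_smul, Matrix.det_vecMulVec]
  simp

theorem det_sphereToBall (ξ : OnePoint ℂ) : (sphereToBall ξ).det = 0 := by
  obtain ⟨v, -, h⟩ := rep_ne_zero ξ
  rw [h, det_lineProj]

theorem HypSpace.det_toBall_ne_zero (p : HypSpace) : p.toBall.det ≠ 0 := by
  have : p.1.trace ≠ 0 := p.2.1.trace_pos.ne'
  rw [HypSpace.toBall, Matrix.det_smul, p.2.2, mul_one]
  exact pow_ne_zero _ (inv_ne_zero this)

theorem ballAct_smul {c : ℂ} (hc : c ≠ 0) (A M : Matrix (Fin 2) (Fin 2) ℂ) :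
    ballAct (c • A) M = ballAct A M := by
  have hs : star c ≠ 0 := star_ne_zero.2 hc
  simp only [ballAct, Matrix.conjTranspose_smul, Matrix.smul_mul, Matrix.mul_smul, smul_smul,
    Matrix.trace_smul, smul_eq_mul]
  congr 1
  field_simp

/-- The diagonal entries are values of the form `Q` on the rows of `M`, and some row is nonzero.
Thus the projective action on interior points stays defined for singular `M ≠ 0`. -/
theorem trace_mul_posDef_mul_ne_zero {M Q : Matrix (Fin 2) (Fin 2) ℂ} (hM : M ≠ 0)
    (hQ : Q.PosDef) : (M * Q * Mᴴ).trace ≠ 0 := by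
  have h : ∀ i, (M * Q * Mᴴ) i i = star (star (M i)) ⬝ᵥ (Q *ᵥ star (M i)) := fun i => by
    rw [star_star, Matrix.dotProduct_mulVec]
    rfl
  have hnn : ∀ i, 0 ≤ (M * Q * Mᴴ) i i := fun i => by
    rw [h]; exact hQ.posSemidef.dotProduct_mulVec_nonneg _
  obtain ⟨i, hi⟩ : ∃ i, M i ≠ 0 := by
    by_contra! h0
    exact hM (funext h0)
  have hpos : 0 < (M * Q * Mᴴ) i i := by
    rw [h]; exact hQ.dotProduct_mulVec_pos (star_ne_zero.2 hi)
  exact (Finset.sum_pos' (fun i _ => hnn i) ⟨i, Finset.mem_univ i, hpos⟩).ne'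

theorem exists_eq_vecMulVec {M : Matrix (Fin 2) (Fin 2) ℂ} (hM : M ≠ 0) (hd : M.det = 0) :
    ∃ u w : Fin 2 → ℂ, u ≠ 0 ∧ w ≠ 0 ∧ M = Matrix.vecMulVec u w := by
  obtain ⟨i, j, hij⟩ : ∃ i j, M i j ≠ 0 := by
    by_contra! h
    exact hM (Matrix.ext h)
  rw [Matrix.det_fin_two] at hd
  -- All `2 × 2` minors vanish: each is trivial or `±det M`.
  have key : ∀ i j k l, M k l * M i j = M k j * M i l := by
    simp only [Fin.forall_fin_two, Fin.isValue]
    refine ⟨⟨⟨⟨?_, ?_⟩, ?_, ?_⟩, ⟨?_, ?_⟩, ?_, ?_⟩, ⟨⟨?_, ?_⟩, ?_, ?_⟩, ⟨?_, ?_⟩, ?_, ?_⟩ <;> grind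
  refine ⟨fun k => M k j, fun l => M i l / M i j, fun h => hij (congrFun h i),
    fun h => one_ne_zero (α := ℂ) ?_, ?_⟩
  · rw [← div_self hij]
    exact congrFun h j
  · ext k l
    rw [Matrix.vecMulVec_apply, ← mul_div_assoc, eq_div_iff hij]
    exact key i j k l

/-- The exceptional point is the kernel of the linear form `w`, a single line in `ℂ²`. -/
theorem exists_forall_ne_dotProduct_ne_zero {w : Fin 2 → ℂ} (hw : w ≠ 0) :
    ∃ η₀ : OnePoint ℂ, ∀ η ≠ η₀, ∃ v, v ≠ 0 ∧ sphereToBall η = lineProj v ∧ w ⬝ᵥ v ≠ 0 := by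
  by_cases h0 : w 0 = 0
  · have h1 : w 1 ≠ 0 := fun h1 => hw (by ext i; fin_cases i <;> assumption)
    refine ⟨∞, fun η hη => ?_⟩
    induction η using OnePoint.rec with
    | infty => exact absurd rfl hη
    | coe z =>
      exact ⟨_, by simp, sphereToBall_coe z, by simp [dotProduct, Fin.sum_univ_two, h0, h1]⟩
  · refine ⟨((-(w 1) / w 0 : ℂ) : OnePoint ℂ), fun η hη => ?_⟩
    induction η using OnePoint.rec with
    | infty => exact ⟨_, by simp, sphereToBall_infty, by simp [dotProduct, Fin.sum_univ_two, h0]⟩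
    | coe z =>
      refine ⟨_, by simp, sphereToBall_coe z, fun h => hη ?_⟩
      simp only [dotProduct, Fin.sum_univ_two, Matrix.cons_val_zero, Matrix.cons_val_one,
        mul_one] at h
      congr 1
      rw [eq_div_iff h0]
      linear_combination h

theorem continuousAt_ballAct_left {M Q : Matrix (Fin 2) (Fin 2) ℂ}
    (h : (M * Q * Mᴴ).trace ≠ 0) : ContinuousAt (fun N => ballAct N Q) M := by
  have hc : Continuous fun N : Matrix (Fin 2) (Fin 2) ℂ => N * Q * Nᴴ :=
    (continuous_id.matrix_mul continuous_const).matrix_mul continuous_id.matrix_conjTranspose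
  exact (hc.matrix_trace.continuousAt.inv₀ h).smul hc.continuousAt

/-- A rank-one matrix collapses the ball: `M Q M*` is a multiple of `u u*`, whatever `Q` is. -/
theorem ballAct_vecMulVec (u w : Fin 2 → ℂ) (Q : Matrix (Fin 2) (Fin 2) ℂ)
    (h : (Matrix.vecMulVec u w * Q * (Matrix.vecMulVec u w)ᴴ).trace ≠ 0) :
    ballAct (Matrix.vecMulVec u w) Q = lineProj u := by
  have e : Matrix.vecMulVec u w * Q * (Matrix.vecMulVec u w)ᴴ =
      ((w ᵥ* Q) ⬝ᵥ star w) • Matrix.vecMulVec u (star u) := by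
    rw [Matrix.conjTranspose_vecMulVec, Matrix.vecMulVec_mul, Matrix.vecMulVec_mul_vecMulVec]
    ext i j
    simp [Matrix.vecMulVec_apply]
    ring
  rw [e, Matrix.trace_smul, smul_eq_mul] at h
  rw [ballAct, e, lineProj, Matrix.trace_smul, smul_smul, Matrix.trace_vecMulVec, smul_eq_mul]
  congr 1
  have := left_ne_zero_of_mul h
  field_simp

theorem tendsto_lineProj_mulVec {α : Type*} {F : Filter α} {N : α → Matrix (Fin 2) (Fin 2) ℂ}
    {M : Matrix (Fin 2) (Fin 2) ℂ} (hN : Tendsto N F (𝓝 M)) {v : Fin 2 → ℂ} (hv : M *ᵥ v ≠ 0) :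
    Tendsto (fun a => lineProj (N a *ᵥ v)) F (𝓝 (lineProj (M *ᵥ v))) := by
  have h1 : Tendsto (fun a => N a *ᵥ v) F (𝓝 (M *ᵥ v)) :=
    ((continuous_id.matrix_mulVec continuous_const).tendsto M).comp hN
  have h2 : ContinuousAt lineProj (M *ᵥ v) := by
    have h0 : M *ᵥ v ⬝ᵥ star (M *ᵥ v) ≠ 0 := fun h => hv (dotProduct_self_star_eq_zero.1 h)
    have hd : Continuous fun x : Fin 2 → ℂ => x ⬝ᵥ star x :=
      continuous_id.dotProduct continuous_star
    have hm : Continuous fun x : Fin 2 → ℂ => Matrix.vecMulVec x (star x) :=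
      continuous_id.matrix_vecMulVec continuous_star
    exact (hd.continuousAt.inv₀ h0).smul hm.continuousAt
  exact h2.tendsto.comp h1

/-- Along an ultrafilter, matrices of determinant one converge projectively. -/
theorem exists_tendsto_smul {α : Type*} (G : Ultrafilter α) (Z : α → SL(2, ℂ)) :
    ∃ (r : α → ℂ) (M : Matrix (Fin 2) (Fin 2) ℂ), (∀ a, r a ≠ 0) ∧ M ≠ 0 ∧
      Tendsto (fun a => r a • (Z a : Matrix (Fin 2) (Fin 2) ℂ)) G (𝓝 M) := by
  -- Dividing by the sum of the moduli of the entries keeps the entries in the unit disc, where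
  -- compactness gives limits; the sum stays `1`, which forces the limit to be nonzero.
  let n : α → ℝ := fun a => ∑ i, ∑ j, ‖Z a i j‖
  have hle : ∀ a i j, ‖Z a i j‖ ≤ n a := fun a i j =>
    (Finset.single_le_sum (f := fun j => ‖Z a i j‖) (fun j _ => norm_nonneg _)
      (Finset.mem_univ j)).trans (Finset.single_le_sum (f := fun i => ∑ j, ‖Z a i j‖)
        (fun i _ => Finset.sum_nonneg fun j _ => norm_nonneg _) (Finset.mem_univ i))
  have hn : ∀ a, 0 < n a := fun a => by
    refine lt_of_le_of_ne ((norm_nonneg _).trans (hle a 0 0)) fun h => ?_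
    have h0 : ∀ i j, Z a i j = 0 := fun i j =>
      norm_le_zero_iff.1 ((hle a i j).trans h.symm.le)
    have := (Z a).2
    rw [Matrix.det_fin_two] at this
    simp [h0] at this
  have hlim : ∀ i j, ∃ m : ℂ, Tendsto (fun a => ((n a : ℂ))⁻¹ * Z a i j) G (𝓝 m) := fun i j => by
    obtain ⟨m, -, hm⟩ := (isCompact_closedBall (0 : ℂ) 1).ultrafilter_le_nhds
      (G.map fun a => ((n a : ℂ))⁻¹ * Z a i j) (by
        rw [le_principal_iff]
        refine Eventually.of_forall (f := (G : Filter α)) fun a => ?_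
        rw [mem_closedBall_zero_iff, norm_mul, norm_inv, Complex.norm_real,
          Real.norm_of_nonneg (hn a).le, inv_mul_le_iff₀ (hn a), mul_one]
        exact hle a i j)
    exact ⟨m, hm⟩
  choose M hM using hlim
  refine ⟨fun a => ((n a : ℂ))⁻¹, M, fun a => inv_ne_zero (Complex.ofReal_ne_zero.2 (hn a).ne'),
    fun h0 => ?_, tendsto_pi_nhds.2 fun i => tendsto_pi_nhds.2 fun j => hM i j⟩
  have h1 : Tendsto (fun a => ∑ i, ∑ j, ‖((n a : ℂ))⁻¹ * Z a i j‖) G (𝓝 (∑ i, ∑ j, ‖M i j‖)) :=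
    tendsto_finsetSum _ fun i _ => tendsto_finsetSum _ fun j _ => (hM i j).norm
  have h2 : ∀ a, ∑ i, ∑ j, ‖((n a : ℂ))⁻¹ * Z a i j‖ = 1 := fun a => by
    simp only [norm_mul, norm_inv, Complex.norm_real, Real.norm_of_nonneg (hn a).le,
      ← Finset.mul_sum]
    exact inv_mul_cancel₀ (hn a).ne'
  simp only [h2] at h1
  have h3 := tendsto_nhds_unique h1 tendsto_const_nhds
  have h4 : ∀ i j, M i j = 0 := fun i j => congrFun (congrFun h0 i) j
  simp [h4] at h3

/-- If the images of a point of hyperbolic space converge to `ξ` on the sphere, then so do those of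
all points of hyperbolic space and of all points of the sphere with one exception. -/
theorem tendsto_smul_of_tendsto_toBall {α : Type*} {G : Ultrafilter α} {Z : α → SL(2, ℂ)}
    {p : HypSpace} {ξ : OnePoint ℂ}
    (h : Tendsto (fun a => (Z a • p).toBall) G (𝓝 (sphereToBall ξ))) :
    (∀ q : HypSpace, Tendsto (fun a => (Z a • q).toBall) G (𝓝 (sphereToBall ξ))) ∧
      ∃ η₀ : OnePoint ℂ, ∀ η ≠ η₀, Tendsto (fun a => Z a • η) G (𝓝 ξ) := by
  obtain ⟨r, M, hr, hM, hlim⟩ := exists_tendsto_smul G Z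
  have htr : ∀ q : HypSpace, (M * q.toBall * Mᴴ).trace ≠ 0 := fun q => by
    rw [HypSpace.toBall, Matrix.mul_smul, Matrix.smul_mul, Matrix.trace_smul, smul_eq_mul]
    exact mul_ne_zero (inv_ne_zero q.2.1.trace_pos.ne') (trace_mul_posDef_mul_ne_zero hM q.2.1)
  have hball : ∀ q : HypSpace, Tendsto (fun a => (Z a • q).toBall) G (𝓝 (ballAct M q.toBall)) :=
    fun q => ((continuousAt_ballAct_left (htr q)).tendsto.comp hlim).congr fun a => by
      rw [Function.comp_apply, ballAct_smul (hr a), ballAct_toBall]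
  have hξ : ballAct M p.toBall = sphereToBall ξ := tendsto_nhds_unique (hball p) h
  -- An invertible limit would send the interior point `p` to an interior point, but the limit lies
  -- on the sphere.
  have hdet : M.det = 0 := by
    have h1 := congrArg Matrix.det hξ
    rw [det_sphereToBall, ballAct, Matrix.det_smul, Matrix.det_mul, Matrix.det_mul,
      Matrix.det_conjTranspose] at h1
    have h2 : ((M * p.toBall * Mᴴ).trace⁻¹ ^ Fintype.card (Fin 2)) ≠ 0 :=
      pow_ne_zero _ (inv_ne_zero (htr p))
    have h3 := p.det_toBall_ne_zero
    by_contra h4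
    exact mul_ne_zero h2 (mul_ne_zero (mul_ne_zero h4 h3) (star_ne_zero.2 h4)) h1
  obtain ⟨u, w, hu, hw, rfl⟩ := exists_eq_vecMulVec hM hdet
  have hq : ∀ q : HypSpace, ballAct (Matrix.vecMulVec u w) q.toBall = lineProj u := fun q =>
    ballAct_vecMulVec u w _ (htr q)
  have hlu : lineProj u = sphereToBall ξ := (hq p).symm.trans hξ
  refine ⟨fun q => ?_, ?_⟩
  · have := hball q
    rwa [hq, hlu] at this
  · obtain ⟨η₀, hη₀⟩ := exists_forall_ne_dotProduct_ne_zero hw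
    refine ⟨η₀, fun η hη => ?_⟩
    obtain ⟨v, hv, hηv, hwv⟩ := hη₀ η hη
    have hMv : Matrix.vecMulVec u w *ᵥ v = (w ⬝ᵥ v) • u := by
      rw [Matrix.vecMulVec_mulVec]
      ext i
      simp [mul_comm]
    have h1 := tendsto_lineProj_mulVec hlim (v := v) (by rw [hMv]; exact smul_ne_zero hwv hu)
    rw [hMv, lineProj_smul hwv, hlu] at h1
    rw [(continuous_sphereToBall.isClosedEmbedding
      sphereToBall_injective).isInducing.tendsto_nhds_iff]
    refine h1.congr fun a => ?_
    rw [Function.comp_apply, sphereToBall_smul, hηv, ballAct_lineProj _ hv, Matrix.smul_mulVec,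
      lineProj_smul (hr a)]

end ProjectiveLimits

/-! ### Bounded variation of the hyperbolic distance under change of base point. -/

section HyperbolicDistance

open Matrix
open scoped MatrixGroups ComplexOrder

namespace HypSpace

theorem inv_coe (P : HypSpace) : P.1⁻¹ = P.1.trace • (1 : Matrix (Fin 2) (Fin 2) ℂ) - P.1 := by
  rw [Matrix.inv_def, P.2.2, Ring.inverse_one, one_smul, Matrix.adjugate_fin_two]
  ext i j
  fin_cases i <;> fin_cases j <;> simp [Matrix.trace_fin_two]

theorem mul_inv_coe (P : HypSpace) : P.1 * P.1⁻¹ = 1 :=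
  Matrix.mul_nonsing_inv _ (by rw [P.2.2]; exact isUnit_one)

theorem trace_mul_nonneg {A B : Matrix (Fin 2) (Fin 2) ℂ} (hA : A.PosSemidef)
    (hB : B.PosSemidef) : 0 ≤ (A * B).trace := by
  obtain ⟨C, rfl⟩ : ∃ C : Matrix (Fin 2) (Fin 2) ℂ, B = Cᴴ * C := by
    open scoped MatrixOrder in exact CStarAlgebra.nonneg_iff_eq_star_mul_self.1 hB.nonneg
  rw [← Matrix.mul_assoc, Matrix.trace_mul_comm, ← Matrix.mul_assoc]
  exact (hA.mul_mul_conjTranspose_same C).trace_nonneg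

/-- By Cayley–Hamilton `P⁻¹ = tr P - P`, and `tr(PQ) ≥ 0`. With the next bound, `cosh d(P, Q)` is
comparable to `tr Q` up to factors depending on `P` only. -/
theorem trace_inv_mul_le (P Q : HypSpace) :
    (P.1⁻¹ * Q.1).trace.re ≤ P.1.trace.re * Q.1.trace.re := by
  have h := (Complex.le_def.1 (trace_mul_nonneg P.2.1.posSemidef Q.2.1.posSemidef)).1
  have hP := (Complex.lt_def.1 P.2.1.trace_pos).2
  rw [inv_coe, Matrix.sub_mul, Matrix.smul_mul, Matrix.one_mul, Matrix.trace_sub,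
    Matrix.trace_smul, smul_eq_mul, Complex.sub_re, Complex.mul_re, ← hP]
  simp only [Complex.zero_re, Complex.zero_im] at h ⊢
  linarith

/-- The trace of `P⁻¹ Q P⁻¹` is nonnegative, and `P⁻² = tr P · P⁻¹ - 1`. -/
theorem trace_le_mul_trace_inv_mul (P Q : HypSpace) :
    Q.1.trace.re ≤ P.1.trace.re * (P.1⁻¹ * Q.1).trace.re := by
  have hP := (Complex.lt_def.1 P.2.1.trace_pos).2
  have hh : (P.1⁻¹)ᴴ = P.1⁻¹ := P.2.1.isHermitian.inv
  have h := (Complex.le_def.1 (Q.2.1.posSemidef.mul_mul_conjTranspose_same P.1⁻¹).trace_nonneg).1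
  have e : P.1⁻¹ * P.1⁻¹ = P.1.trace • P.1⁻¹ - 1 := by
    nth_rewrite 1 [inv_coe]
    rw [Matrix.sub_mul, Matrix.smul_mul, Matrix.one_mul, mul_inv_coe]
  rw [hh, Matrix.trace_mul_comm, ← Matrix.mul_assoc, e, Matrix.sub_mul, Matrix.smul_mul,
    Matrix.one_mul, Matrix.trace_sub, Matrix.trace_smul, smul_eq_mul, Complex.sub_re,
    Complex.mul_re, ← hP] at h
  simp only [Complex.zero_re, Complex.zero_im] at h
  linarith

/-- `arcosh u` is `log(u + √(u² - 1))`, with the root equal to `0` for a negative argument, so `u ≥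
1` need not be known. -/
theorem log_le_arcosh {u : ℝ} (hu : 0 < u) : Real.log u ≤ Real.arcosh u :=
  Real.log_le_log hu (le_add_of_nonneg_right (Real.sqrt_nonneg _))

theorem arcosh_le_log {u : ℝ} (hu : 0 < u) : Real.arcosh u ≤ Real.log (2 * u) := by
  refine Real.log_le_log (add_pos_of_pos_of_nonneg hu (Real.sqrt_nonneg _)) ?_
  have : √(u ^ 2 - 1) ≤ u := Real.sqrt_le_iff.2 ⟨hu.le, by linarith⟩
  linarith

theorem dist_le_dist_add (P P' Q : HypSpace) :
    dist P' Q ≤ dist P Q + Real.log (2 * (P'.1.trace.re * P.1.trace.re)) := by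
  have hpos : ∀ R : HypSpace, 0 < R.1.trace.re := fun R => (Complex.lt_def.1 R.2.1.trace_pos).1
  have hu : ∀ R : HypSpace, 0 < (R.1⁻¹ * Q.1).trace.re / 2 := fun R => by
    have := (hpos Q).trans_le (trace_le_mul_trace_inv_mul R Q)
    exact half_pos (pos_of_mul_pos_right this (hpos R).le)
  have hle : (P'.1⁻¹ * Q.1).trace.re / 2 ≤
      (P'.1.trace.re * P.1.trace.re) * ((P.1⁻¹ * Q.1).trace.re / 2) := by
    have h1 := trace_inv_mul_le P' Q
    have h2 := mul_le_mul_of_nonneg_left (trace_le_mul_trace_inv_mul P Q) (hpos P').le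
    linarith
  have hc : 0 < P'.1.trace.re * P.1.trace.re := mul_pos (hpos P') (hpos P)
  calc dist P' Q ≤ Real.log (2 * ((P'.1⁻¹ * Q.1).trace.re / 2)) := arcosh_le_log (hu P')
    _ ≤ Real.log (((P.1⁻¹ * Q.1).trace.re / 2) * (2 * (P'.1.trace.re * P.1.trace.re))) :=
        Real.log_le_log (mul_pos two_pos (hu P')) (by linarith)
    _ = Real.log ((P.1⁻¹ * Q.1).trace.re / 2) + Real.log (2 * (P'.1.trace.re * P.1.trace.re)) :=
        Real.log_mul (hu P).ne' (mul_pos two_pos hc).ne'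
    _ ≤ _ := add_le_add (log_le_arcosh (hu P)) le_rfl

theorem exists_abs_dist_sub_dist_le (P P' : HypSpace) :
    ∃ C, ∀ Q, |dist P Q - dist P' Q| ≤ C := by
  refine ⟨Real.log (2 * (P'.1.trace.re * P.1.trace.re)), fun Q => ?_⟩
  have h1 := dist_le_dist_add P P' Q
  have h2 := dist_le_dist_add P' P Q
  rw [mul_comm P.1.trace.re] at h2
  rw [abs_le]
  constructor <;> linarith

theorem trace_inv_conj_mul_conj {A : Matrix (Fin 2) (Fin 2) ℂ} (hA : IsUnit A.det)
    (P Q : Matrix (Fin 2) (Fin 2) ℂ) :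
    ((A * P * Aᴴ)⁻¹ * (A * Q * Aᴴ)).trace = (P⁻¹ * Q).trace := by
  have hA' : IsUnit Aᴴ.det := by rw [Matrix.det_conjTranspose]; exact hA.star
  rw [Matrix.mul_inv_rev, Matrix.mul_inv_rev, Matrix.mul_assoc, Matrix.trace_mul_comm]
  simp only [Matrix.mul_assoc]
  rw [Matrix.mul_nonsing_inv _ hA', Matrix.mul_one, Matrix.nonsing_inv_mul_cancel_left _ _ hA]

theorem dist_smul_smul (A : SL(2, ℂ)) (P Q : HypSpace) : dist (A • P) (A • Q) = dist P Q := by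
  rw [dist, dist]
  congr 3
  exact trace_inv_conj_mul_conj (by simp) P.1 Q.1

end HypSpace

end HyperbolicDistance

/-! ### Word length in free groups. -/

section FreeGroupWords

/-- Left multiplication by the inverse of a letter cancels the first letter of a reduced word if it
is that letter, and otherwise lengthens the word by one. -/
theorem FreeGroup.norm_inv_mul {α : Type*} [DecidableEq α] (l : α × Bool) (w : FreeGroup α) :
    (FreeGroup.norm ((FreeGroup.mk [l])⁻¹ * w) : ℝ) =
      FreeGroup.norm w - if w.toWord.head? = some l then 1 else -1 := by
  have e : (FreeGroup.mk [l])⁻¹ * w = FreeGroup.mk ((l.1, !l.2) :: w.toWord) := by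
    conv_lhs => rw [← FreeGroup.mk_toWord (x := w)]
    rw [FreeGroup.inv_mk, FreeGroup.mul_mk]
    rfl
  rw [e, FreeGroup.norm, FreeGroup.norm, FreeGroup.toWord_mk, FreeGroup.reduce.cons,
    FreeGroup.reduce_toWord]
  obtain ⟨i, b⟩ := l
  cases w.toWord with
  | nil => simp
  | cons h t =>
    obtain ⟨j, b'⟩ := h
    by_cases hi : i = j
    · subst hi
      cases b <;> cases b' <;> simp
    · have hi' : ¬ j = i := fun h => hi h.symm
      simp [hi, hi']

end FreeGroupWords

/-! ### Ping-pong: freeness of Schottky groups and the Cayley distance. -/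

section PingPong

open scoped MatrixGroups

namespace SchottkyGenerators

variable {g : ℕ} (S : SchottkyGenerators g)

/-- The generators as elements of the Schottky group. -/
def generator (i : Fin g) : S.group := ⟨S.gen i, Subgroup.subset_closure (mem_range_self i)⟩

/-- The generators and their inverses. -/
def letter (l : Fin g × Bool) : S.group := cond l.2 (S.generator l.1) (S.generator l.1)⁻¹

/-- The closed disc into which a letter maps the complement of the closed disc of its inverse. -/
def closedDisc (l : Fin g × Bool) : Set (OnePoint ℂ) :=
  closure (S.disc (cond l.2 (.inr l.1) (.inl l.1)))

theorem isClosed_closedDisc (l : Fin g × Bool) : IsClosed (S.closedDisc l) := isClosed_closure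

theorem disjoint_closedDisc {l k : Fin g × Bool} (h : l ≠ k) :
    Disjoint (S.closedDisc l) (S.closedDisc k) := by
  refine S.disjoint _ _ fun e => h ?_
  obtain ⟨i, b⟩ := l
  obtain ⟨j, c⟩ := k
  cases b <;> cases c <;> simp_all

theorem flip_ne (l : Fin g × Bool) : (l.1, !l.2) ≠ l := by
  obtain ⟨i, b⟩ := l
  cases b <;> simp

theorem letter_smul_mem {l : Fin g × Bool} {η : OnePoint ℂ} (h : η ∉ S.closedDisc (l.1, !l.2)) :
    (S.letter l : PSL(2, ℂ)) • η ∈ S.closedDisc l := by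
  obtain ⟨i, b⟩ := l
  cases b with
  | true =>
    refine subset_closure ?_
    change S.gen i • η ∈ S.disc (.inr i)
    rw [← S.image_exterior i]
    exact mem_image_of_mem _ h
  | false =>
    -- For an inverse generator: were `gen⁻¹ η` outside the closed source disc, applying the
    -- generator would put `η` in the target disc.
    by_contra h'
    refine h (subset_closure ?_)
    change η ∈ S.disc (.inr i)
    rw [← S.image_exterior i]
    exact ⟨(S.gen i)⁻¹ • η, h', smul_inv_smul _ _⟩

theorem prod_smul_mem {η : OnePoint ℂ} {k : Fin g × Bool} (hη : η ∉ S.closedDisc (k.1, !k.2)) :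
    ∀ (L : List (Fin g × Bool)) (l : Fin g × Bool), FreeGroup.IsReduced L → L.head? = some l →
      L.getLast? = some k →
        (((L.map S.letter).prod : S.group) : PSL(2, ℂ)) • η ∈ S.closedDisc l
  | [], l, _, hl, _ => by simp at hl
  | [a], l, _, hl, hk => by
    simp only [List.head?_cons, Option.some.injEq, List.getLast?_singleton] at hl hk
    subst hl hk
    simpa using S.letter_smul_mem hη
  | a :: b :: L, l, hr, hl, hk => by
    simp only [List.head?_cons, Option.some.injEq] at hl
    subst hl
    rw [FreeGroup.isReduced_cons_cons] at hr
    rw [List.getLast?_cons_cons] at hk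
    have ih := prod_smul_mem hη (b :: L) b hr.2 rfl hk
    rw [List.map_cons, List.prod_cons, Subgroup.coe_mul, mul_smul]
    -- The tail of the word lands in the disc of `b`, which in a reduced word differs from the disc
    -- of the inverse of `a`.
    refine S.letter_smul_mem fun h => (S.disjoint_closedDisc ?_).le_bot ⟨ih, h⟩
    intro hab
    have h1 := hr.1 (by rw [hab])
    rw [hab] at h1
    simp at h1

/-- The homomorphism from the free group. -/
def freeHom : FreeGroup (Fin g) →* S.group := FreeGroup.lift S.generator

theorem freeHom_mk (L : List (Fin g × Bool)) :
    S.freeHom (FreeGroup.mk L) = (L.map S.letter).prod := FreeGroup.lift_mk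

theorem freeHom_smul_mem {w : FreeGroup (Fin g)} {l k : Fin g × Bool}
    (hl : w.toWord.head? = some l) (hk : w.toWord.getLast? = some k) {η : OnePoint ℂ}
    (hη : η ∉ S.closedDisc (k.1, !k.2)) : (S.freeHom w : PSL(2, ℂ)) • η ∈ S.closedDisc l := by
  rw [← FreeGroup.mk_toWord (x := w), freeHom_mk]
  exact S.prod_smul_mem hη _ _ FreeGroup.isReduced_toWord hl hk

theorem closedDisc_nonempty (l : Fin g × Bool) : (S.closedDisc l).Nonempty :=
  (S.isJordanDomain _).2.1.nonempty.mono subset_closure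

theorem closedDisc_ne_univ (l : Fin g × Bool) : S.closedDisc l ≠ univ := fun h => by
  obtain ⟨η, hη⟩ := S.closedDisc_nonempty (l.1, !l.2)
  exact (S.disjoint_closedDisc (flip_ne l)).le_bot ⟨hη, h ▸ mem_univ η⟩

/-- If a nonempty reduced word acted trivially, its image disc and the disc of the inverse of its
last letter would cover the sphere. If they coincide, a disc is everything, which the other disjoint
discs forbid; if not, they are disjoint closed sets disconnecting the sphere. -/
theorem freeHom_injective : Function.Injective S.freeHom := by
  refine (injective_iff_map_eq_one _).2 fun w hw => ?_
  by_contra hne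
  have hL : w.toWord ≠ [] := fun h => hne (FreeGroup.toWord_eq_nil_iff.1 h)
  obtain ⟨l, hl⟩ := Option.isSome_iff_exists.1 (List.isSome_head?.2 hL)
  obtain ⟨k, hk⟩ := Option.isSome_iff_exists.1 (List.getLast?_isSome.2 hL)
  have hcover : ∀ η, η ∉ S.closedDisc (k.1, !k.2) → η ∈ S.closedDisc l := fun η hη => by
    have := S.freeHom_smul_mem hl hk hη
    rwa [hw, Subgroup.coe_one, one_smul] at this
  by_cases hkl : (k.1, !k.2) = l
  · refine S.closedDisc_ne_univ l (eq_univ_of_forall fun η => ?_)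
    by_contra h
    exact h (hcover η (hkl ▸ h))
  · have hc : (S.closedDisc l)ᶜ = S.closedDisc (k.1, !k.2) := by
      ext η
      exact ⟨fun h => by_contra fun h' => h (hcover η h'),
        fun h h' => (S.disjoint_closedDisc hkl).le_bot ⟨h, h'⟩⟩
    have hclopen : IsClopen (S.closedDisc l) :=
      ⟨S.isClosed_closedDisc l, by
        rw [← isClosed_compl_iff, hc]; exact S.isClosed_closedDisc _⟩
    rcases isClopen_iff.1 hclopen with h | h
    · exact (S.closedDisc_nonempty l).ne_empty h
    · exact S.closedDisc_ne_univ l h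

theorem freeHom_surjective : Function.Surjective S.freeHom := by
  have h : S.group ≤ S.freeHom.range.map S.group.subtype := by
    refine (Subgroup.closure_le _).2 ?_
    rintro _ ⟨i, rfl⟩
    exact ⟨S.generator i, ⟨FreeGroup.of i, FreeGroup.lift_apply_of⟩, rfl⟩
  rintro ⟨x, hx⟩
  obtain ⟨_, ⟨w, rfl⟩, hw⟩ := h hx
  exact ⟨w, Subtype.ext hw⟩

/-- A Schottky group is free on its generators. -/
def freeEquiv : FreeGroup (Fin g) ≃* S.group :=
  MulEquiv.ofBijective S.freeHom ⟨S.freeHom_injective, S.freeHom_surjective⟩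

theorem freeEquiv_letter (l : Fin g × Bool) : S.freeEquiv (FreeGroup.mk [l]) = S.letter l := by
  refine (S.freeHom_mk [l]).trans ?_
  simp

/-- The reduced word that represents an element of a Schottky group. -/
def word (z : S.group) : List (Fin g × Bool) := (S.freeEquiv.symm z).toWord

theorem word_eq_nil {z : S.group} (h : S.word z = []) : z = 1 := by
  rw [← S.freeEquiv.symm.map_eq_one_iff]
  exact FreeGroup.toWord_eq_nil_iff.1 h

theorem prod_word (z : S.group) : ((S.word z).map S.letter).prod = z := by
  rw [← freeHom_mk, word, FreeGroup.mk_toWord]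
  exact S.freeEquiv.apply_symm_apply z

theorem smul_mem_closedDisc {z : S.group} {l k : Fin g × Bool}
    (hl : (S.word z).head? = some l) (hk : (S.word z).getLast? = some k) {η : OnePoint ℂ}
    (hη : η ∉ S.closedDisc (k.1, !k.2)) : (z : PSL(2, ℂ)) • η ∈ S.closedDisc l := by
  have := S.freeHom_smul_mem hl hk hη
  rwa [show S.freeHom (S.freeEquiv.symm z) = z from S.freeEquiv.apply_symm_apply z] at this

theorem length_word_letter_inv_mul (l : Fin g × Bool) (z : S.group) :
    ((S.word ((S.letter l)⁻¹ * z)).length : ℝ) =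
      (S.word z).length - if (S.word z).head? = some l then 1 else -1 := by
  have := FreeGroup.norm_inv_mul l (S.freeEquiv.symm z)
  rwa [← S.freeEquiv.symm_apply_apply (FreeGroup.mk [l]), freeEquiv_letter, ← map_inv,
    ← map_mul] at this

theorem length_word_mul_le (x y : S.group) :
    (S.word (x * y)).length ≤ (S.word x).length + (S.word y).length := by
  rw [word, map_mul]
  exact FreeGroup.norm_mul_le _ _

theorem letter_ne_one (l : Fin g × Bool) : S.letter l ≠ 1 := fun h => by
  rw [← freeEquiv_letter, EmbeddingLike.map_eq_one_iff, ← FreeGroup.toWord_eq_nil_iff,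
    FreeGroup.toWord_mk, FreeGroup.reduce_singleton] at h
  simp at h

theorem cayleyGraph_adj_mul_letter (x : S.group) (l : Fin g × Bool) :
    S.cayleyGraph.Adj x (x * S.letter l) := by
  refine (SimpleGraph.mulCayley_adj' _ _ _).2 ⟨fun h => S.letter_ne_one l (by simpa using h), ?_⟩
  obtain ⟨i, b⟩ := l
  refine ⟨S.generator i, ⟨i, rfl⟩, ?_⟩
  cases b with
  | true => exact .inl rfl
  | false => exact .inr (inv_mul_cancel_right x (S.generator i)).symm

theorem length_word_of_adj {x y : S.group} (h : S.cayleyGraph.Adj x y) :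
    (S.word (x⁻¹ * y)).length ≤ 1 := by
  obtain ⟨-, s, ⟨i, hs⟩, h⟩ := (SimpleGraph.mulCayley_adj' _ _ _).1 h
  have key : ∀ l, (S.word (S.letter l)).length ≤ 1 := fun l => by
    rw [← freeEquiv_letter, word, MulEquiv.symm_apply_apply]
    exact FreeGroup.norm_mk_le
  have hs' : s = S.generator i := Subtype.ext hs
  subst hs'
  rcases h with rfl | rfl
  · rw [inv_mul_cancel_left]
    exact key (i, true)
  · rw [mul_inv_rev, inv_mul_cancel_right]
    exact key (i, false)

theorem exists_walk : ∀ (L : List (Fin g × Bool)) (x : S.group),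
    ∃ p : S.cayleyGraph.Walk x (x * (L.map S.letter).prod), p.length = L.length
  | [], x => ⟨SimpleGraph.Walk.nil.copy rfl (by simp), by simp⟩
  | l :: L, x => by
    obtain ⟨p, hp⟩ := exists_walk L (x * S.letter l)
    refine ⟨(SimpleGraph.Walk.cons (S.cayleyGraph_adj_mul_letter x l) p).copy rfl
      (by simp [mul_assoc]), ?_⟩
    simp [hp]

theorem exists_walk_length_eq (x y : S.group) :
    ∃ p : S.cayleyGraph.Walk x y, p.length = (S.word (x⁻¹ * y)).length := by
  obtain ⟨p, hp⟩ := S.exists_walk (S.word (x⁻¹ * y)) x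
  refine ⟨p.copy rfl (by rw [prod_word, mul_inv_cancel_left]), ?_⟩
  rw [SimpleGraph.Walk.length_copy, hp]

theorem length_word_le_length {x y : S.group} (p : S.cayleyGraph.Walk x y) :
    (S.word (x⁻¹ * y)).length ≤ p.length := by
  induction p with
  | nil => simp [word]
  | @cons u v w h p ih =>
    have := S.length_word_mul_le (u⁻¹ * v) (v⁻¹ * w)
    rw [mul_assoc, mul_inv_cancel_left] at this
    have h1 := S.length_word_of_adj h
    rw [SimpleGraph.Walk.length_cons]
    omega

theorem connected_cayleyGraph : S.cayleyGraph.Connected :=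
  { preconnected := fun x y => ⟨(S.exists_walk_length_eq x y).choose⟩
    nonempty := ⟨1⟩ }

/-- Reading the reduced word gives a walk of that length; subadditivity of word length shows that no
walk is shorter. -/
theorem cayleyDist_eq (x y : S.group) : S.cayleyDist x y = (S.word (x⁻¹ * y)).length := by
  obtain ⟨p, hp⟩ := S.exists_walk_length_eq x y
  obtain ⟨q, hq⟩ := (S.connected_cayleyGraph.preconnected x y).exists_walk_length_eq_dist
  rw [cayleyDist]
  congr 1
  exact le_antisymm ((SimpleGraph.dist_le p).trans hp.le) (hq ▸ S.length_word_le_length q)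

theorem cayleyDist_smul_smul (γ x y : S.group) :
    S.cayleyDist (γ • x) (γ • y) = S.cayleyDist x y := by
  rw [cayleyDist_eq, cayleyDist_eq, smul_eq_mul, smul_eq_mul, mul_inv_rev, mul_assoc,
    inv_mul_cancel_left]

/-- The difference depends on the first letter alone, so the Busemann limit exists as soon as the
first letter stabilises. -/
theorem cayleyDist_one_sub (l : Fin g × Bool) (z : S.group) :
    S.cayleyDist 1 z - S.cayleyDist (S.letter l) z =
      if (S.word z).head? = some l then 1 else -1 := by
  rw [cayleyDist_eq, cayleyDist_eq, length_word_letter_inv_mul, inv_one, one_mul]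
  ring

end SchottkyGenerators

end PingPong

/-! ### Translation of Busemann limits. -/

section BusemannTransport

variable {Γ Λ P : Type*} [Group Γ] [TopologicalSpace Λ] [MulAction Γ Λ] [ContinuousConstSMul Γ Λ]
  [MulAction Γ P] {d : P → P → ℝ} {F : Λ → Filter P}

/-- Carries the limits for the edges at `1` of the Cayley graph to all other edges. -/
theorem HasBusemannLimit.smul {x y : P} (h : HasBusemannLimit d F x y)
    (hF : ∀ (γ : Γ) ξ, Tendsto (γ • ·) (F ξ) (F (γ • ξ)))
    (hd : ∀ (γ : Γ) x y, d (γ • x) (γ • y) = d x y) (γ : Γ) :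
    HasBusemannLimit d F (γ • x) (γ • y) := by
  obtain ⟨β, hβ⟩ := h
  refine ⟨⟨fun ξ => β (γ⁻¹ • ξ), β.continuous.comp (continuous_const_smul γ⁻¹)⟩, fun ξ => ?_⟩
  refine ((hβ (γ⁻¹ • ξ)).comp (hF γ⁻¹ ξ)).congr fun z => ?_
  rw [Function.comp_apply, ← hd γ x, ← hd γ y, smul_inv_smul]

end BusemannTransport

/-! ### Limit set of a Schottky group and convergence of words. -/

section SchottkyBoundary

open scoped MatrixGroups

namespace SchottkyGenerators

variable {g : ℕ} (S : SchottkyGenerators g)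

theorem neBot_nhdsNE_onePoint (η : OnePoint ℂ) : (𝓝[≠] η).NeBot := by
  induction η using OnePoint.rec with
  | infty => infer_instance
  | coe z => infer_instance

/-- Along an ultrafilter the first letter `l` and the last letter `k` are constant. A point `η` of
the open disc of `k`, distinct from the exceptional point of the projective limit, satisfies `z η →
ξ`, while ping-pong keeps `z η` in the closed disc of `l`. -/
theorem exists_mem_closedDisc {G : Ultrafilter S.group} {p : HypSpace} {ξ : OnePoint ℂ}
    (h : Tendsto (fun z : S.group => ((z : PSL(2, ℂ)) • p).toBall) G (𝓝 (sphereToBall ξ))) :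
    ∃ l, ξ ∈ S.closedDisc l ∧ ∀ᶠ z in (G : Filter S.group), (S.word z).head? = some l := by
  have hsurj : ∀ z : S.group, ∃ A : SL(2, ℂ), (A : PSL(2, ℂ)) = z := fun z =>
    QuotientGroup.mk_surjective _
  choose Z hZ using hsurj
  have hZ' : Tendsto (fun z => (Z z • p).toBall) G (𝓝 (sphereToBall ξ)) :=
    h.congr fun z => by rw [← hZ, mk_smul_hyp]
  obtain ⟨-, η₀, hη₀⟩ := tendsto_smul_of_tendsto_toBall hZ'
  obtain ⟨⟨a, b⟩, hab⟩ :=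
    (G.map fun z => ((S.word z).head?, (S.word z).getLast?)).eq_pure_of_finite
  have hev : ∀ᶠ z in (G : Filter S.group),
      (S.word z).head? = a ∧ (S.word z).getLast? = b := by
    have : {(a, b)} ∈ G.map fun z => ((S.word z).head?, (S.word z).getLast?) := by
      rw [hab]; exact rfl
    filter_upwards [this] with z hz
    exact Prod.ext_iff.1 hz
  -- The empty word would make `z p = p` constant, and an interior point is not on the sphere.
  have hnil : ¬ ∀ᶠ z in (G : Filter S.group), S.word z = [] := fun hn => by
    have h1 : Tendsto (fun _ : S.group => p.toBall) G (𝓝 (sphereToBall ξ)) :=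
      h.congr' (hn.mono fun z hz => by rw [S.word_eq_nil hz, Subgroup.coe_one, one_smul])
    have := congrArg Matrix.det (tendsto_nhds_unique tendsto_const_nhds h1)
    rw [det_sphereToBall] at this
    exact p.det_toBall_ne_zero this
  cases a with
  | none => exact absurd (hev.mono fun z hz => List.head?_eq_none_iff.1 hz.1) hnil
  | some l =>
    cases b with
    | none => exact absurd (hev.mono fun z hz => List.getLast?_eq_none_iff.1 hz.2) hnil
    | some k =>
      refine ⟨l, ?_, hev.mono fun z hz => hz.1⟩
      have := neBot_nhdsNE_onePoint η₀
      have hk := S.isJordanDomain (cond k.2 (.inr k.1) (.inl k.1))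
      obtain ⟨η, hηη₀, hη⟩ := (dense_compl_singleton η₀).exists_mem_open hk.1 hk.2.1.nonempty
      have hηk : η ∉ S.closedDisc (k.1, !k.2) := fun h' =>
        (S.disjoint_closedDisc (flip_ne k)).le_bot ⟨h', subset_closure hη⟩
      refine (S.isClosed_closedDisc l).mem_of_tendsto (hη₀ η hηη₀) ?_
      filter_upwards [hev] with z hz
      rw [← mk_smul_sphere, hZ]
      exact S.smul_mem_closedDisc hz.1 hz.2 hηk

/-- The discs are disjoint, so every ultrafilter finer than the filter yields the same letter; this
gives the statement for the filter. -/
theorem eventually_head {p : HypSpace} {ξ : limitSet S.group} {l : Fin g × Bool}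
    (hl : (ξ : OnePoint ℂ) ∈ S.closedDisc l) :
    ∀ᶠ z in S.nhdsVertices p ξ, (S.word z).head? = some l := by
  refine mem_iff_ultrafilter.2 fun G hG => ?_
  obtain ⟨k, hk, h⟩ := S.exists_mem_closedDisc (tendsto_comap.mono_left hG)
  obtain rfl : l = k := by
    by_contra hne
    exact (S.disjoint_closedDisc hne).le_bot ⟨hl, hk⟩
  exact h

/-- The limit set is defined with the orbit of the origin, the filter with that of `p`; along an
ultrafilter both orbits have the same limit. -/
theorem nhdsVertices_neBot (p : HypSpace) (ξ : limitSet S.group) : (S.nhdsVertices p ξ).NeBot := by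
  have h0 : (comap (fun z : S.group => ((z : PSL(2, ℂ)) • HypSpace.origin).toBall)
      (𝓝 (sphereToBall ξ))).NeBot := by
    refine comap_neBot_iff_frequently.2 ?_
    exact (mem_closure_iff_frequently.1 ξ.2)
  let G := Ultrafilter.of (comap (fun z : S.group => ((z : PSL(2, ℂ)) • HypSpace.origin).toBall)
      (𝓝 (sphereToBall ξ)))
  have hG : Tendsto (fun z : S.group => ((z : PSL(2, ℂ)) • HypSpace.origin).toBall) G
      (𝓝 (sphereToBall ξ)) := tendsto_comap.mono_left (Ultrafilter.of_le _)
  have hsurj : ∀ z : S.group, ∃ A : SL(2, ℂ), (A : PSL(2, ℂ)) = z := fun z =>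
    QuotientGroup.mk_surjective _
  choose Z hZ using hsurj
  have hact : ∀ (q : HypSpace) (z : S.group), ((z : PSL(2, ℂ)) • q).toBall = (Z z • q).toBall :=
      fun q z => by
    rw [← hZ, mk_smul_hyp]
  have h1 := (tendsto_smul_of_tendsto_toBall (hG.congr (hact _))).1 p
  exact G.neBot.mono (tendsto_iff_comap.1 (h1.congr fun z => (hact p z).symm))

theorem exists_mem_closedDisc_of_mem_limitSet (ξ : limitSet S.group) :
    ∃ l, (ξ : OnePoint ℂ) ∈ S.closedDisc l := by
  have := S.nhdsVertices_neBot HypSpace.origin ξ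
  obtain ⟨l, hl, -⟩ := S.exists_mem_closedDisc (tendsto_comap.mono_left
    (Ultrafilter.of_le (S.nhdsVertices HypSpace.origin ξ)))
  exact ⟨l, hl⟩

theorem tendsto_smul_nhdsVertices (p : HypSpace) (γ : S.group) (ξ : limitSet S.group) :
    Tendsto (γ • ·) (S.nhdsVertices p ξ) (S.nhdsVertices p (γ • ξ)) := by
  obtain ⟨A, hA⟩ := QuotientGroup.mk_surjective (γ : PSL(2, ℂ))
  refine tendsto_comap_iff.2 ?_
  have hξ : sphereToBall (γ • ξ : limitSet S.group) = ballAct A (sphereToBall ξ) := by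
    rw [← sphereToBall_smul, ← mk_smul_sphere]
    exact congrArg (fun δ : PSL(2, ℂ) => sphereToBall (δ • (ξ : OnePoint ℂ))) hA.symm
  rw [hξ]
  refine ((continuousAt_ballAct A ξ).tendsto.comp tendsto_comap).congr fun z => ?_
  obtain ⟨B, hB⟩ := QuotientGroup.mk_surjective (z : PSL(2, ℂ))
  simp only [Function.comp_apply, smul_eq_mul, Subgroup.coe_mul]
  rw [mul_smul, ← hA, ← hB, mk_smul_hyp, mk_smul_hyp, ballAct_toBall]

/-- Finitely many disjoint closed discs cover the limit set, so each cuts out a set with closed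
complement. This makes the Busemann function continuous. -/
theorem isClopen_closedDisc (l : Fin g × Bool) :
    IsClopen {ξ : limitSet S.group | (ξ : OnePoint ℂ) ∈ S.closedDisc l} := by
  refine ⟨(S.isClosed_closedDisc l).preimage continuous_subtype_val, ?_⟩
  have h : {ξ : limitSet S.group | (ξ : OnePoint ℂ) ∈ S.closedDisc l}ᶜ =
      ⋃ k ∈ {k | k ≠ l}, {ξ : limitSet S.group | (ξ : OnePoint ℂ) ∈ S.closedDisc k} := by
    ext ξ
    simp only [mem_compl_iff, mem_ofPred_eq, mem_iUnion, exists_prop]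
    refine ⟨fun hξ => ?_, fun ⟨k, hkl, hk⟩ hl => (S.disjoint_closedDisc hkl).le_bot ⟨hk, hl⟩⟩
    obtain ⟨k, hk⟩ := S.exists_mem_closedDisc_of_mem_limitSet ξ
    exact ⟨k, fun e => hξ (e ▸ hk), hk⟩
  rw [← isClosed_compl_iff, h]
  exact (toFinite _).isClosed_biUnion fun k _ =>
    (S.isClosed_closedDisc k).preimage continuous_subtype_val

open Classical in
theorem hasBusemannLimit_one_letter (p : HypSpace) (l : Fin g × Bool) :
    HasBusemannLimit S.cayleyDist (S.nhdsVertices p) 1 (S.letter l) := by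
  refine ⟨⟨fun ξ : limitSet S.group => if (ξ : OnePoint ℂ) ∈ S.closedDisc l then 1 else -1,
    continuous_const.if (by
      simp only [(S.isClopen_closedDisc l).frontier_eq]; simp) continuous_const⟩, fun ξ => ?_⟩
  obtain ⟨k, hk⟩ := S.exists_mem_closedDisc_of_mem_limitSet ξ
  refine tendsto_const_nhds.congr' ?_
  filter_upwards [S.eventually_head (p := p) hk] with z hz
  have : (ξ : OnePoint ℂ) ∈ S.closedDisc l ↔ k = l :=
    ⟨fun hl => by_contra fun hne => (S.disjoint_closedDisc hne).le_bot ⟨hk, hl⟩, fun e => e ▸ hk⟩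
  simp only [cayleyDist_one_sub, hz, Option.some.injEq, ContinuousMap.coe_mk, this]

/-- Telescoping along the path from `x` to `y` spelled by the reduced word of `x⁻¹ y`. -/
theorem hasBusemannLimit (p : HypSpace) (x y : S.group) :
    HasBusemannLimit S.cayleyDist (S.nhdsVertices p) x y := by
  have key : ∀ (L : List (Fin g × Bool)) (x : S.group),
      HasBusemannLimit S.cayleyDist (S.nhdsVertices p) x (x * (L.map S.letter).prod) := by
    intro L
    induction L with
    | nil => intro x; simpa using HasBusemannLimit.refl x
    | cons l L ih =>
      intro x
      have h1 := (S.hasBusemannLimit_one_letter p l).smul (S.tendsto_smul_nhdsVertices p)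
        S.cayleyDist_smul_smul x
      rw [smul_eq_mul, smul_eq_mul, mul_one] at h1
      have h2 := h1.trans (ih (x * S.letter l))
      rwa [mul_assoc, ← List.prod_cons, ← List.map_cons] at h2
  have := key (S.word (x⁻¹ * y)) x
  rwa [prod_word, mul_inv_cancel_left] at this

theorem hypDist_smul_smul (p : HypSpace) (γ x y : S.group) :
    S.hypDist p (γ • x) (γ • y) = S.hypDist p x y := by
  obtain ⟨A, hA⟩ := QuotientGroup.mk_surjective (γ : PSL(2, ℂ))
  rw [hypDist, hypDist, smul_eq_mul, smul_eq_mul, Subgroup.coe_mul, Subgroup.coe_mul, mul_smul,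
    mul_smul, ← hA, mk_smul_hyp, mk_smul_hyp, HypSpace.dist_smul_smul]

theorem busemannDynamicsImplemented (p : HypSpace) (x₀ : S.group) (μ : Measure (limitSet S.group))
    (hμ : IsPattersonSullivan S.group S.cayleyDist (S.nhdsVertices p) x₀ μ ∨
      IsPattersonSullivan S.group (S.hypDist p) (S.nhdsVertices p) x₀ μ) :
    BusemannDynamicsImplemented S.group S.cayleyDist (S.nhdsVertices p) x₀ μ := by
  have : IsProbabilityMeasure μ := hμ.elim (·.isProbabilityMeasure) (·.isProbabilityMeasure)
  have : TopologicalSpace.MetrizableSpace (Matrix (Fin 2) (Fin 2) ℂ) :=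
    inferInstanceAs (TopologicalSpace.MetrizableSpace (Fin 2 → Fin 2 → ℂ))
  have he : Continuous fun ξ : limitSet S.group => sphereToBall ξ :=
    continuous_sphereToBall.comp continuous_subtype_val
  have hinj : Function.Injective fun ξ : limitSet S.group => sphereToBall ξ :=
    sphereToBall_injective.comp Subtype.val_injective
  have hF := S.tendsto_smul_nhdsVertices p
  have hj : ∀ ξ, Tendsto (fun z : S.group => ((z : PSL(2, ℂ)) • p).toBall) (S.nhdsVertices p ξ)
      (𝓝 (sphereToBall ξ)) := fun ξ => tendsto_comap
  refine busemannDynamicsImplemented_of_tendsto (S.nhdsVertices_neBot p) hF S.cayleyDist_smul_smul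
    (S.hasBusemannLimit p) ?_
  -- The cocycle always comes from the Cayley distance, whereas quasi-invariance is proved with the
  -- distance that defines `μ`; either one is invariant and varies boundedly with the base point.
  rcases hμ with hμ | hμ
  · exact map_smul_absolutelyContinuous he hinj hj hF S.cayleyDist_smul_smul
      (fun γ => ⟨_, S.connected_cayleyGraph.abs_dist_sub_dist_le x₀ (γ • x₀)⟩) hμ
  · refine map_smul_absolutelyContinuous he hinj hj hF (S.hypDist_smul_smul p) (fun γ => ?_) hμ
    obtain ⟨C, hC⟩ := HypSpace.exists_abs_dist_sub_dist_le ((x₀ : PSL(2, ℂ)) • p)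
      (((γ • x₀ : S.group) : PSL(2, ℂ)) • p)
    exact ⟨C, fun z => hC _⟩

end SchottkyGenerators

end SchottkyBoundary

theorem mainTheorem7 :
    -- the boundary of the universal covering tree of a finite graph
    (∀ {V E W : Type*} [Finite V] [Finite E] (X : MultiGraph V E), X.Connected →
      2 ≤ X.bettiNumber → (∀ v, 3 ≤ X.valency v) →
      ∀ {T : SimpleGraph W} (c : X.UniversalCovering T) (x₀ : W) (μ : Measure c.Boundary),
        IsPattersonSullivan c.deckGroup c.dist c.nhdsVertices x₀ μ →
        BusemannDynamicsImplemented c.deckGroup c.dist c.nhdsVertices x₀ μ) ∧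
    -- the limit set of a Schottky group
    (∀ {g : ℕ} (S : SchottkyGenerators g) (p : HypSpace) (x₀ : S.group)
      (μ : Measure (limitSet S.group)),
        (IsPattersonSullivan S.group S.cayleyDist (S.nhdsVertices p) x₀ μ ∨
          IsPattersonSullivan S.group (S.hypDist p) (S.nhdsVertices p) x₀ μ) →
        BusemannDynamicsImplemented S.group S.cayleyDist (S.nhdsVertices p) x₀ μ) :=
  ⟨fun X _ _ _ _ c x₀ μ hμ => busemannDynamicsImplemented_tree X c x₀ μ hμ,
    fun S p x₀ μ hμ => S.busemannDynamicsImplemented p x₀ μ hμ⟩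

end
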